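/- Let $\Omega\subset\mathbb R^2=\mathbb C$ be a bounded simply connected domain and let $\lambda,\mu$ be real (Lamé) parameters with $2\mu+\lambda\neq0$; put $k_0=\frac{\mu}{2(2\mu+\lambda)}$. A regular parametrization of $\partial\Omega$ is a $2\pi$-periodic $C^1$ map $q:\mathbb R\to\mathbb C$ with $q'\ne0$, injective on $[-\pi,\pi)$, with $q(\mathbb R)=\partial\Omega$ and $\Omega$ on its left; the outward unit normal at $\mathbf y=q(s)$ is $\mathbf n_{\mathbf y}=-iq'(s)/|q'(s)|$ and $d\sigma(\mathbf y)=|q'(s)|\,ds$. We say that $\partial\Omega$ is $C^{k,\alpha}$ (respectively real analytic) if it has a regular parametrization that is $C^{k,\alpha}$ (respectively real analytic). Let $$K_0(\mathbf x,\mathbf y)=\frac{(\mathbf y-\mathbf x)\cdot\mathbf n_{\mathbf y}}{2\pi|\mathbf x-\mathbf y|^2},\qquad \mathbf K_2(\mathbf x,\mathbf y)=\frac{\mu}{2\mu+\lambda}\frac{(\mathbf x-\mathbf y)\cdot\mathbf n_{\mathbf y}}{2\pi|\mathbf x-\mathbf y|^2}\mathbf I+\frac{2(\mu+\lambda)}{2\mu+\lambda}\frac{(\mathbf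 x-\mathbf y)\cdot\mathbf n_{\mathbf y}}{2\pi|\mathbf x-\mathbf y|^4}(\mathbf x-\mathbf y)(\mathbf x-\mathbf y)^{\top},$$ let $\mathcal K$ and $\mathbf T_2$ be the integral operators on $\partial\Omega$ with kernels $K_0$ and $\mathbf K_2$ with respect to $d\sigma(\mathbf y)$, and let $\mathbf B=\mathrm{diag}(\mathcal K,\mathcal K)$. (i) Let $k\in\mathbb N$ and $0\le\alpha<1$ with $k+\alpha>2$, suppose that $\partial\Omega$ is $C^{k,\alpha}$, and let $q$ be any $C^{k,\alpha}$ regular parametrization of it. Then the parametrized kernels $K_0(q(t),q(s))\,|q'(s)|\,\mathbf I$ of $\mathbf B$ and $\mathbf K_2(q(t),q(s))\,|q'(s)|$ of $\mathbf T_2$, defined for $q(t)\neq q(s)$, extend to functions on $\mathbb R^2$ of class $C^{k-2,\alpha}$ jointly in $(t,s)$. (ii) Suppose that $\partial\Omega$ is real analytic. Let $\Phi$ be a Riemann mapping of the unit disc onto $\Omega$, extended continuously to the closed disc, and let $q(s)=\Phi(e^{is})$. Let $\varepsilon_q\in[0,\infty]$ be the modified maximal Grauert radius of $q$, that is, the supremum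 of the $\varepsilon>0$ such that $q$ extends holomorphically to $\mathbb R\times i(-\varepsilon,\varepsilon)$ and, for $t\in[-\pi,\pi)\times i(-\varepsilon,\varepsilon)$ and $s\in[-\pi,\pi)$, $q(t)=q(s)$ implies $t=s$. For real $f\in L^2(\partial\Omega)$ let $\mathcal H[f]$ be its Hilbert transform: the real function in $L^2(\partial\Omega)$ such that $f+i\mathcal H[f]$ is the $L^2$ boundary value of a holomorphic function $F$ in $\Omega$ (that is, $F(\Phi(re^{is}))\to (f+i\mathcal H[f])(q(s))$ in $L^2(-\pi,\pi)$ as $r\to1^-$) with $\operatorname{Im}F(\Phi(0))=0$; and let $\mathbf H=\begin{bmatrix}0&-\mathcal H\\ \mathcal H&0\end{bmatrix}$. For every $0<\varepsilon<\varepsilon_q$: there is a unique continuous $2\times2$ real matrix-valued function $T_q(t,s)$ on $\mathbb R^2$ (independent of $\varepsilon$), $2\pi$-periodic in $t$ and in $s$, such that $$(2k_0\mathbf B\mathbf H+\mathbf T_2)[\varphi](q(t))=\int_{-\pi}^{\pi}T_q(t,s)\,\varphi(q(s))\,ds$$ for all $\varphi\in L^2(\partial\Omega)^2$ and all $t\in\mathbb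 R$; and there is a constant $C$ such that its Fourier coefficients $$a_n^q(s)=\frac1{2\pi}\int_{-\pi}^{\pi}T_q(t,s)e^{-int}\,dt$$ satisfy $|a_n^q(s)|\le Ce^{-\varepsilon|n|}$ for all $n\in\mathbb Z$ and all $s\in[-\pi,\pi)$, where $|a_n^q(s)|$ is the maximum of the absolute values of the entries. -/

import Mathlib

open MeasureTheory Filter Topology Set
open scoped ENNReal NNReal

noncomputable section

namespace ElasticNP

/-! ### Domains and parametrizations of their boundaries

The plane is identified with `ℂ`.  A closed curve is given by a `2π`-periodic map `q : ℝ → ℂ`. -/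

/-- A (nonempty) bounded simply connected domain of the plane. -/
structure IsSimplyConnectedDomain (Ω : Set ℂ) : Prop where
  isOpen : IsOpen Ω
  bounded : Bornology.IsBounded Ω
  simplyConnected : IsSimplyConnected Ω

/-- `q` is a regular (`C¹`, nonvanishing speed) `2π`-periodic parametrization of the boundary of
`Ω`, one-to-one on a period and positively oriented: `Ω` lies on the left of the curve. -/
structure IsRegularParam (Ω : Set ℂ) (q : ℝ → ℂ) : Prop where
  periodic : Function.Periodic q (2 * Real.pi)
  contDiff : ContDiff ℝ 1 q
  deriv_ne_zero : ∀ s, deriv q s ≠ 0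
  injOn : InjOn q (Ico (-Real.pi) Real.pi)
  range_eq : range q = frontier Ω
  leftSide : ∀ s, ∀ᶠ τ : ℝ in 𝓝[>] 0,
    q s + τ * (Complex.I * deriv q s) ∈ Ω ∧ q s - τ * (Complex.I * deriv q s) ∉ Ω

/-- `f` is of class `C^{k,α}`: `k` times continuously differentiable with the derivative of order
`k` uniformly Hölder continuous of exponent `α`.  (Used for periodic functions only; for them the
case `α = 0` is just `C^k`.) -/
def IsCkHolder {E F : Type*} [NormedAddCommGroup E] [NormedSpace ℝ E]
    [NormedAddCommGroup F] [NormedSpace ℝ F] (k : ℕ) (α : ℝ≥0) (f : E → F) : Prop :=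
  ContDiff ℝ k f ∧ ∃ C : ℝ≥0, HolderWith C α (iteratedFDeriv ℝ k f)

/-- The boundary of `Ω` is real analytic: it has a regular real analytic parametrization. -/
def HasAnalyticBoundary (Ω : Set ℂ) : Prop :=
  ∃ q : ℝ → ℂ, IsRegularParam Ω q ∧ AnalyticOnNhd ℝ q univ

/-- `Φ` is a Riemann mapping from the open unit disc onto `Ω`. -/
structure IsRiemannMap (Ω : Set ℂ) (Φ : ℂ → ℂ) : Prop where
  holo : DifferentiableOn ℂ Φ (Metric.ball 0 1)
  injOn : InjOn Φ (Metric.ball 0 1)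
  image_eq : Φ '' Metric.ball 0 1 = Ω

/-- `q` is the parametrization by the Riemann mapping `Φ`, that is `q(s) = Φ(e^{is})`, where `Φ` on
the unit circle is the continuous extension of `Φ` from the open disc. -/
def IsParamByRiemannMap (Φ : ℂ → ℂ) (q : ℝ → ℂ) : Prop :=
  ∀ s : ℝ, Tendsto Φ (𝓝[Metric.ball 0 1] (Complex.exp (s * Complex.I))) (𝓝 (q s))

/-- `q` extends holomorphically to the strip `|Im t| < ε`, and the extension satisfies condition
(G): it takes a value `q(s)` with `s ∈ [-π, π)` at no point of `[-π, π) × i(-ε, ε)` except `s`. -/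
def IsGrauertAdmissible (q : ℝ → ℂ) (ε : ℝ) : Prop :=
  ∃ Q : ℂ → ℂ, DifferentiableOn ℂ Q {t : ℂ | |t.im| < ε} ∧ (∀ s : ℝ, Q s = q s) ∧
    ∀ t : ℂ, t.re ∈ Ico (-Real.pi) Real.pi → |t.im| < ε →
      ∀ s ∈ Ico (-Real.pi) Real.pi, Q t = q s → t = (s : ℂ)

/-- The modified maximal Grauert radius `ε_q ∈ [0, ∞]` of `q`. -/
def grauertRadius (q : ℝ → ℂ) : ℝ≥0∞ :=
  sSup {r : ℝ≥0∞ | ∃ ε : ℝ, 0 < ε ∧ IsGrauertAdmissible q ε ∧ r = ENNReal.ofReal ε}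

/-! ### Kernels -/

/-- The outward unit normal `-i q'(s)/|q'(s)|` at the point `q(s)` of a positively oriented
curve. -/
def unitNormal (q : ℝ → ℂ) (s : ℝ) : ℂ := -Complex.I * deriv q s / (‖deriv q s‖ : ℂ)

/-- A point of the plane as a coordinate vector. -/
def toVec (z : ℂ) : Fin 2 → ℝ := ![z.re, z.im]

/-- The kernel `(y - x)·n / (2π |x - y|²)` of the electrostatic Neumann–Poincaré operator, `n` being
the normal at `y`. -/
def kernelK (x y n : ℂ) : ℝ := inner ℝ (y - x) n / (2 * Real.pi * ‖x - y‖ ^ 2)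

/-- The matrix kernel of `B = diag(K, K)`. -/
def kernelB (x y n : ℂ) : Matrix (Fin 2) (Fin 2) ℝ := !![kernelK x y n, 0; 0, kernelK x y n]

/-- The matrix kernel of `T₂`, for the Lamé parameters `lam`, `mu`. -/
def kernelT2 (lam mu : ℝ) (x y n : ℂ) : Matrix (Fin 2) (Fin 2) ℝ :=
  (mu / (2 * mu + lam) * (inner ℝ (x - y) n / (2 * Real.pi * ‖x - y‖ ^ 2))) •
      (1 : Matrix (Fin 2) (Fin 2) ℝ) +
    (2 * (mu + lam) / (2 * mu + lam) * (inner ℝ (x - y) n / (2 * Real.pi * ‖x - y‖ ^ 4))) •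
      Matrix.vecMulVec (toVec (x - y)) (toVec (x - y))

/-- The kernel `k(x, y, n_y)` on the boundary after parametrization by `q`:
`k(q(t), q(s), n_{q(s)}) |q'(s)|`, relative to `ds`.  It is meaningful for `q(t) ≠ q(s)`. -/
def paramKernel (k : ℂ → ℂ → ℂ → Matrix (Fin 2) (Fin 2) ℝ) (q : ℝ → ℂ) (t s : ℝ) :
    Matrix (Fin 2) (Fin 2) ℝ :=
  ‖deriv q s‖ • k (q t) (q s) (unitNormal q s)

/-- A parametrized kernel, defined for `q(t) ≠ q(s)`, is of class `C^{m,α}` jointly in `(t, s)`: it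
has an extension to all `(t, s)` whose entries are of class `C^{m,α}`. -/
def IsCkHolderKernel (m : ℕ) (α : ℝ≥0) (q : ℝ → ℂ) (M : ℝ → ℝ → Matrix (Fin 2) (Fin 2) ℝ) :
    Prop :=
  ∃ A : ℝ → ℝ → Matrix (Fin 2) (Fin 2) ℝ, (∀ t s, q t ≠ q s → A t s = M t s) ∧
    ∀ i j, IsCkHolder m α (fun p : ℝ × ℝ => A p.1 p.2 i j)

/-! ### Operators

Densities are functions on the boundary, `f : ℂ → ℝ` or `φ : ℂ → Fin 2 → ℝ`, of which only the
values on the range of `q` matter; `∫_{∂Ω} f dσ = ∫_{-π}^{π} f(q(s)) |q'(s)| ds`. -/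

/-- Square integrable real functions on the boundary. -/
def IsL2 (q : ℝ → ℂ) (f : ℂ → ℝ) : Prop :=
  MemLp (fun s => f (q s)) 2 (volume.restrict (Ioc (-Real.pi) Real.pi))

/-- `g` is a Hilbert transform of `f` on the boundary of `Ω`: `f + i g` is the `L²` boundary value
(along the level curves `|Φ⁻¹| = r`, `r → 1`) of a holomorphic function `F` in `Ω`; the additive
constant in `g` is fixed by `Im F(Φ(0)) = 0`. -/
def IsHilbertTransform (Ω : Set ℂ) (Φ : ℂ → ℂ) (q : ℝ → ℂ) (f g : ℂ → ℝ) : Prop :=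
  IsL2 q g ∧ ∃ F : ℂ → ℂ, DifferentiableOn ℂ F Ω ∧ (F (Φ 0)).im = 0 ∧
    Tendsto (fun r : ℝ => eLpNorm
        (fun s : ℝ => F (Φ (r * Complex.exp (s * Complex.I))) -
          ((f (q s) : ℂ) + Complex.I * (g (q s) : ℂ)))
        2 (volume.restrict (Ioc (-Real.pi) Real.pi)))
      (𝓝[<] 1) (𝓝 0)

/-- The Hilbert transform on the boundary (a representative of it; it is determined almost
everywhere). -/
def hilbertTransform (Ω : Set ℂ) (Φ : ℂ → ℂ) (q : ℝ → ℂ) (f : ℂ → ℝ) : ℂ → ℝ :=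
  Classical.epsilon (IsHilbertTransform Ω Φ q f)

/-- `H = [[0, -ℋ], [ℋ, 0]]`. -/
def opH (Ω : Set ℂ) (Φ : ℂ → ℂ) (q : ℝ → ℂ) (φ : ℂ → Fin 2 → ℝ) : ℂ → Fin 2 → ℝ :=
  fun x => ![-hilbertTransform Ω Φ q (fun y => φ y 1) x, hilbertTransform Ω Φ q (fun y => φ y 0) x]

/-- The operator on the boundary with the matrix kernel `k(x, y, n_y)` relative to `dσ(y)`. -/
def integralOp (k : ℂ → ℂ → ℂ → Matrix (Fin 2) (Fin 2) ℝ) (q : ℝ → ℂ) (φ : ℂ → Fin 2 → ℝ) :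
    ℂ → Fin 2 → ℝ :=
  fun x => ∫ s in (-Real.pi)..Real.pi, ‖deriv q s‖ • (k x (q s) (unitNormal q s)).mulVec (φ (q s))

/-- The constant `k₀ = μ / (2(2μ + λ))`. -/
def k0 (lam mu : ℝ) : ℝ := mu / (2 * (2 * mu + lam))

/-- The operator `2 k₀ B H + T₂`. -/
def opT (lam mu : ℝ) (Ω : Set ℂ) (Φ : ℂ → ℂ) (q : ℝ → ℂ) (φ : ℂ → Fin 2 → ℝ) : ℂ → Fin 2 → ℝ :=
  fun x => (2 * k0 lam mu) • integralOp kernelB q (opH Ω Φ q φ) x +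
    integralOp (kernelT2 lam mu) q φ x

/-- `T` is the (continuous, `2π`-periodic in both variables) integral kernel of `2 k₀ B H + T₂`
after parametrization by `q`, the operator acting on square integrable densities. -/
structure IsKernelOfOpT (lam mu : ℝ) (Ω : Set ℂ) (Φ : ℂ → ℂ) (q : ℝ → ℂ)
    (T : ℝ → ℝ → Matrix (Fin 2) (Fin 2) ℝ) : Prop where
  continuous : Continuous (fun p : ℝ × ℝ => T p.1 p.2)
  periodic_left : ∀ t s, T (t + 2 * Real.pi) s = T t s
  periodic_right : ∀ t s, T t (s + 2 * Real.pi) = T t s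
  represents : ∀ φ : ℂ → Fin 2 → ℝ, (∀ i, IsL2 q (fun y => φ y i)) → ∀ t : ℝ,
    opT lam mu Ω Φ q φ (q t) = ∫ s in (-Real.pi)..Real.pi, (T t s).mulVec (φ (q s))

/-- The Fourier coefficient `a_k(s) = (1/2π) ∫_{-π}^{π} T(t, s) e^{-ikt} dt`, entrywise. -/
def fourierCoeffKernel (T : ℝ → ℝ → Matrix (Fin 2) (Fin 2) ℝ) (k : ℤ) (s : ℝ) :
    Matrix (Fin 2) (Fin 2) ℂ :=
  Matrix.of fun i j => (1 / (2 * Real.pi) : ℂ) *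
    ∫ t in (-Real.pi)..Real.pi, (T t s i j : ℂ) * Complex.exp (-(Complex.I * k * t))

end ElasticNP

end

/-!
**Regularity of the parametrized kernels.** With `z = q(s) - q(t)` and `v = q'(s)` both kernels,
multiplied by `|q'(s)|`, are built from `Im (v / z)` and from the direction of `z` (`angleForm`,
`elasticForm`). By Taylor's formula `z = (s - t) a` and `v = a + (s - t) b`, where `a` and `b` are
means of `q'` and `q''` over the segment from `t` to `s`. The singular part `1 / (s - t)` of
`v / z` is real, so that it drops out: near the diagonal the kernels are the smooth functions
`angleForm a b`, `elasticForm a b` of `a ≠ 0` and `b`, which are of class `C^{k-2,α}`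
(`isCkHolderKernel_kernelB_kernelT2`).

**The analytic case.** By the three lines theorem the holomorphic extension of `q` to a strip
slightly wider than `|Im t| < ε` is a lift of the Riemann mapping, so that `Φ` extends to
a holomorphic function `Ψ` on a disc of radius `R > e^ε`; the condition in the definition of
the Grauert radius says that `Ψ` takes its values on the unit circle only once, and regularity of
the boundary says that `Ψ'` does not vanish there (`exists_isDiscExtension`). With `σ = e^{is}`, `τ = e^{it}`,
`∂_s log (q(s) - q(t)) = iσ / (σ - τ) + logRem(σ, τ)`, and `Re (σ / (σ - τ)) = 1/2` on the circle,
so that `𝒦` has the kernel `(1/2 + Im logRem) / 2π`. As a function of `σ`, `logRem` extends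
holomorphically to the disc and vanishes at `0`. The mean value property of its product with
`f + iℋ[f]` moves the Hilbert transform from the density to the kernel: `𝒦ℋ` has the kernel
`Re logRem / 2π` (`IsDiscExtension.integral_circleK_mul`). Likewise the direction `z / z̄` in the
kernel of `T₂` is a quotient of divided differences. The resulting kernel `circleT` of
`2 k₀ B H + T₂` is hence continuous. For fixed `σ` it is built from functions of `τ` that are
holomorphic for `|τ| < R`, and from their conjugates, which on the circle agree with the
holomorphic functions `conj (u (1 / conj τ))` of `|τ| > 1/R`; so it extends to the annulus
`1/R < |τ| < R`, and moving the circle of integration to `|τ| = e^{±ε}` gives the decay of the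
Fourier coefficients (`IsDiscExtension.exists_fourierCoeffKernel_bound`). A continuous kernel is
determined by the operator, since the difference of two of them is orthogonal to its own rows.

The Hilbert transform of a square integrable function exists: the part of the Fourier series of
`f ∘ q` of nonnegative frequencies, with the positive ones doubled, defines a holomorphic function
in the disc (`exists_hardy`), which is carried to `Ω` by the inverse of the Riemann mapping
(`IsDiscExtension.exists_isHilbertTransform`).
-/

open scoped ComplexConjugate

noncomputable section

namespace ElasticNP

/-! ### Local Hölder classes -/

section HolderClass

universe u

variable {E F G : Type u} [NormedAddCommGroup E] [NormedSpace ℝ E]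
  [NormedAddCommGroup F] [NormedSpace ℝ F] [NormedAddCommGroup G] [NormedSpace ℝ G]
  {α : ℝ≥0} {m : ℕ} {x : E}

/-- `f` is Hölder continuous of exponent `α` near `x`. -/
def LocHolderAt {X Y : Type*} [PseudoEMetricSpace X] [PseudoEMetricSpace Y] (α : ℝ≥0) (f : X → Y)
    (x : X) : Prop :=
  ∃ C : ℝ≥0, ∃ s ∈ 𝓝 x, HolderOnWith C α f s

/-- `f` is of class `C^{m,α}` near `x`. -/
def CkHolderAt (m : ℕ) (α : ℝ≥0) (f : E → F) (x : E) : Prop :=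
  ContDiffAt ℝ m f x ∧ LocHolderAt α (iteratedFDeriv ℝ m f) x

theorem LocHolderAt.of_edist_le {X Y Z : Type*} [PseudoEMetricSpace X] [PseudoEMetricSpace Y]
    [PseudoEMetricSpace Z] {f : X → Y} {g : X → Z} {x : X}
    (h : ∃ t ∈ 𝓝 x, ∀ a ∈ t, ∀ b ∈ t, edist (g a) (g b) ≤ edist (f a) (f b))
    (hf : LocHolderAt α f x) : LocHolderAt α g x := by
  obtain ⟨C, s, hs, hC⟩ := hf
  obtain ⟨t, ht, ht'⟩ := h
  exact ⟨C, s ∩ t, inter_mem hs ht, fun a ha b hb =>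
    (ht' a ha.2 b hb.2).trans (hC a ha.1 b hb.1)⟩

theorem CkHolderAt.congr {f g : E → F} (hf : CkHolderAt m α f x) (h : g =ᶠ[𝓝 x] f) :
    CkHolderAt m α g x := by
  refine ⟨hf.1.congr_of_eventuallyEq h, hf.2.of_edist_le ?_⟩
  have h2 := h.iteratedFDeriv ℝ m
  exact ⟨_, h2, fun a ha b hb => by rw [show _ = _ from ha, show _ = _ from hb]⟩

theorem ckHolderAt_zero {f : E → F} :
    CkHolderAt 0 α f x ↔ ContDiffAt ℝ 0 f x ∧ LocHolderAt α f x := by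
  refine and_congr Iff.rfl ⟨fun h => h.of_edist_le ?_, fun h => h.of_edist_le ?_⟩ <;>
  · refine ⟨univ, univ_mem, fun a _ b _ => ?_⟩
    rw [iteratedFDeriv_zero_eq_comp, Function.comp_apply, Function.comp_apply,
      LinearIsometryEquiv.edist_map]

theorem ckHolderAt_succ {f : E → F} :
    CkHolderAt (m + 1) α f x ↔
      (∀ᶠ y in 𝓝 x, DifferentiableAt ℝ f y) ∧ CkHolderAt m α (fderiv ℝ f) x := by
  have key : ∀ p : E × E, edist (iteratedFDeriv ℝ m (fderiv ℝ f) p.1)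
      (iteratedFDeriv ℝ m (fderiv ℝ f) p.2) =
      edist (iteratedFDeriv ℝ (m + 1) f p.1) (iteratedFDeriv ℝ (m + 1) f p.2) := fun p => by
    simp only [iteratedFDeriv_succ_eq_comp_right, Function.comp_apply,
      LinearIsometryEquiv.edist_map]
  constructor
  · rintro ⟨h1, h2⟩
    have h1' : ContDiffAt ℝ ((m : WithTop ℕ∞) + 1) f x := by exact_mod_cast h1
    refine ⟨?_, h1'.fderiv_right le_rfl, h2.of_edist_le ⟨univ, univ_mem, fun a _ b _ => (key (a, b)).le⟩⟩
    filter_upwards [h1'.eventually (by simp)] with y hy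
    exact hy.differentiableAt (by simp)
  · rintro ⟨h0, h1, h2⟩
    refine ⟨?_, h2.of_edist_le ⟨univ, univ_mem, fun a _ b _ => (key (a, b)).ge⟩⟩
    have : ContDiffAt ℝ ((m : WithTop ℕ∞) + 1) f x := by
      rw [contDiffAt_succ_iff_hasFDerivAt (n := m)]
      exact ⟨fderiv ℝ f, ⟨_, h0, fun y hy => DifferentiableAt.hasFDerivAt hy⟩, h1⟩
    exact_mod_cast this

theorem LocHolderAt.of_lipschitz {X Y : Type*} [PseudoMetricSpace X] [PseudoMetricSpace Y]
    {f : X → Y} {x : X} {K : ℝ≥0} {s : Set X} (hα : α ≤ 1) (hs : s ∈ 𝓝 x)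
    (hf : LipschitzOnWith K f s) : LocHolderAt α f x := by
  have hb : HolderOnWith K 1 f (s ∩ Metric.ball x 1) :=
    holderOnWith_one.2 (hf.mono inter_subset_left)
  refine ⟨_, _, inter_mem hs (Metric.ball_mem_nhds x one_pos),
    HolderOnWith.of_le (D := 2) (fun a ha b hb => ?_) hb hα⟩
  calc edist a b ≤ edist a x + edist b x := edist_triangle_right _ _ _
    _ ≤ 1 + 1 := by
        gcongr
        · rw [edist_dist]; exact ENNReal.ofReal_le_one.2 (Metric.mem_ball.1 ha.2).le
        · rw [edist_dist]; exact ENNReal.ofReal_le_one.2 (Metric.mem_ball.1 hb.2).le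
    _ = _ := by norm_num

theorem CkHolderAt.of_contDiffAt {f : E → F} (hα : α ≤ 1) (hf : ContDiffAt ℝ (m + 1 : ℕ) f x) :
    CkHolderAt m α f x := by
  refine ⟨hf.of_le (by exact_mod_cast Nat.le_succ m), ?_⟩
  have h1 : ContDiffAt ℝ 1 (iteratedFDeriv ℝ m f) x := by
    refine ContDiffAt.iteratedFDeriv_right (n := (m + 1 : ℕ)) hf ?_
    push_cast; rw [add_comm]
  obtain ⟨K, t, ht, hK⟩ := h1.exists_lipschitzOnWith
  exact .of_lipschitz hα ht hK

theorem CkHolderAt.clm_comp {f : E → F} (L : F →L[ℝ] G) (hf : CkHolderAt m α f x) :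
    CkHolderAt m α (fun y => L (f y)) x := by
  induction m generalizing F G with
  | zero =>
    rw [ckHolderAt_zero] at hf ⊢
    refine ⟨L.contDiff.contDiffAt.comp x hf.1, ?_⟩
    obtain ⟨C, s, hs, hC⟩ := hf.2
    have := ((holderWith_one.2 L.lipschitz).holderOnWith univ).comp hC (mapsTo_univ _ _)
    rw [one_mul] at this
    exact ⟨_, s, hs, this⟩
  | succ m ih =>
    rw [ckHolderAt_succ] at hf ⊢
    refine ⟨?_, ?_⟩
    · filter_upwards [hf.1] with y hy using L.differentiableAt.comp y hy
    · refine (ih (ContinuousLinearMap.compL ℝ E F G L) hf.2).congr ?_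
      filter_upwards [hf.1] with y hy
      exact (L.hasFDerivAt.comp y hy.hasFDerivAt).fderiv

theorem CkHolderAt.add {f g : E → F} (hf : CkHolderAt m α f x) (hg : CkHolderAt m α g x) :
    CkHolderAt m α (fun y => f y + g y) x := by
  induction m generalizing F with
  | zero =>
    rw [ckHolderAt_zero] at hf hg ⊢
    refine ⟨hf.1.add hg.1, ?_⟩
    obtain ⟨C, s, hs, hC⟩ := hf.2
    obtain ⟨D, t, ht, hD⟩ := hg.2
    refine ⟨C + D, s ∩ t, inter_mem hs ht, fun a ha b hb => ?_⟩
    calc edist (f a + g a) (f b + g b) ≤ edist (f a) (f b) + edist (g a) (g b) :=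
          edist_add_add_le _ _ _ _
      _ ≤ C * edist a b ^ (α : ℝ) + D * edist a b ^ (α : ℝ) :=
          add_le_add (hC a ha.1 b hb.1) (hD a ha.2 b hb.2)
      _ = _ := by rw [ENNReal.coe_add, add_mul]
  | succ m ih =>
    rw [ckHolderAt_succ] at hf hg ⊢
    refine ⟨?_, ?_⟩
    · filter_upwards [hf.1, hg.1] with y hy hy' using hy.add hy'
    · refine (ih hf.2 hg.2).congr ?_
      filter_upwards [hf.1, hg.1] with y hy hy'
      exact fderiv_add hy hy'

theorem CkHolderAt.prodMk {f : E → F} {g : E → G} (hf : CkHolderAt m α f x)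
    (hg : CkHolderAt m α g x) : CkHolderAt m α (fun y => (f y, g y)) x := by
  simpa using (hf.clm_comp (ContinuousLinearMap.inl ℝ F G)).add
    (hg.clm_comp (ContinuousLinearMap.inr ℝ F G))

theorem CkHolderAt.of_succ {f : E → F} (hα : α ≤ 1) (hf : CkHolderAt (m + 1) α f x) :
    CkHolderAt m α f x :=
  .of_contDiffAt hα hf.1

/-- The class `C^{m,α}` is stable under composition with smooth maps on the left.  The derivative
of `g ∘ f` is again a smooth function of the pair `(f, f')`, so that the induction on `m` needs no
separate product rule. -/
theorem CkHolderAt.contDiff_comp {f : E → F} {g : F → G} (hα : α ≤ 1)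
    (hg : ContDiffAt ℝ ⊤ g (f x)) (hf : CkHolderAt m α f x) :
    CkHolderAt m α (fun y => g (f y)) x := by
  induction m generalizing F G with
  | zero =>
    rw [ckHolderAt_zero] at hf ⊢
    refine ⟨(hg.of_le (by simp)).comp x hf.1, ?_⟩
    obtain ⟨K, t, ht, hK⟩ := (hg.of_le (m := 1) le_top).exists_lipschitzOnWith
    obtain ⟨C, s, hs, hC⟩ := hf.2
    have := (holderOnWith_one.2 hK).comp (hC.mono inter_subset_left)
      fun a (ha : a ∈ s ∩ f ⁻¹' t) => ha.2
    rw [one_mul] at this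
    exact ⟨_, _, inter_mem hs (hf.1.continuousAt ht), this⟩
  | succ m ih =>
    have hf' := hf.of_succ hα
    have hcont : ContinuousAt f x := hf.1.continuousAt
    rw [ckHolderAt_succ] at hf ⊢
    have hgd : ∀ᶠ y in 𝓝 x, DifferentiableAt ℝ g (f y) := by
      refine hcont.eventually ?_
      filter_upwards [(hg.of_le (m := 1) le_top).eventually (by simp)] with z hz
      exact hz.differentiableAt (by simp)
    refine ⟨?_, ?_⟩
    · filter_upwards [hf.1, hgd] with y hy hy' using hy'.comp y hy
    · have hg2 : ContDiffAt ℝ ⊤ (fun p : F × (E →L[ℝ] F) => (fderiv ℝ g p.1).comp p.2)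
          (f x, fderiv ℝ f x) := by
        refine ContDiffAt.clm_comp ?_ contDiffAt_snd
        exact ContDiffAt.comp (f x, fderiv ℝ f x) (hg.fderiv_right (by simp)) contDiffAt_fst
      refine (ih (f := fun y => (f y, fderiv ℝ f y)) hg2 (hf'.prodMk hf.2)).congr ?_
      filter_upwards [hf.1, hgd] with y hy hy'
      exact fderiv_comp y hy' hy

end HolderClass

/-! ### Means along segments, and periodic functions -/

section SegmentMean

variable {F : Type} [NormedAddCommGroup F] [NormedSpace ℝ F] {α : ℝ≥0}

/-- The weighted mean `∫₀¹ w(u) φ(t + u(s - t)) du` of `φ` over the segment from `t` to `s`, as a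
function of `p = (t, s)`. -/
def segMean (w : ℝ → ℝ) (φ : ℝ → F) (p : ℝ × ℝ) : F :=
  ∫ u in (0 : ℝ)..1, w u • φ (p.1 + u * (p.2 - p.1))

theorem continuous_segMean {w : ℝ → ℝ} {φ : ℝ → F} (hw : Continuous w) (hφ : Continuous φ) :
    Continuous (segMean w φ) := by
  unfold segMean
  apply intervalIntegral.continuous_parametric_intervalIntegral_of_continuous'
  simp only [Function.uncurry_def]
  fun_prop

theorem isCkHolder_fderiv {m : ℕ} {φ : ℝ → F} (h : IsCkHolder (m + 1) α φ) :
    IsCkHolder m α (fderiv ℝ φ) := by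
  obtain ⟨h1, C, hC⟩ := h
  refine ⟨h1.fderiv_right (by push_cast; rfl), C, fun x y => ?_⟩
  have := hC x y
  simpa only [iteratedFDeriv_succ_eq_comp_right, Function.comp_apply,
      LinearIsometryEquiv.edist_map] using this

theorem hasFDerivAt_segMean [CompleteSpace F] {w : ℝ → ℝ} {φ : ℝ → F} (hw : Continuous w)
    (hφ : ContDiff ℝ 1 φ) (p : ℝ × ℝ) :
    HasFDerivAt (segMean w φ)
      ((segMean (fun u => w u * (1 - u)) (fderiv ℝ φ) p).comp (ContinuousLinearMap.fst ℝ ℝ ℝ) +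
       (segMean (fun u => w u * u) (fderiv ℝ φ) p).comp (ContinuousLinearMap.snd ℝ ℝ ℝ)) p := by
  have hφ' : Continuous (fderiv ℝ φ) := hφ.continuous_fderiv (by simp)
  have hφc : Continuous φ := hφ.continuous
  let ℓ : ℝ → (ℝ × ℝ →L[ℝ] ℝ) := fun u =>
    (1 - u) • ContinuousLinearMap.fst ℝ ℝ ℝ + u • ContinuousLinearMap.snd ℝ ℝ ℝ
  have hℓc : Continuous ℓ := by fun_prop
  let F' : ℝ × ℝ → ℝ → (ℝ × ℝ →L[ℝ] F) := fun x u =>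
    w u • (fderiv ℝ φ (x.1 + u * (x.2 - x.1))).comp (ℓ u)
  have hF' : Continuous (Function.uncurry F') := by
    have h1 : Continuous fun y : (ℝ × ℝ) × ℝ => fderiv ℝ φ (y.1.1 + y.2 * (y.1.2 - y.1.1)) := by
      fun_prop
    have h2 : Continuous fun y : (ℝ × ℝ) × ℝ => ℓ y.2 := hℓc.comp continuous_snd
    have h3 : Continuous fun y : (ℝ × ℝ) × ℝ => w y.2 := hw.comp continuous_snd
    exact h3.smul (h1.clm_comp h2)
  obtain ⟨M, hM⟩ := ((isCompact_closedBall p 1).prod (isCompact_Icc (a := (0 : ℝ)) (b := 1))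
    ).exists_bound_of_continuousOn
    hF'.continuousOn
  have key : HasFDerivAt (segMean w φ) (∫ u in (0 : ℝ)..1, F' p u) p := by
    refine intervalIntegral.hasFDerivAt_integral_of_dominated_of_fderiv_le
      (𝕜 := ℝ) (F := fun x u => w u • φ (x.1 + u * (x.2 - x.1))) (F' := F')
      (bound := fun _ => M) (Metric.closedBall_mem_nhds p one_pos) ?_ ?_ ?_ ?_ ?_ ?_
    · refine Eventually.of_forall fun x => Continuous.aestronglyMeasurable ?_
      fun_prop
    · refine Continuous.intervalIntegrable ?_ _ _
      fun_prop
    · exact (hF'.comp (by fun_prop : Continuous fun u : ℝ => (p, u))).aestronglyMeasurable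
    · refine Eventually.of_forall fun u hu x hx => hM (x, u) ⟨hx, ?_⟩
      rw [uIoc_of_le zero_le_one] at hu
      exact ⟨hu.1.le, hu.2⟩
    · exact intervalIntegrable_const
    · refine Eventually.of_forall fun u _ x _ => ?_
      have h1 : HasFDerivAt (fun x : ℝ × ℝ => x.1 + u * (x.2 - x.1)) (ℓ u) x := by
        have : (fun x : ℝ × ℝ => x.1 + u * (x.2 - x.1)) = ℓ u := by
          ext x; simp [ℓ]; ring
        rw [this]; exact (ℓ u).hasFDerivAt
      have h2 := ((hφ.differentiable (by simp)) (x.1 + u * (x.2 - x.1))).hasFDerivAt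
      exact (h2.comp x h1).const_smul (w u)
  convert key using 1
  unfold segMean
  have c1 := ((ContinuousLinearMap.compL ℝ (ℝ × ℝ) ℝ F).flip
    (ContinuousLinearMap.fst ℝ ℝ ℝ)).intervalIntegral_comp_comm (μ := volume) (a := 0) (b := 1)
    (f := fun u => (w u * (1 - u)) • fderiv ℝ φ (p.1 + u * (p.2 - p.1)))
    (Continuous.intervalIntegrable (by fun_prop) _ _)
  have c2 := ((ContinuousLinearMap.compL ℝ (ℝ × ℝ) ℝ F).flip
    (ContinuousLinearMap.snd ℝ ℝ ℝ)).intervalIntegral_comp_comm (μ := volume) (a := 0) (b := 1)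
    (f := fun u => (w u * u) • fderiv ℝ φ (p.1 + u * (p.2 - p.1)))
    (Continuous.intervalIntegrable (by fun_prop) _ _)
  simp only [ContinuousLinearMap.flip_apply, ContinuousLinearMap.compL_apply] at c1 c2
  rw [← c1, ← c2, ← intervalIntegral.integral_add]
  · refine intervalIntegral.integral_congr fun u _ => ContinuousLinearMap.ext fun z => ?_
    have e : ℓ u z = (1 - u) • z.1 + u • z.2 := rfl
    change (w u * (1 - u)) • fderiv ℝ φ (p.1 + u * (p.2 - p.1)) z.1 +
      (w u * u) • fderiv ℝ φ (p.1 + u * (p.2 - p.1)) z.2 =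
      w u • fderiv ℝ φ (p.1 + u * (p.2 - p.1)) (ℓ u z)
    rw [e, map_add, map_smul, map_smul, smul_add, mul_smul, mul_smul]
  · refine Continuous.intervalIntegrable ?_ _ _
    exact Continuous.clm_comp (by fun_prop) continuous_const
  · refine Continuous.intervalIntegrable ?_ _ _
    exact Continuous.clm_comp (by fun_prop) continuous_const

theorem ckHolderAt_segMean [CompleteSpace F] {m : ℕ} {w : ℝ → ℝ} {φ : ℝ → F}
    (hw : Continuous w) (hφ : IsCkHolder m α φ) (p : ℝ × ℝ) :
    CkHolderAt m α (segMean w φ) p := by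
  induction m generalizing F w with
  | zero =>
    rw [ckHolderAt_zero]
    have hφc : Continuous φ := hφ.1.continuous
    have hc := continuous_segMean hw hφc
    refine ⟨(contDiff_zero.2 hc).contDiffAt, ?_⟩
    obtain ⟨-, C, hC⟩ := hφ
    have hC' : HolderWith C α φ := fun x y => by
      simpa only [iteratedFDeriv_zero_eq_comp, Function.comp_apply,
        LinearIsometryEquiv.edist_map] using hC x y
    obtain ⟨M, hM⟩ := (isCompact_Icc (a := (0 : ℝ)) (b := 1)).exists_bound_of_continuousOn
      hw.continuousOn
    have hM0 : 0 ≤ M := (norm_nonneg _).trans (hM 0 (by simp))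
    refine ⟨Real.toNNReal M * C, univ, univ_mem, fun x _ y _ => ?_⟩
    have hd : dist (segMean w φ x) (segMean w φ y) ≤ M * C * dist x y ^ (α : ℝ) := by
      rw [dist_eq_norm]
      unfold segMean
      rw [← intervalIntegral.integral_sub (Continuous.intervalIntegrable (by fun_prop) _ _)
        (Continuous.intervalIntegrable (by fun_prop) _ _)]
      refine (intervalIntegral.norm_integral_le_of_norm_le_const
        (C := M * C * dist x y ^ (α : ℝ)) fun u hu => ?_).trans (by simp)
      rw [uIoc_of_le zero_le_one] at hu
      rw [← smul_sub, norm_smul, mul_assoc]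
      refine mul_le_mul (hM u ⟨hu.1.le, hu.2⟩) ?_ (norm_nonneg _) hM0
      rw [← dist_eq_norm]
      refine hC'.dist_le_of_le ?_
      rw [Real.dist_eq, Prod.dist_eq, Real.dist_eq, Real.dist_eq]
      calc |x.1 + u * (x.2 - x.1) - (y.1 + u * (y.2 - y.1))|
          = |(1 - u) * (x.1 - y.1) + u * (x.2 - y.2)| := by ring_nf
        _ ≤ |(1 - u) * (x.1 - y.1)| + |u * (x.2 - y.2)| := abs_add_le _ _
        _ = (1 - u) * |x.1 - y.1| + u * |x.2 - y.2| := by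
            rw [abs_mul, abs_mul, abs_of_nonneg hu.1.le, abs_of_nonneg (by linarith [hu.2])]
        _ ≤ (1 - u) * max |x.1 - y.1| |x.2 - y.2| + u * max |x.1 - y.1| |x.2 - y.2| := by
            have h0 := hu.1.le
            have h1 : 0 ≤ 1 - u := by linarith [hu.2]
            exact add_le_add (mul_le_mul_of_nonneg_left (le_max_left _ _) h1)
              (mul_le_mul_of_nonneg_left (le_max_right _ _) h0)
        _ = _ := by ring
    rw [edist_nndist, edist_nndist, ← ENNReal.coe_rpow_of_nonneg _ α.coe_nonneg,
      ← ENNReal.coe_mul, ENNReal.coe_le_coe, ← NNReal.coe_le_coe]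
    push_cast
    rw [Real.coe_toNNReal M hM0]
    exact hd
  | succ m ih =>
    rw [ckHolderAt_succ]
    have h1 : ContDiff ℝ 1 φ := hφ.1.of_le (by push_cast; simp)
    refine ⟨Eventually.of_forall fun y => (hasFDerivAt_segMean hw h1 y).differentiableAt, ?_⟩
    have hφ' := isCkHolder_fderiv hφ
    have A := (ih (w := fun u => w u * (1 - u)) (by fun_prop) hφ').clm_comp
      ((ContinuousLinearMap.compL ℝ (ℝ × ℝ) ℝ F).flip (ContinuousLinearMap.fst ℝ ℝ ℝ))
    have B := (ih (w := fun u => w u * u) (by fun_prop) hφ').clm_comp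
      ((ContinuousLinearMap.compL ℝ (ℝ × ℝ) ℝ F).flip (ContinuousLinearMap.snd ℝ ℝ ℝ))
    refine (A.add B).congr (Eventually.of_forall fun y => ?_)
    exact (hasFDerivAt_segMean hw h1 y).fderiv

end SegmentMean

/-- A continuous, doubly periodic function that is locally Hölder continuous is uniformly so. -/
theorem exists_holderWith_of_periodic {Y : Type*} [PseudoMetricSpace Y] {α : ℝ≥0} {T : ℝ}
    (hT : 0 < T) {H : ℝ × ℝ → Y} (hc : Continuous H) (h1 : ∀ t s, H (t + T, s) = H (t, s))
    (h2 : ∀ t s, H (t, s + T) = H (t, s)) (hloc : ∀ p, LocHolderAt α H p) :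
    ∃ C, HolderWith C α H := by
  let K : Set (ℝ × ℝ) := Icc 0 T ×ˢ Icc 0 T
  have hK : IsCompact K := isCompact_Icc.prod isCompact_Icc
  have hper : ∀ (m n : ℤ) (p : ℝ × ℝ), H (p.1 - m * T, p.2 - n * T) = H p := fun m n p => by
    rw [(show Function.Periodic (fun t => H (t, p.2 - n * T)) T from fun t => h1 t _).sub_int_mul_eq
      m, (show Function.Periodic (fun t => H (p.1, t)) T from fun t => h2 _ t).sub_int_mul_eq n]
  have hred : ∀ p : ℝ × ℝ, ∃ m n : ℤ, (p.1 - m * T, p.2 - n * T) ∈ K := fun p => by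
    refine ⟨toIcoDiv hT 0 p.1, toIcoDiv hT 0 p.2, ?_, ?_⟩
    · have := sub_toIcoDiv_zsmul_mem_Ico hT 0 p.1
      simp only [zsmul_eq_mul, zero_add] at this
      exact ⟨this.1, this.2.le⟩
    · have := sub_toIcoDiv_zsmul_mem_Ico hT 0 p.2
      simp only [zsmul_eq_mul, zero_add] at this
      exact ⟨this.1, this.2.le⟩
  obtain ⟨B, hB⟩ := Metric.isBounded_iff.1 (hK.image hc).isBounded
  have hbd : ∀ p p', dist (H p) (H p') ≤ B := fun p p' => by
    obtain ⟨m, n, h⟩ := hred p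
    obtain ⟨m', n', h'⟩ := hred p'
    rw [← hper m n p, ← hper m' n' p']
    exact hB (mem_image_of_mem _ h) (mem_image_of_mem _ h')
  -- a Lebesgue number for a cover of `K` by balls on which `H` is Hölder continuous
  have hr : ∀ p, ∃ r > 0, ∃ C : ℝ≥0, HolderOnWith C α H (Metric.ball p (2 * r)) := fun p => by
    obtain ⟨C, s, hs, hC⟩ := hloc p
    obtain ⟨r, hr, hrs⟩ := Metric.mem_nhds_iff.1 hs
    exact ⟨r / 2, by positivity, C, hC.mono (by rwa [mul_div_cancel₀ _ (two_ne_zero)])⟩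
  choose r hr0 C hC using hr
  obtain ⟨I, hI⟩ := hK.elim_nhds_subcover (fun p => Metric.ball p (r p))
    fun p _ => Metric.ball_mem_nhds p (hr0 p)
  obtain ⟨δ, hδ0, hδ⟩ : ∃ δ > 0, ∀ p ∈ I, δ ≤ r p := by
    rcases I.eq_empty_or_nonempty with rfl | hne
    · exact ⟨1, one_pos, by simp⟩
    · exact ⟨I.inf' hne r, (Finset.lt_inf'_iff hne).2 fun p _ => hr0 p,
        fun p hp => Finset.inf'_le r hp⟩
  have hBt : 0 ≤ B := (dist_nonneg).trans (hbd 0 0)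
  let C₀ : ℝ≥0 := I.sum C + ⟨B / δ ^ (α : ℝ), by positivity⟩
  refine ⟨C₀, fun x y => ?_⟩
  have key : dist (H x) (H y) ≤ C₀ * dist x y ^ (α : ℝ) := by
    rcases lt_or_ge (dist x y) δ with hxy | hxy
    · obtain ⟨m, n, h⟩ := hred x
      rw [← hper m n x, ← hper m n y]
      set x' : ℝ × ℝ := (x.1 - m * T, x.2 - n * T)
      set y' : ℝ × ℝ := (y.1 - m * T, y.2 - n * T)
      have hd : dist x' y' = dist x y := by simp [x', y', Prod.dist_eq]
      obtain ⟨p, hpI, hp⟩ := mem_iUnion₂.1 (hI.2 h)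
      have hp' : dist x' p < r p := hp
      have h1 : x' ∈ Metric.ball p (2 * r p) := by
        rw [Metric.mem_ball]; linarith [hr0 p]
      have h2 : y' ∈ Metric.ball p (2 * r p) := by
        rw [Metric.mem_ball]
        calc dist y' p ≤ dist x' y' + dist x' p := by
              rw [dist_comm x' y']; exact dist_triangle _ _ _
          _ < 2 * r p := by rw [hd]; linarith [hδ p hpI]
      refine ((hC p).dist_le h1 h2).trans ?_
      rw [hd]
      gcongr
      exact (Finset.single_le_sum (fun _ _ => zero_le) hpI).trans le_self_add
    · calc dist (H x) (H y) ≤ B := hbd x y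
        _ = B / δ ^ (α : ℝ) * δ ^ (α : ℝ) := by field_simp
        _ ≤ B / δ ^ (α : ℝ) * dist x y ^ (α : ℝ) := by gcongr
        _ ≤ C₀ * dist x y ^ (α : ℝ) := by
            gcongr
            exact le_add_of_nonneg_left (NNReal.coe_nonneg _)
  rw [edist_nndist, edist_nndist, ← ENNReal.coe_rpow_of_nonneg _ α.coe_nonneg,
    ← ENNReal.coe_mul, ENNReal.coe_le_coe, ← NNReal.coe_le_coe]
  push_cast
  exact key

theorem isCkHolder_of_periodic {F : Type} [NormedAddCommGroup F] [NormedSpace ℝ F] {m : ℕ}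
    {α : ℝ≥0} {T : ℝ} (hT : 0 < T) {H : ℝ × ℝ → F} (h1 : ∀ t s, H (t + T, s) = H (t, s))
    (h2 : ∀ t s, H (t, s + T) = H (t, s)) (hloc : ∀ p, CkHolderAt m α H p) :
    IsCkHolder m α H := by
  have hH : ContDiff ℝ m H := contDiff_iff_contDiffAt.2 fun p => (hloc p).1
  have tr : ∀ c : ℝ × ℝ, (∀ p, H (p + c) = H p) → ∀ p,
      iteratedFDeriv ℝ m H (p + c) = iteratedFDeriv ℝ m H p := fun c hc p => by
    conv_rhs => rw [← (funext hc : (fun p => H (p + c)) = H)]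
    rw [iteratedFDeriv_comp_add_right]
  refine ⟨hH, exists_holderWith_of_periodic hT (hH.continuous_iteratedFDeriv le_rfl) ?_ ?_
    fun p => (hloc p).2⟩
  · intro t s
    simpa using tr (T, 0) (fun p => by
      rw [← h1 p.1 p.2]; congr 1; ext <;> simp) (t, s)
  · intro t s
    simpa using tr (0, T) (fun p => by
      rw [← h2 p.1 p.2]; congr 1; ext <;> simp) (t, s)

/-! ### The kernels in terms of differences and tangents -/

/-- The kernel `K₀|q'|` in terms of `z = q(s) - q(t)` and `v = q'(s)`: it is `Im(v / z) / 2π`. -/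
def angleForm (z v : ℂ) : ℝ := (z.re * v.im - z.im * v.re) / (2 * Real.pi * Complex.normSq z)

/-- The kernel `K₂|q'|` in terms of `z = q(s) - q(t)` and `v = q'(s)`. -/
def elasticForm (lam mu : ℝ) (z v : ℂ) : Matrix (Fin 2) (Fin 2) ℝ :=
  (-(mu / (2 * mu + lam)) * angleForm z v) • (1 : Matrix (Fin 2) (Fin 2) ℝ) -
    (2 * (mu + lam) / (2 * mu + lam) * (angleForm z v / Complex.normSq z)) •
      Matrix.vecMulVec (toVec z) (toVec z)

theorem norm_mul_inner_unitNormal {q : ℝ → ℂ} {s : ℝ} (hs : deriv q s ≠ 0) (z : ℂ) :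
    ‖deriv q s‖ * inner ℝ z (unitNormal q s) = z.re * (deriv q s).im - z.im * (deriv q s).re := by
  have h : (‖deriv q s‖ : ℝ) ≠ 0 := by simpa using hs
  rw [← inner_smul_right (𝕜 := ℝ)]
  have : ‖deriv q s‖ • unitNormal q s = -Complex.I * deriv q s := by
    rw [unitNormal, Complex.real_smul]
    have : (‖deriv q s‖ : ℂ) ≠ 0 := by exact_mod_cast h
    field_simp
  rw [this, Complex.inner]
  simp
  ring

theorem norm_mul_kernelK {q : ℝ → ℂ} {s : ℝ} (hs : deriv q s ≠ 0) (x : ℂ) :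
    ‖deriv q s‖ * kernelK x (q s) (unitNormal q s) = angleForm (q s - x) (deriv q s) := by
  rw [kernelK, angleForm, ← norm_mul_inner_unitNormal hs, Complex.normSq_eq_norm_sq,
    norm_sub_rev x, mul_div_assoc]

theorem paramKernel_kernelB {q : ℝ → ℂ} {s : ℝ} (hs : deriv q s ≠ 0) (t : ℝ) :
    paramKernel kernelB q t s = angleForm (q s - q t) (deriv q s) • 1 := by
  rw [paramKernel, kernelB]
  ext i j
  fin_cases i <;> fin_cases j <;> simp [norm_mul_kernelK hs]

theorem norm_smul_kernelT2 {q : ℝ → ℂ} {s : ℝ} (lam mu : ℝ) (hs : deriv q s ≠ 0) (x : ℂ) :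
    ‖deriv q s‖ • kernelT2 lam mu x (q s) (unitNormal q s) =
      elasticForm lam mu (q s - x) (deriv q s) := by
  rw [kernelT2, elasticForm, smul_add, smul_smul, smul_smul, sub_eq_add_neg _ (_ • _), ← neg_smul]
  have hin : inner ℝ (x - q s) (unitNormal q s) = -inner ℝ (q s - x) (unitNormal q s) := by
    rw [← inner_neg_left, neg_sub]
  have hv : Matrix.vecMulVec (toVec (x - q s)) (toVec (x - q s)) =
      Matrix.vecMulVec (toVec (q s - x)) (toVec (q s - x)) := by
    ext i j
    fin_cases i <;> fin_cases j <;> simp [Matrix.vecMulVec_apply, toVec] <;> ring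
  rw [hin, hv]
  congr 2
  · rw [← norm_mul_kernelK hs, kernelK, norm_sub_rev x]; ring
  · rw [← norm_mul_kernelK hs, kernelK, norm_sub_rev x, Complex.normSq_eq_norm_sq,
      show ‖q s - x‖ ^ 4 = ‖q s - x‖ ^ 2 * ‖q s - x‖ ^ 2 by ring]
    simp only [div_eq_mul_inv, mul_inv]
    ring

theorem paramKernel_kernelT2 {q : ℝ → ℂ} {s : ℝ} (lam mu : ℝ) (hs : deriv q s ≠ 0) (t : ℝ) :
    paramKernel (kernelT2 lam mu) q t s = elasticForm lam mu (q s - q t) (deriv q s) :=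
  norm_smul_kernelT2 lam mu hs _

/-- The singular part `1/h` of `v / z`, where `z = ha` and `v = a + hb`, is real, and so drops out
of the kernel. -/
theorem angleForm_real_mul {h : ℝ} (hh : h ≠ 0) (a b : ℂ) :
    angleForm (h * a) (a + h * b) = angleForm a b := by
  rw [angleForm, angleForm, Complex.normSq_mul, Complex.normSq_ofReal]
  simp only [Complex.re_ofReal_mul, Complex.im_ofReal_mul, Complex.add_re, Complex.add_im]
  rw [show h * a.re * (a.im + h * b.im) - h * a.im * (a.re + h * b.re) =
    (h * h) * (a.re * b.im - a.im * b.re) by ring,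
    show 2 * Real.pi * (h * h * Complex.normSq a) = (h * h) * (2 * Real.pi * Complex.normSq a) by
      ring, mul_div_mul_left _ _ (mul_ne_zero hh hh)]

theorem elasticForm_real_mul (lam mu : ℝ) {h : ℝ} (hh : h ≠ 0) (a b : ℂ) :
    elasticForm lam mu (h * a) (a + h * b) = elasticForm lam mu a b := by
  rw [elasticForm, elasticForm, angleForm_real_mul hh]
  congr 1
  ext i j
  simp only [Matrix.smul_apply, Matrix.vecMulVec_apply, smul_eq_mul, Complex.normSq_mul,
    Complex.normSq_ofReal]
  have : ∀ k, toVec (h * a) k = h * toVec a k := fun k => by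
    fin_cases k <;> simp [toVec]
  rw [this, this]
  field_simp

theorem contDiffAt_angleForm {a : ℂ} (ha : a ≠ 0) (b : ℂ) :
    ContDiffAt ℝ ⊤ (fun p : ℂ × ℂ => angleForm p.1 p.2) (a, b) := by
  unfold angleForm
  simp only [Complex.normSq_apply, ← Complex.reCLM_apply, ← Complex.imCLM_apply]
  refine ContDiffAt.div (by fun_prop) (by fun_prop) ?_
  have := Complex.normSq_pos.2 ha
  rw [Complex.normSq_apply] at this
  have := Real.pi_pos
  simp only [Complex.reCLM_apply, Complex.imCLM_apply]
  positivity

theorem contDiffAt_elasticForm (lam mu : ℝ) {a : ℂ} (ha : a ≠ 0) (b : ℂ) (i j : Fin 2) :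
    ContDiffAt ℝ ⊤ (fun p : ℂ × ℂ => elasticForm lam mu p.1 p.2 i j) (a, b) := by
  have h1 := contDiffAt_angleForm ha b
  have h2 : ContDiffAt ℝ ⊤ (fun p : ℂ × ℂ => Complex.normSq p.1) (a, b) := by
    simp only [Complex.normSq_apply, ← Complex.reCLM_apply, ← Complex.imCLM_apply]
    fun_prop
  have h3 : ∀ k, ContDiffAt ℝ ⊤ (fun p : ℂ × ℂ => toVec p.1 k) (a, b) := fun k => by
    fin_cases k
    · exact (Complex.reCLM.contDiff.comp contDiff_fst).contDiffAt
    · exact (Complex.imCLM.contDiff.comp contDiff_fst).contDiffAt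
  unfold elasticForm
  simp only [Matrix.sub_apply, Matrix.smul_apply, Matrix.vecMulVec_apply, smul_eq_mul]
  refine ContDiffAt.sub ((contDiffAt_const.mul h1).mul contDiffAt_const)
    ((contDiffAt_const.mul (h1.div h2 ?_)).mul ((h3 i).mul (h3 j)))
  simpa using ha

/-! ### Regularity of the parametrized kernels -/

theorem CkHolderAt.add_period {F : Type} [NormedAddCommGroup F] [NormedSpace ℝ F]
    {E : Type} [NormedAddCommGroup E] [NormedSpace ℝ E] {m : ℕ} {α : ℝ≥0} {f : E → F} {x c : E}
    (hf : CkHolderAt m α f x) (hc : ∀ y, f (y + c) = f y) : CkHolderAt m α f (x + c) := by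
  have hc' : (fun y => f (y + -c)) = f := funext fun y => by
    rw [← hc (y + -c), neg_add_cancel_right]
  obtain ⟨h1, C, s, hs, hC⟩ := hf
  have hcont : ContinuousAt (fun y : E => y + -c) (x + c) := by fun_prop
  refine ⟨?_, C, (fun y => y + -c) ⁻¹' s, hcont (by simpa using hs), fun y hy z hz => ?_⟩
  · rw [← hc']
    refine ContDiffAt.comp (g := f) (x + c) (by simpa using h1) (by fun_prop)
  · have := hC _ hy _ hz
    rw [← hc']
    simpa [iteratedFDeriv_comp_add_right] using this

theorem injOn_mod_period {q : ℝ → ℂ} (hper : Function.Periodic q (2 * Real.pi))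
    (hinj : InjOn q (Ico (-Real.pi) Real.pi)) {t s : ℝ} (h : q t = q s) :
    ∃ n : ℤ, t = s + n * (2 * Real.pi) := by
  have hp : 0 < 2 * Real.pi := by positivity
  have e : ∀ x, toIcoMod hp (-Real.pi) x ∈ Ico (-Real.pi) Real.pi := fun x => by
    have := toIcoMod_mem_Ico hp (-Real.pi) x
    rwa [show -Real.pi + 2 * Real.pi = Real.pi by ring] at this
  have e2 : ∀ x, q (toIcoMod hp (-Real.pi) x) = q x := fun x => by
    rw [toIcoMod, zsmul_eq_mul, hper.sub_int_mul_eq]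
  have := hinj (e t) (e s) (by rw [e2, e2, h])
  rw [toIcoMod, toIcoMod, zsmul_eq_mul, zsmul_eq_mul] at this
  refine ⟨toIcoDiv hp (-Real.pi) t - toIcoDiv hp (-Real.pi) s, ?_⟩
  push_cast
  linarith

theorem eq_of_abs_sub_lt {q : ℝ → ℂ} (hper : Function.Periodic q (2 * Real.pi))
    (hinj : InjOn q (Ico (-Real.pi) Real.pi)) {t s : ℝ} (h : q t = q s)
    (hts : |t - s| < 2 * Real.pi) : t = s := by
  obtain ⟨n, rfl⟩ := injOn_mod_period hper hinj h
  have hp : 0 < 2 * Real.pi := by positivity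
  rw [add_sub_cancel_left, abs_mul, abs_of_pos hp] at hts
  have h1 : |(n : ℝ)| < 1 := by
    by_contra hn; push Not at hn
    nlinarith
  have : n = 0 := Int.abs_lt_one_iff.1 (by exact_mod_cast h1)
  simp [this]

/-- A kernel that near the diagonal is given by a function `G` of class `C^{m,α}` has an extension
of class `C^{m,α}`. -/
theorem isCkHolderKernel_of_near_diagonal {q : ℝ → ℂ} (hper : Function.Periodic q (2 * Real.pi))
    (hinj : InjOn q (Ico (-Real.pi) Real.pi)) {m : ℕ} {α : ℝ≥0}
    {M : ℝ → ℝ → Matrix (Fin 2) (Fin 2) ℝ} {G : ℝ × ℝ → Matrix (Fin 2) (Fin 2) ℝ}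
    (hM1 : ∀ t s, M (t + 2 * Real.pi) s = M t s) (hM2 : ∀ t s, M t (s + 2 * Real.pi) = M t s)
    (hG : ∀ s, G (s + 2 * Real.pi, s + 2 * Real.pi) = G (s, s))
    (hGM : ∀ t s, t ≠ s → |t - s| < 2 * Real.pi → G (t, s) = M t s)
    (hreg : ∀ t s, |t - s| < 2 * Real.pi → ∀ i j, CkHolderAt m α (fun p => G p i j) (t, s)) :
    IsCkHolderKernel m α q M := by
  classical
  have hp : 0 < 2 * Real.pi := by positivity
  let A : ℝ → ℝ → Matrix (Fin 2) (Fin 2) ℝ := fun t s => if q t = q s then G (s, s) else M t s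
  have hA1 : ∀ t s, A (t + 2 * Real.pi) s = A t s := fun t s => by
    simp only [A, hper t, hM1]
  have hA2 : ∀ t s, A t (s + 2 * Real.pi) = A t s := fun t s => by
    simp only [A, hper s, hM2, hG]
  have hAG : ∀ t s, |t - s| < 2 * Real.pi → A t s = G (t, s) := fun t s hts => by
    rcases eq_or_ne t s with rfl | hne
    · simp [A]
    · simp only [A]
      rw [if_neg fun h => hne (eq_of_abs_sub_lt hper hinj h hts), hGM t s hne hts]
  refine ⟨A, fun t s h => if_neg h, fun i j => ?_⟩
  refine isCkHolder_of_periodic hp (fun t s => by simp [hA1]) (fun t s => by simp [hA2])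
    fun p => ?_
  -- move the first coordinate to within half a period of the second one
  set n := toIcoDiv hp (p.2 - Real.pi) p.1
  have hn := sub_toIcoDiv_zsmul_mem_Ico hp (p.2 - Real.pi) p.1
  rw [zsmul_eq_mul] at hn
  set t := p.1 - n * (2 * Real.pi) with ht
  have hts : |t - p.2| < 2 * Real.pi := by
    rw [abs_lt]; constructor <;> linarith [hn.1, hn.2, Real.pi_pos]
  have hev : ∀ᶠ y : ℝ × ℝ in 𝓝 (t, p.2), |y.1 - y.2| < 2 * Real.pi :=
    (by fun_prop : Continuous fun y : ℝ × ℝ => |y.1 - y.2|).continuousAt.eventually_lt_const hts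
  have h1 : CkHolderAt m α (fun y : ℝ × ℝ => A y.1 y.2 i j) (t, p.2) :=
    (hreg t p.2 hts i j).congr (hev.mono fun y hy => by simp only [hAG _ _ hy])
  have h2 := h1.add_period (c := (n * (2 * Real.pi), 0)) fun y => by
    have : Function.Periodic (fun t => A t y.2 i j) (2 * Real.pi) := fun t => by simp only [hA1]
    have := (this.int_mul n) y.1
    simpa using this
  convert h2 using 1
  ext <;> simp [ht]

theorem segMean_add_period {F : Type} [NormedAddCommGroup F] [NormedSpace ℝ F] {w : ℝ → ℝ}
    {φ : ℝ → F} {T : ℝ} (hφ : Function.Periodic φ T) (t s : ℝ) :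
    segMean w φ (t + T, s + T) = segMean w φ (t, s) := by
  unfold segMean
  refine intervalIntegral.integral_congr fun u _ => ?_
  simp only
  rw [show t + T + u * (s + T - (t + T)) = t + u * (s - t) + T by ring, hφ]

theorem sub_smul_segMean_deriv {φ : ℝ → ℂ} (hφ : ContDiff ℝ 1 φ) (t s : ℝ) :
    φ s - φ t = ((s - t : ℝ) : ℂ) * segMean (fun _ => 1) (deriv φ) (t, s) := by
  have hd : Continuous (deriv φ) := hφ.continuous_deriv le_rfl
  have key := intervalIntegral.integral_eq_sub_of_hasDerivAt (a := (0 : ℝ)) (b := 1)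
    (f := fun u : ℝ => φ (t + u * (s - t)))
    (f' := fun u : ℝ => (s - t) • deriv φ (t + u * (s - t))) (fun u _ => by
      have h1 : HasDerivAt (fun u : ℝ => t + u * (s - t)) (s - t) u := by
        simpa using ((hasDerivAt_id u).mul_const (s - t)).const_add t
      exact ((hφ.differentiable (by simp)) _).hasDerivAt.scomp u h1)
    (Continuous.intervalIntegrable (by fun_prop) _ _)
  simp only [zero_mul, add_zero, one_mul, add_sub_cancel] at key
  rw [← key, intervalIntegral.integral_smul, Complex.real_smul]
  simp [segMean]

theorem deriv_sub_segMean {φ : ℝ → ℂ} (hφ : ContDiff ℝ 1 φ) (t s : ℝ) :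
    φ s = segMean (fun _ => 1) φ (t, s) +
      ((s - t : ℝ) : ℂ) * segMean (fun u => u) (deriv φ) (t, s) := by
  have hd : Continuous (deriv φ) := hφ.continuous_deriv le_rfl
  have hc : Continuous φ := hφ.continuous
  have key := intervalIntegral.integral_eq_sub_of_hasDerivAt (a := (0 : ℝ)) (b := 1)
    (f := fun u : ℝ => u • φ (t + u * (s - t)))
    (f' := fun u : ℝ => u • ((s - t) • deriv φ (t + u * (s - t))) +
      (1 : ℝ) • φ (t + u * (s - t))) (fun u _ => by
      have h1 : HasDerivAt (fun u : ℝ => t + u * (s - t)) (s - t) u := by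
        simpa using ((hasDerivAt_id u).mul_const (s - t)).const_add t
      exact (hasDerivAt_id u).smul
        (((hφ.differentiable (by simp)) _).hasDerivAt.scomp u h1))
    (Continuous.intervalIntegrable (by fun_prop) _ _)
  rw [intervalIntegral.integral_add (Continuous.intervalIntegrable (by fun_prop) _ _)
    (Continuous.intervalIntegrable (by fun_prop) _ _)] at key
  simp only [one_mul, one_smul, zero_smul, sub_zero, add_sub_cancel] at key
  rw [← key, add_comm]
  congr 1
  · simp [segMean]
  · rw [segMean, ← Complex.real_smul, ← intervalIntegral.integral_smul]
    refine intervalIntegral.integral_congr fun u _ => ?_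
    simp only [smul_comm u]

theorem isCkHolder_deriv {m : ℕ} {α : ℝ≥0} {φ : ℝ → ℂ} (h : IsCkHolder (m + 1) α φ) :
    IsCkHolder m α (deriv φ) := by
  obtain ⟨h1, C, hC⟩ := isCkHolder_fderiv h
  have hL : deriv φ = ContinuousLinearMap.apply ℝ ℂ (1 : ℝ) ∘ fderiv ℝ φ := by
    ext x; rfl
  rw [hL]
  set L := ContinuousLinearMap.apply ℝ ℂ (1 : ℝ)
  refine ⟨L.contDiff.comp h1, ?_⟩
  have e : iteratedFDeriv ℝ m (L ∘ fderiv ℝ φ) = fun x =>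
      ContinuousLinearMap.compContinuousMultilinearMapL ℝ (fun _ : Fin m => ℝ) _ _ L
        (iteratedFDeriv ℝ m (fderiv ℝ φ) x) := by
    ext1 x
    exact L.iteratedFDeriv_comp_left h1.contDiffAt le_rfl
  have := (holderWith_one.2 (ContinuousLinearMap.compContinuousMultilinearMapL ℝ
    (fun _ : Fin m => ℝ) _ _ L).lipschitz).comp hC
  rw [one_mul] at this
  rw [e]
  exact ⟨_, this⟩

/-- Regularity of the parametrized kernels: `q(s) - q(t) = (s - t) a` and `q'(s) = a + (s - t) b`
with means `a` of `q'` and `b` of `q''` over the segment from `t` to `s`, so that near the diagonal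
the kernels are smooth functions of `a` and `b`, of class `C^{k-2,α}`. -/
theorem isCkHolderKernel_param {q : ℝ → ℂ} (hper : Function.Periodic q (2 * Real.pi))
    (hinj : InjOn q (Ico (-Real.pi) Real.pi)) (hder : ∀ s, deriv q s ≠ 0) {m : ℕ} {α : ℝ≥0}
    (hα : α ≤ 1) (hq : IsCkHolder (m + 2) α q)
    {k : ℂ → ℂ → ℂ → Matrix (Fin 2) (Fin 2) ℝ} {form : ℂ → ℂ → Matrix (Fin 2) (Fin 2) ℝ}
    (hk : ∀ t s, paramKernel k q t s = form (q s - q t) (deriv q s))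
    (hform : ∀ (h : ℝ) (a b : ℂ), h ≠ 0 → form (h * a) (a + h * b) = form a b)
    (hsmooth : ∀ (a b : ℂ), a ≠ 0 → ∀ i j,
      ContDiffAt ℝ ⊤ (fun p : ℂ × ℂ => form p.1 p.2 i j) (a, b)) :
    IsCkHolderKernel m α q (paramKernel k q) := by
  have hq1 : ContDiff ℝ 1 q := hq.1.of_le (by exact_mod_cast (by lia : 1 ≤ m + 2))
  have hdq := isCkHolder_deriv hq
  have hq2 : ContDiff ℝ 1 (deriv q) := hdq.1.of_le (by push_cast; simp)
  have hdper : Function.Periodic (deriv q) (2 * Real.pi) := fun s => by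
    rw [← deriv_comp_add_const, show (fun x => q (x + 2 * Real.pi)) = q from funext hper]
  have hddper : Function.Periodic (deriv (deriv q)) (2 * Real.pi) := fun s => by
    rw [← deriv_comp_add_const, show (fun x => deriv q (x + 2 * Real.pi)) = deriv q from
      funext hdper]
  set a := segMean (fun _ => 1) (deriv q)
  set b := segMean (fun u => u) (deriv (deriv q))
  have ha : ∀ t s, q s - q t = ((s - t : ℝ) : ℂ) * a (t, s) := sub_smul_segMean_deriv hq1
  have hb : ∀ t s, deriv q s = a (t, s) + ((s - t : ℝ) : ℂ) * b (t, s) := deriv_sub_segMean hq2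
  refine isCkHolderKernel_of_near_diagonal hper hinj (G := fun p => form (a p) (b p))
    (fun t s => by rw [hk, hk, hper]) (fun t s => by rw [hk, hk, hper, hdper])
    (fun s => by simp only [a, b, segMean_add_period hdper, segMean_add_period hddper]) ?_ ?_
  · intro t s hne _
    rw [hk, ha, hb t s, hform _ _ _ (sub_ne_zero.2 hne.symm)]
  · intro t s hts i j
    have ha0 : a (t, s) ≠ 0 := by
      rcases eq_or_ne t s with rfl | hne
      · have := hb t t
        simp only [sub_self, Complex.ofReal_zero, zero_mul, add_zero] at this
        exact this ▸ hder t
      · intro h0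
        have := ha t s
        rw [h0, mul_zero, sub_eq_zero] at this
        exact hne (eq_of_abs_sub_lt hper hinj this.symm hts)
    have h1 : CkHolderAt m α a (t, s) :=
      (ckHolderAt_segMean continuous_const hdq _).of_succ hα
    have h2 : CkHolderAt m α b (t, s) := ckHolderAt_segMean continuous_id (isCkHolder_deriv hdq) _
    exact CkHolderAt.contDiff_comp (f := fun y => (a y, b y))
      (g := fun p : ℂ × ℂ => form p.1 p.2 i j) hα (hsmooth _ _ ha0 i j) (h1.prodMk h2)

/-- The parametrized kernels of `B` and `T₂` lose two derivatives. -/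
theorem isCkHolderKernel_kernelB_kernelT2 {Ω : Set ℂ} (lam mu : ℝ) {k : ℕ} {α : ℝ≥0} (hα : α < 1)
    (hk : 2 < (k : ℝ) + (α : ℝ)) {q : ℝ → ℂ} (hq : IsRegularParam Ω q) (hqk : IsCkHolder k α q) :
    IsCkHolderKernel (k - 2) α q (paramKernel kernelB q) ∧
      IsCkHolderKernel (k - 2) α q (paramKernel (kernelT2 lam mu) q) := by
  obtain ⟨m, rfl⟩ : ∃ m, k = m + 2 := by
    refine ⟨k - 2, (Nat.sub_add_cancel ?_).symm⟩
    have h1 : (α : ℝ) < 1 := by exact_mod_cast hα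
    have : (1 : ℝ) < k := by linarith
    exact_mod_cast this
  rw [Nat.add_sub_cancel]
  refine ⟨isCkHolderKernel_param hq.periodic hq.injOn hq.deriv_ne_zero hα.le hqk
      (form := fun z v => angleForm z v • 1) (fun t s => paramKernel_kernelB (hq.deriv_ne_zero s) t)
      (fun h a b hh => by rw [angleForm_real_mul hh]) (fun a b ha i j => ?_),
    isCkHolderKernel_param hq.periodic hq.injOn hq.deriv_ne_zero hα.le hqk
      (fun t s => paramKernel_kernelT2 lam mu (hq.deriv_ne_zero s) t)
      (fun h a b hh => elasticForm_real_mul lam mu hh a b)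
      (fun a b ha i j => contDiffAt_elasticForm lam mu ha b i j)⟩
  exact (contDiffAt_angleForm ha b).mul contDiffAt_const

/-! ### The Riemann mapping at the boundary -/

theorem norm_exp_I_mul (w : ℂ) : ‖Complex.exp (Complex.I * w)‖ = Real.exp (-w.im) := by
  rw [Complex.norm_exp]; simp

theorem nhdsWithin_ball_neBot {z : ℂ} (hz : ‖z‖ ≤ 1) : (𝓝[Metric.ball (0 : ℂ) 1] z).NeBot := by
  rw [← mem_closure_iff_nhdsWithin_neBot, closure_ball _ one_ne_zero]
  simpa using hz

theorem IsParamByRiemannMap.periodic {Φ : ℂ → ℂ} {q : ℝ → ℂ} (hq : IsParamByRiemannMap Φ q) :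
    Function.Periodic q (2 * Real.pi) := fun s => by
  have := nhdsWithin_ball_neBot (Complex.norm_exp_ofReal_mul_I s).le
  refine tendsto_nhds_unique ?_ (hq s)
  have h := hq (s + 2 * Real.pi)
  have e : Complex.exp (((s + 2 * Real.pi : ℝ) : ℂ) * Complex.I) = Complex.exp (s * Complex.I) := by
    push_cast
    rw [add_mul, Complex.exp_periodic]
  rwa [e] at h

/-- A Riemann mapping is open and one-to-one, so its boundary values lie on the boundary. -/
theorem IsParamByRiemannMap.mem_frontier {Ω : Set ℂ} {Φ : ℂ → ℂ} {q : ℝ → ℂ} (hΩ : IsOpen Ω)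
    (hΦ : IsRiemannMap Ω Φ) (hq : IsParamByRiemannMap Φ q) (s : ℝ) : q s ∈ frontier Ω := by
  have hb := nhdsWithin_ball_neBot (Complex.norm_exp_ofReal_mul_I s).le
  rw [hΩ.frontier_eq]
  constructor
  · refine mem_closure_of_tendsto (hq s) ?_
    filter_upwards [self_mem_nhdsWithin] with z hz
    exact hΦ.image_eq ▸ mem_image_of_mem Φ hz
  · intro hmem
    rw [← hΦ.image_eq] at hmem
    obtain ⟨z₁, hz₁, hz₁q⟩ := hmem
    have hz₁' : ‖z₁‖ < 1 := by simpa using hz₁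
    obtain ⟨r, hr1, hr2⟩ := exists_between hz₁'
    have han : AnalyticOnNhd ℂ Φ (Metric.ball 0 1) := hΦ.holo.analyticOnNhd Metric.isOpen_ball
    have hsub : Metric.ball (0 : ℂ) r ⊆ Metric.ball 0 1 := Metric.ball_subset_ball hr2.le
    have hopen : IsOpen (Φ '' Metric.ball 0 r) := by
      rcases han.is_constant_or_isOpen (convex_ball _ _).isPreconnected with ⟨w, hw⟩ | h
      · exfalso
        have h0 : (0 : ℂ) ∈ Metric.ball (0 : ℂ) 1 := by simp
        have h1 : (1 / 2 : ℂ) ∈ Metric.ball (0 : ℂ) 1 := by simp; norm_num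
        have := hΦ.injOn h0 h1 (by rw [hw _ h0, hw _ h1])
        norm_num at this
      · exact h _ hsub Metric.isOpen_ball
    have hqmem : q s ∈ Φ '' Metric.ball 0 r := ⟨z₁, by simpa using hr1, hz₁q⟩
    have h1 := (hq s).eventually (hopen.mem_nhds hqmem)
    have h2 : ∀ᶠ z in 𝓝[Metric.ball 0 1] (Complex.exp (s * Complex.I)), r < ‖z‖ := by
      refine nhdsWithin_le_nhds (continuous_norm.continuousAt.eventually_const_lt ?_)
      change r < ‖_‖
      rwa [Complex.norm_exp_ofReal_mul_I]
    obtain ⟨z, ⟨z₂, hz₂, hz₂e⟩, hz2, hz3⟩ := (h1.and (h2.and self_mem_nhdsWithin)).exists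
    have := hΦ.injOn (hsub hz₂) hz3 hz₂e
    rw [← this] at hz2
    simp at hz₂
    linarith

theorem exists_eq_exp_of_norm_eq_one {z : ℂ} (hz : ‖z‖ = 1) :
    ∃ s : ℝ, z = Complex.exp (s * Complex.I) :=
  ⟨z.arg, by have := Complex.norm_mul_exp_arg_mul_I z; rw [hz] at this; simpa using this.symm⟩

/-- The Riemann mapping extends continuously to the closed disc. -/
theorem IsParamByRiemannMap.exists_closedBall {Ω : Set ℂ} {Φ : ℂ → ℂ} {q : ℝ → ℂ}
    (hΦ : IsRiemannMap Ω Φ) (hq : IsParamByRiemannMap Φ q) :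
    ∃ Φc : ℂ → ℂ, ContinuousOn Φc (Metric.closedBall 0 1) ∧
      (∀ z ∈ Metric.ball (0 : ℂ) 1, Φc z = Φ z) ∧
      ∀ s : ℝ, Φc (Complex.exp (s * Complex.I)) = q s := by
  have hin : ∀ z ∈ Metric.ball (0 : ℂ) 1, Tendsto Φ (𝓝[Metric.ball 0 1] z) (𝓝 (Φ z)) :=
    fun z hz => (hΦ.holo z hz).continuousWithinAt
  refine ⟨extendFrom (Metric.ball 0 1) Φ, continuousOn_extendFrom ?_ fun z hz => ?_,
    fun z hz => ?_, fun s => ?_⟩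
  · rw [closure_ball _ one_ne_zero]
  · have hz' : ‖z‖ ≤ 1 := by simpa using hz
    rcases hz'.lt_or_eq with h | h
    · exact ⟨_, hin z (by simpa using h)⟩
    · obtain ⟨s, rfl⟩ := exists_eq_exp_of_norm_eq_one h
      exact ⟨_, hq s⟩
  · exact extendFrom_eq (subset_closure hz) (hin z hz)
  · refine extendFrom_eq ?_ (hq s)
    rw [closure_ball _ one_ne_zero]
    simp

/-! ### Continuation of the Riemann mapping across the unit circle -/

theorem isOpen_strip (ε : ℝ) : IsOpen {t : ℂ | |t.im| < ε} :=
  isOpen_lt (by fun_prop) continuous_const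

theorem strip_periodic_of_real_periodic {Q : ℂ → ℂ} {q : ℝ → ℂ} {ε : ℝ} (hε : 0 < ε)
    (hQ : DifferentiableOn ℂ Q {t : ℂ | |t.im| < ε}) (hQq : ∀ s : ℝ, Q s = q s)
    (hq : Function.Periodic q (2 * Real.pi)) {w : ℂ} (hw : |w.im| < ε) :
    Q (w + 2 * Real.pi) = Q w := by
  set S := {t : ℂ | |t.im| < ε}
  have hconv : Convex ℝ S := by
    have : S = Complex.imLm ⁻¹' Ioo (-ε) ε := by ext t; simp [S, abs_lt]
    rw [this]; exact (convex_Ioo _ _).linear_preimage _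
  have hsh : MapsTo (fun w : ℂ => w + 2 * Real.pi) S S := fun w hw => by
    simp only [S, mem_ofPred_eq] at hw ⊢
    have : ((w + 2 * Real.pi : ℂ)).im = w.im := by simp
    rwa [this]
  have hd : DifferentiableOn ℂ (fun w => Q (w + 2 * Real.pi) - Q w) S :=
    (hQ.comp (by fun_prop) hsh).sub hQ
  have han := hd.analyticOnNhd (isOpen_strip ε)
  have h0 : (0 : ℂ) ∈ S := by simpa [S] using hε
  have hfreq : ∃ᶠ z in 𝓝[≠] (0 : ℂ), Q (z + 2 * Real.pi) - Q z = 0 := by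
    have ht : Tendsto (fun x : ℝ => (x : ℂ)) (𝓝[≠] 0) (𝓝[≠] 0) := by
      refine tendsto_nhdsWithin_iff.2 ⟨?_, ?_⟩
      · exact (Complex.continuous_ofReal.tendsto' 0 0 (by simp)).mono_left nhdsWithin_le_nhds
      · filter_upwards [self_mem_nhdsWithin] with x hx
        simpa using hx
    refine ht.frequently (Eventually.frequently (Eventually.of_forall fun x => ?_))
    have h := hQq (x + 2 * Real.pi)
    push_cast at h
    rw [h, hQq, hq, sub_self]
  exact sub_eq_zero.1 (han.eqOn_zero_of_preconnected_of_frequently_eq_zero hconv.isPreconnected h0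
    hfreq hw)

/-- In the upper half of the strip, the extension `Q` of `q` is the lift `w ↦ Φ(e^{iw})` of the
Riemann mapping: the difference of the two is bounded and vanishes on the real line, hence
everywhere by the three lines theorem. -/
theorem riemannMap_exp_eq {Ω : Set ℂ} {Φ : ℂ → ℂ} {q : ℝ → ℂ} (hΦ : IsRiemannMap Ω Φ)
    (hq : IsParamByRiemannMap Φ q) {Q : ℂ → ℂ} {ε : ℝ}
    (hQ : DifferentiableOn ℂ Q {t : ℂ | |t.im| < ε}) (hQq : ∀ s : ℝ, Q s = q s) {w : ℂ}
    (hw0 : 0 < w.im) (hwε : w.im < ε) : Φ (Complex.exp (Complex.I * w)) = Q w := by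
  have hε : 0 < ε := hw0.trans hwε
  obtain ⟨δ, hδ1, hδ2⟩ := exists_between hwε
  have hδ0 : 0 < δ := hw0.trans hδ1
  obtain ⟨Φc, hc, hcΦ, hcq⟩ := hq.exists_closedBall hΦ
  have hper := fun {w : ℂ} (hw : |w.im| < ε) =>
    strip_periodic_of_real_periodic hε hQ hQq hq.periodic hw
  let L : ℂ → ℂ := fun z => Complex.I * (δ * z)
  have hLim : ∀ z, (L z).im = δ * z.re := fun z => by simp [L]
  let f : ℂ → ℂ := fun z => Φc (Complex.exp (Complex.I * L z)) - Q (L z)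
  have hn : ∀ z, ‖Complex.exp (Complex.I * L z)‖ = Real.exp (-(δ * z.re)) := fun z => by
    rw [norm_exp_I_mul, hLim]
  have hclosed : Complex.HadamardThreeLines.verticalClosedStrip 0 1 ⊆
      (fun z => Complex.exp (Complex.I * L z)) ⁻¹' Metric.closedBall 0 1 := fun z hz => by
    have : 0 ≤ z.re := hz.1
    simp only [mem_preimage, mem_closedBall_zero_iff, hn]
    rw [Real.exp_le_one_iff]
    have := mul_nonneg hδ0.le this
    linarith
  have hclosed2 : ∀ z ∈ Complex.HadamardThreeLines.verticalClosedStrip 0 1,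
      0 ≤ (L z).im ∧ (L z).im ≤ δ := fun z hz => by
    rw [hLim]
    exact ⟨mul_nonneg hδ0.le hz.1, by nlinarith [hz.2]⟩
  have hstrip : MapsTo L (Complex.HadamardThreeLines.verticalClosedStrip 0 1)
      {t : ℂ | |t.im| < ε} := fun z hz => by
    have := hclosed2 z hz
    simp only [mem_ofPred_eq, abs_lt]
    constructor <;> linarith [this.1, this.2]
  have hLd : Differentiable ℂ L := by fun_prop
  have hLc : Continuous L := hLd.continuous
  have hd : DiffContOnCl ℂ f (Complex.HadamardThreeLines.verticalStrip 0 1) := by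
    have hsub : closure (Complex.HadamardThreeLines.verticalStrip 0 1) ⊆
        Complex.HadamardThreeLines.verticalClosedStrip 0 1 := by
      refine closure_minimal (fun z hz => ⟨hz.1.le, hz.2.le⟩) ?_
      exact isClosed_Icc.preimage Complex.continuous_re
    refine ⟨?_, ?_⟩
    · have hopen : IsOpen (Complex.HadamardThreeLines.verticalStrip 0 1) :=
        isOpen_Ioo.preimage Complex.continuous_re
      refine DifferentiableOn.sub ?_ ?_
      · have : DifferentiableOn ℂ (fun z => Φ (Complex.exp (Complex.I * L z)))
            (Complex.HadamardThreeLines.verticalStrip 0 1) := by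
          refine hΦ.holo.comp (by fun_prop) fun z hz => ?_
          simp only [mem_ball_zero_iff, hn, Real.exp_lt_one_iff]
          have := mul_pos hδ0 hz.1
          linarith
        refine this.congr fun z hz => hcΦ _ ?_
        simp only [mem_ball_zero_iff, hn, Real.exp_lt_one_iff]
        have := mul_pos hδ0 hz.1
        linarith
      · exact hQ.comp hLd.differentiableOn fun z hz => hstrip ⟨hz.1.le, hz.2.le⟩
    · refine ContinuousOn.sub ?_ ?_
      · exact hc.comp (by fun_prop) fun z hz => hclosed (hsub hz)
      · exact hQ.continuousOn.comp hLc.continuousOn fun z hz => hstrip (hsub hz)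
  obtain ⟨M₁, hM₁⟩ := (isCompact_closedBall (0 : ℂ) 1).exists_bound_of_continuousOn hc
  have hK : IsCompact (Icc 0 (2 * Real.pi) ×ℂ Icc 0 δ) := isCompact_Icc.reProdIm isCompact_Icc
  obtain ⟨M₂, hM₂⟩ := hK.exists_bound_of_continuousOn (f := Q) (hQ.continuousOn.mono fun z hz => by
    have := (Complex.mem_reProdIm.1 hz).2
    simp only [mem_ofPred_eq, abs_lt]
    constructor <;> linarith [this.1, this.2])
  have hM₂' : ∀ z : ℂ, 0 ≤ z.im → z.im ≤ δ → ‖Q z‖ ≤ M₂ := fun z h1 h2 => by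
    have hpf : Function.Periodic (fun x : ℝ => Q (x + z.im * Complex.I)) (2 * Real.pi) := fun x => by
      have := hper (w := x + z.im * Complex.I) (by
        simp only [Complex.add_im, Complex.ofReal_im, Complex.mul_I_im, Complex.ofReal_re,
          zero_add, abs_lt]
        constructor <;> linarith)
      simp only
      rw [← this]
      push_cast
      ring_nf
    have hp : 0 < 2 * Real.pi := by positivity
    obtain ⟨y, hy, hyz⟩ := hpf.exists_mem_Ico₀ hp z.re
    have hz : ((z.re : ℝ) : ℂ) + z.im * Complex.I = z := Complex.re_add_im z
    simp only [hz] at hyz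
    rw [hyz]
    refine hM₂ _ (Complex.mem_reProdIm.2 ⟨?_, ?_⟩)
    · simpa using ⟨hy.1, hy.2.le⟩
    · simpa using ⟨h1, h2⟩
  have hbd : ∀ z ∈ Complex.HadamardThreeLines.verticalClosedStrip 0 1, ‖f z‖ ≤ M₁ + M₂ :=
    fun z hz => (norm_sub_le _ _).trans
      (add_le_add (hM₁ _ (hclosed hz)) (hM₂' _ (hclosed2 z hz).1 (hclosed2 z hz).2))
  let z₀ : ℂ := -Complex.I * w / δ
  have hδc : (δ : ℂ) ≠ 0 := by exact_mod_cast hδ0.ne'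
  have hLz₀ : L z₀ = w := by
    simp only [L, z₀]
    rw [mul_div_cancel₀ _ hδc, ← mul_assoc]
    simp
  have hz₀re : δ * z₀.re = w.im := by rw [← hLim, hLz₀]
  have hz₀ : z₀.re < 1 := by
    by_contra h
    push Not at h
    nlinarith
  have hz₀' : 0 < z₀.re := by
    by_contra h
    push Not at h
    nlinarith
  have h := Complex.HadamardThreeLines.norm_le_interp_of_mem_verticalClosedStrip₀₁' f
    (a := 0) (b := M₁ + M₂) (show z₀ ∈ _ from ⟨hz₀'.le, hz₀.le⟩) hd
    ⟨M₁ + M₂, by rintro _ ⟨z, hz, rfl⟩; exact hbd z hz⟩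
    (fun z hz => by
      have hz' : z.re = 0 := hz
      have hreal : L z = ((-(δ * z.im) : ℝ) : ℂ) := by
        apply Complex.ext <;> simp [L, hz']
      simp only [f, hreal, hQq]
      rw [mul_comm, hcq, sub_self, norm_zero])
    (fun z hz => by
      have hz' : z.re = 1 := hz
      exact hbd z ⟨by simp [hz'], by simp [hz']⟩)
  rw [Real.zero_rpow (by linarith), zero_mul] at h
  have h' := norm_le_zero_iff.1 h
  simp only [f, hLz₀] at h'
  rw [hcΦ _ (by simpa [norm_exp_I_mul] using hw0)] at h'
  exact sub_eq_zero.1 h'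

/-- If `q(s) = Φ(e^{is})` extends holomorphically to the strip `|Im t| < ε`, then `Φ` extends
holomorphically to the disc of radius `e^ε`. -/
theorem exists_riemannMap_extension {Ω : Set ℂ} {Φ : ℂ → ℂ} {q : ℝ → ℂ} (hΦ : IsRiemannMap Ω Φ)
    (hq : IsParamByRiemannMap Φ q) {Q : ℂ → ℂ} {ε : ℝ} (hε : 0 < ε)
    (hQ : DifferentiableOn ℂ Q {t : ℂ | |t.im| < ε}) (hQq : ∀ s : ℝ, Q s = q s) :
    ∃ Ψ : ℂ → ℂ, DifferentiableOn ℂ Ψ (Metric.ball 0 (Real.exp ε)) ∧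
      (∀ z ∈ Metric.ball (0 : ℂ) 1, Ψ z = Φ z) ∧
      ∀ w : ℂ, |w.im| < ε → Ψ (Complex.exp (Complex.I * w)) = Q w := by
  classical
  let Ψ : ℂ → ℂ := fun z => if ‖z‖ < 1 then Φ z else Q (-Complex.I * Complex.log z)
  have hI : ∀ z : ℂ, z ≠ 0 → Complex.exp (Complex.I * (-Complex.I * Complex.log z)) = z :=
    fun z hz => by
      rw [← mul_assoc, mul_neg, Complex.I_mul_I, neg_neg, one_mul, Complex.exp_log hz]
  have hper : ∀ (w : ℂ), |w.im| < ε → ∀ n : ℤ, Q (w + n * (2 * Real.pi)) = Q w := fun w hw n => by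
    have : Function.Periodic (fun x : ℝ => Q (x + w.im * Complex.I)) (2 * Real.pi) := fun x => by
      have := strip_periodic_of_real_periodic hε hQ hQq hq.periodic
        (w := x + w.im * Complex.I) (by simpa using hw)
      simp only
      rw [← this]
      push_cast
      ring_nf
    have := (this.int_mul n) w.re
    conv_rhs => rw [← Complex.re_add_im w]
    rw [← this]
    congr 1
    conv_lhs => rw [← Complex.re_add_im w]
    push_cast
    ring
  have hΨQ : ∀ w : ℂ, |w.im| < ε → Ψ (Complex.exp (Complex.I * w)) = Q w := fun w hw => by
    simp only [Ψ]
    split_ifs with h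
    · rw [norm_exp_I_mul, Real.exp_lt_one_iff] at h
      exact riemannMap_exp_eq hΦ hq hQ hQq (by linarith) (abs_lt.1 hw).2
    · have he := hI _ (Complex.exp_ne_zero (Complex.I * w))
      rw [Complex.exp_eq_exp_iff_exists_int] at he
      obtain ⟨n, hn⟩ := he
      have h2 : -Complex.I * Complex.log (Complex.exp (Complex.I * w)) = w + n * (2 * Real.pi) := by
        apply mul_left_cancel₀ Complex.I_ne_zero
        rw [hn]
        ring
      rw [h2, hper w hw]
  have hΨΦ : ∀ z ∈ Metric.ball (0 : ℂ) 1, Ψ z = Φ z := fun z hz => if_pos (by simpa using hz)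
  refine ⟨Ψ, fun z hz => ?_, hΨΦ, hΨQ⟩
  refine DifferentiableAt.differentiableWithinAt ?_
  by_cases h1 : ‖z‖ < 1
  · have hz1 : z ∈ Metric.ball (0 : ℂ) 1 := by simpa using h1
    refine ((hΦ.holo z hz1).differentiableAt (Metric.isOpen_ball.mem_nhds hz1)
      ).congr_of_eventuallyEq ?_
    filter_upwards [Metric.isOpen_ball.mem_nhds hz1] with y hy using hΨΦ y hy
  · -- near `z`, the logarithm that is continuous at `z` provides a lift to the strip
    push Not at h1
    have hz0 : z ≠ 0 := by rintro rfl; simp at h1; linarith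
    let ℓ : ℂ → ℂ := fun y => -Complex.I * Complex.log z + -Complex.I * Complex.log (y / z)
    have hℓz : ℓ z = -Complex.I * Complex.log z := by simp [ℓ, div_self hz0]
    have hℓd : DifferentiableAt ℂ ℓ z := by
      have : z / z ∈ Complex.slitPlane := by rw [div_self hz0]; simp
      exact (((differentiableAt_id.div_const z).clog this).const_mul _).const_add _
    have hzim : |(ℓ z).im| < ε := by
      rw [hℓz]
      have : (-Complex.I * Complex.log z).im = -Real.log ‖z‖ := by simp [Complex.log_re]
      rw [this, abs_neg, abs_of_nonneg (Real.log_nonneg h1)]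
      rw [Real.log_lt_iff_lt_exp (by linarith)]
      simpa using hz
    have hQd : DifferentiableAt ℂ Q (ℓ z) :=
      (hQ _ hzim).differentiableAt ((isOpen_strip ε).mem_nhds hzim)
    refine (DifferentiableAt.comp z hQd hℓd).congr_of_eventuallyEq ?_
    have h2 : ∀ᶠ y in 𝓝 z, |(ℓ y).im| < ε :=
      hℓd.continuousAt.eventually ((isOpen_strip ε).mem_nhds hzim)
    filter_upwards [h2, isOpen_ne.mem_nhds hz0] with y hy hy0
    rw [Function.comp_apply, ← hΨQ _ hy]
    congr 1
    simp only [ℓ]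
    rw [mul_add, Complex.exp_add, hI z hz0, hI _ (div_ne_zero hy0 hz0), mul_div_cancel₀ _ hz0]

/-! ### The derivative of the Riemann mapping on the unit circle -/

/-- The open sector of the `y` that make an angle less than `π/3` with `-i`. -/
def downSector : Set ℂ := {y : ℂ | y.im + ‖y‖ / 2 < 0}

theorem isOpen_downSector : IsOpen downSector :=
  isOpen_lt (by fun_prop) continuous_const

theorem convex_downSector : Convex ℝ downSector := by
  intro x hx y hy a b ha hb hab
  simp only [downSector, mem_ofPred_eq] at hx hy ⊢
  have h1 : (a • x + b • y).im = a * x.im + b * y.im := by simp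
  have h2 : ‖a • x + b • y‖ ≤ a * ‖x‖ + b * ‖y‖ := by
    refine (norm_add_le _ _).trans ?_
    rw [norm_smul, norm_smul, Real.norm_of_nonneg ha, Real.norm_of_nonneg hb]
  rw [h1]
  have h3 : a * (x.im + ‖x‖ / 2) ≤ 0 := mul_nonpos_of_nonneg_of_nonpos ha hx.le
  have h4 : b * (y.im + ‖y‖ / 2) ≤ 0 := mul_nonpos_of_nonneg_of_nonpos hb hy.le
  rcases eq_or_lt_of_le ha with h | h
  · have : b = 1 := by linarith
    subst h; subst this
    nlinarith
  · have : a * (x.im + ‖x‖ / 2) < 0 := mul_neg_of_pos_of_neg h hx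
    nlinarith

theorem smul_mem_downSector {c : ℝ} (hc : 0 < c) {y : ℂ} (hy : y ∈ downSector) :
    (c : ℂ) * y ∈ downSector := by
  simp only [downSector, mem_ofPred_eq, norm_mul, Complex.norm_real, Complex.im_ofReal_mul,
    Real.norm_of_nonneg hc.le] at hy ⊢
  nlinarith

/-- At a boundary point with tangent `p'`, a small sector about the outer normal does not meet
`Ω`: it contains a point outside `Ω`, and does not meet the boundary. -/
theorem IsRegularParam.exists_sector_disjoint {Ω : Set ℂ} (hΩ : IsOpen Ω) {p : ℝ → ℂ}
    (hp : IsRegularParam Ω p) (σ : ℝ) :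
    ∃ r > 0, ∀ y ∈ downSector, ‖y‖ < r → p σ + deriv p σ * y ∉ Ω := by
  set v := deriv p σ with hv
  have hv0 : v ≠ 0 := hp.deriv_ne_zero σ
  -- near `σ`, the curve is close to its tangent
  have hder : HasDerivAt p v σ := ((hp.contDiff.differentiable (by simp)) σ).hasDerivAt
  have hlo := (hasDerivAt_iff_isLittleO.1 hder).def (c := ‖v‖ / 4) (by positivity)
  obtain ⟨δ, hδ, hδ'⟩ := Metric.eventually_nhds_iff.1 hlo
  have hnear : ∀ t, |t - σ| < δ → ∀ y, p t = p σ + v * y → y ∉ downSector := by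
    intro t ht y hy hyd
    have h1 := hδ' (show dist t σ < δ by rwa [Real.dist_eq])
    have h2 : p t - p σ - (t - σ) • v = v * (y - ((t - σ : ℝ) : ℂ)) := by
      rw [hy, Complex.real_smul]; ring
    rw [h2, norm_mul, Real.norm_eq_abs] at h1
    have h3 : ‖y - ((t - σ : ℝ) : ℂ)‖ ≤ |t - σ| / 4 := by
      refine le_of_mul_le_mul_left (h1.trans_eq ?_) (norm_pos_iff.2 hv0)
      ring
    have h4 : |y.im| ≤ |t - σ| / 4 := by
      have := (Complex.abs_im_le_norm (y - ((t - σ : ℝ) : ℂ))).trans h3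
      simpa using this
    have h5 : |t - σ| ≤ ‖y‖ + |t - σ| / 4 := by
      have := norm_sub_norm_le ((t - σ : ℝ) : ℂ) y
      rw [norm_sub_rev, Complex.norm_real, Real.norm_eq_abs] at this
      linarith
    simp only [downSector, mem_ofPred_eq] at hyd
    have := (abs_le.1 h4).1
    linarith [abs_nonneg (t - σ)]
  -- the rest of the curve keeps away from `p σ`
  have hfar : ∃ r > 0, ∀ t, σ - Real.pi ≤ t → t ≤ σ + Real.pi → δ ≤ |t - σ| →
      r ≤ ‖p t - p σ‖ := by
    let K : Set ℝ := Icc (σ - Real.pi) (σ + Real.pi) ∩ {t | δ ≤ |t - σ|}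
    have hK : IsCompact K := isCompact_Icc.inter_right
      (isClosed_le continuous_const (by fun_prop))
    have hcont : ContinuousOn (fun t => ‖p t - p σ‖) K := by
      have := hp.contDiff.continuous
      fun_prop
    rcases K.eq_empty_or_nonempty with hKe | hKne
    · refine ⟨1, one_pos, fun t h1 h2 h3 => ?_⟩
      have : t ∈ K := ⟨⟨h1, h2⟩, h3⟩
      rw [hKe] at this
      exact this.elim
    · obtain ⟨t₀, ht₀, hmin⟩ := hK.exists_isMinOn hKne hcont
      refine ⟨‖p t₀ - p σ‖, ?_, fun t h1 h2 h3 => hmin (show t ∈ K from ⟨⟨h1, h2⟩, h3⟩)⟩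
      rw [gt_iff_lt, norm_pos_iff, sub_ne_zero]
      intro heq
      have := eq_of_abs_sub_lt hp.periodic hp.injOn heq (by
        have := ht₀.1
        rw [abs_lt]; constructor <;> linarith [this.1, this.2, Real.pi_pos])
      have h := ht₀.2
      simp only [mem_ofPred_eq, this, sub_self, abs_zero] at h
      linarith
  obtain ⟨r, hr, hr'⟩ := hfar
  refine ⟨r / ‖v‖, by positivity, ?_⟩
  set S : Set ℂ := downSector ∩ Metric.ball 0 (r / ‖v‖)
  have hSc : IsPreconnected S := (convex_downSector.inter (convex_ball _ _)).isPreconnected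
  have hmapc : Continuous fun y => p σ + v * y := by fun_prop
  have himg : IsPreconnected ((fun y => p σ + v * y) '' S) := hSc.image _ hmapc.continuousOn
  have hfr : ∀ y ∈ S, p σ + v * y ∉ frontier Ω := by
    intro y hy hyf
    rw [← hp.range_eq] at hyf
    have hpp : 0 < 2 * Real.pi := by positivity
    obtain ⟨t, ht⟩ := hyf
    obtain ⟨t', ht', htt'⟩ := hp.periodic.exists_mem_Ico hpp t (σ - Real.pi)
    rw [htt'] at ht
    by_cases h : |t' - σ| < δ
    · exact hnear t' h y ht hy.1
    · have h1 := hr' t' ht'.1 (by linarith [ht'.2]) (not_lt.1 h)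
      rw [ht, add_sub_cancel_left, norm_mul] at h1
      have h2 : ‖y‖ < r / ‖v‖ := by simpa using hy.2
      rw [lt_div_iff₀ (norm_pos_iff.2 hv0)] at h2
      linarith [mul_comm ‖v‖ ‖y‖]
  -- a point of the sector that is not in `Ω`
  obtain ⟨y₁, hy₁S, hy₁Ω⟩ : ∃ y ∈ S, p σ + v * y ∉ Ω := by
    have h1 := hp.leftSide σ
    have h2 : ∀ᶠ τ : ℝ in 𝓝[>] 0, τ < r / ‖v‖ :=
      nhdsWithin_le_nhds (Iio_mem_nhds (by positivity))
    obtain ⟨τ, ⟨-, h1⟩, h2, h3⟩ := (h1.and (h2.and self_mem_nhdsWithin)).exists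
    have h3' : 0 < τ := h3
    refine ⟨-(τ * Complex.I), ⟨?_, ?_⟩, ?_⟩
    · simp [downSector, abs_of_pos h3']
      linarith
    · simpa [abs_of_pos h3'] using h2
    · have e : p σ + v * -(τ * Complex.I) = p σ - τ * (Complex.I * v) := by ring
      rwa [e]
  have hcover : (fun y => p σ + v * y) '' S ⊆ Ω ∪ (closure Ω)ᶜ := by
    rintro _ ⟨y, hy, rfl⟩
    by_contra h
    rw [mem_union, not_or, notMem_compl_iff] at h
    refine hfr y hy ?_
    rw [hΩ.frontier_eq]
    exact ⟨h.2, h.1⟩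
  intro y hy hyr hyΩ
  have hyS : y ∈ S := ⟨hy, by simpa using hyr⟩
  obtain ⟨z, -, hz1, hz2⟩ := himg Ω (closure Ω)ᶜ hΩ isClosed_closure.isOpen_compl hcover
    ⟨_, mem_image_of_mem _ hyS, hyΩ⟩
    ⟨_, mem_image_of_mem _ hy₁S, (hcover (mem_image_of_mem _ hy₁S)).resolve_left hy₁Ω⟩
  exact hz2 (subset_closure hz1)

/-- A half-plane of directions `e^{iθ}`, `|θ| < π/2`, is mapped by `y ↦ C y^m`, `m ≥ 2`, to a set
of directions that meets the sector about `-i`. -/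
theorem exists_mul_exp_mem_downSector {C : ℂ} (hC : C ≠ 0) {m : ℕ} (hm : 2 ≤ m) :
    ∃ θ : ℝ, 0 < Real.cos θ ∧ C * Complex.exp (θ * Complex.I) ^ m ∈ downSector := by
  set β := Complex.arg (-Complex.I / C)
  have hπ := Real.pi_pos
  have hβ : |β| ≤ Real.pi := Complex.abs_arg_le_pi _
  have hm' : (2 : ℝ) ≤ m := by exact_mod_cast hm
  have hm0 : (m : ℂ) ≠ 0 := by exact_mod_cast (by lia : m ≠ 0)
  have hCn : (‖C‖ : ℂ) ≠ 0 := by exact_mod_cast norm_ne_zero_iff.2 hC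
  -- the factor `9/10` keeps `θ` off the endpoints `±π/2`
  refine ⟨9 / 10 * β / m, Real.cos_pos_of_mem_Ioo (abs_lt.1 ?_), ?_⟩
  · rw [abs_div, abs_mul, Nat.abs_cast, div_lt_iff₀ (by linarith),
      abs_of_pos (by norm_num : (0 : ℝ) < 9 / 10)]
    nlinarith
  · have h1 : C * Complex.exp (β * Complex.I) = -Complex.I * ‖C‖ := by
      have h := Complex.norm_mul_exp_arg_mul_I (-Complex.I / C)
      rw [norm_div, norm_neg, Complex.norm_I] at h
      push_cast at h
      have : Complex.exp (β * Complex.I) = ‖C‖ * (-Complex.I / C) := by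
        rw [← h, ← mul_assoc, mul_one_div, div_self hCn, one_mul]
      rw [this]
      field_simp
    have h2 : C * Complex.exp ((9 / 10 * β / m : ℝ) * Complex.I) ^ m =
        (‖C‖ : ℂ) * (-Complex.I * Complex.exp ((-(β / 10) : ℝ) * Complex.I)) := by
      rw [← Complex.exp_nat_mul]
      have : (m : ℂ) * (((9 / 10 * β / m : ℝ) : ℂ) * Complex.I) =
          β * Complex.I + (-(β / 10) : ℝ) * Complex.I := by
        push_cast
        field_simp
        ring
      rw [this, Complex.exp_add, ← mul_assoc, h1]
      ring
    rw [h2]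
    refine smul_mem_downSector (norm_pos_iff.2 hC) ?_
    have h3 : (1 / 2 : ℝ) < Real.cos (β / 10) := by
      rw [← Real.cos_abs, ← Real.cos_pi_div_three]
      refine Real.cos_lt_cos_of_nonneg_of_le_pi (abs_nonneg _) (by linarith) ?_
      rw [abs_div, abs_of_pos (by norm_num : (0 : ℝ) < 10)]
      linarith
    simp only [downSector, mem_ofPred_eq, norm_mul, norm_neg, Complex.norm_I,
      Complex.norm_exp_ofReal_mul_I, Complex.mul_im, Complex.neg_re, Complex.neg_im, Complex.I_re,
      Complex.I_im, Complex.exp_ofReal_mul_I_re, Complex.exp_ofReal_mul_I_im, Real.cos_neg]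
    linarith

/-- A holomorphic extension of the Riemann mapping has no critical point on the unit circle: near a
zero of the derivative it would map the half-disc inside the circle to a set that meets the
sector about the outer normal, in contradiction to the regularity of the boundary. -/
theorem deriv_riemannMap_extension_ne_zero {Ω : Set ℂ} (hΩ : IsOpen Ω) {p : ℝ → ℂ}
    (hp : IsRegularParam Ω p) {Φ : ℂ → ℂ} (hΦ : IsRiemannMap Ω Φ) {Ψ : ℂ → ℂ} {R : ℝ}
    (hR : 1 < R) (hΨ : DifferentiableOn ℂ Ψ (Metric.ball 0 R))
    (hΨΦ : ∀ z ∈ Metric.ball (0 : ℂ) 1, Ψ z = Φ z) {ζ : ℂ} (hζ : ‖ζ‖ = 1)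
    (hfr : Ψ ζ ∈ frontier Ω) : deriv Ψ ζ ≠ 0 := by
  have hζ0 : ζ ≠ 0 := norm_ne_zero_iff.1 (by rw [hζ]; exact one_ne_zero)
  rw [← hp.range_eq] at hfr
  obtain ⟨σ, hσ⟩ := hfr
  obtain ⟨r, hr, hdisj⟩ := hp.exists_sector_disjoint hΩ σ
  have hv0 := hp.deriv_ne_zero σ
  set v := deriv p σ
  have hmem : Metric.ball (0 : ℂ) R ∈ 𝓝 ζ := Metric.isOpen_ball.mem_nhds (by simpa [hζ] using hR)
  have han : AnalyticAt ℂ Ψ ζ := hΨ.analyticAt hmem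
  have han' : AnalyticAt ℂ (fun z => Ψ z - Ψ ζ) ζ := han.sub analyticAt_const
  -- inside the disc, approach `ζ` along `ζ (1 - ρ e^{iθ})`
  have happ : ∀ θ : ℝ, Tendsto (fun ρ : ℝ => ζ * (1 - ρ * Complex.exp (θ * Complex.I))) (𝓝[>] 0)
      (𝓝 ζ) := fun θ => by
    have : Continuous fun ρ : ℝ => ζ * (1 - ρ * Complex.exp (θ * Complex.I)) := by fun_prop
    exact (this.tendsto' 0 ζ (by simp)).mono_left nhdsWithin_le_nhds
  have hdisc : ∀ θ : ℝ, 0 < Real.cos θ →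
      ∀ᶠ ρ : ℝ in 𝓝[>] 0, ζ * (1 - ρ * Complex.exp (θ * Complex.I)) ∈ Metric.ball (0 : ℂ) 1 := by
    intro θ hθ
    have h2 : ∀ᶠ ρ : ℝ in 𝓝[>] 0, ρ < 2 * Real.cos θ :=
      nhdsWithin_le_nhds (Iio_mem_nhds (by positivity))
    filter_upwards [h2, self_mem_nhdsWithin] with ρ hρ hρ0
    have hρ0' : 0 < ρ := hρ0
    rw [mem_ball_zero_iff, norm_mul, hζ, one_mul, ← sq_lt_one_iff₀ (norm_nonneg _),
      ← Complex.normSq_eq_norm_sq, Complex.normSq_apply]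
    simp only [Complex.sub_re, Complex.sub_im, Complex.one_re, Complex.one_im,
      Complex.re_ofReal_mul, Complex.im_ofReal_mul, Complex.exp_ofReal_mul_I_re,
      Complex.exp_ofReal_mul_I_im]
    have h3 := Real.sin_sq_add_cos_sq θ
    have h4 : ρ * (2 * Real.cos θ - ρ) > 0 := mul_pos hρ0' (by linarith)
    have h5 : ρ ^ 2 * (Real.sin θ ^ 2 + Real.cos θ ^ 2) = ρ ^ 2 := by rw [h3, mul_one]
    nlinarith
  have hnc : ¬ ∀ᶠ z in 𝓝 ζ, Ψ z - Ψ ζ = 0 := by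
    intro h
    have h1 := ((happ 0).eventually h).and (hdisc 0 (by simp))
    rw [eventually_nhdsWithin_iff, Metric.eventually_nhds_iff] at h1
    obtain ⟨δ, hδ, h1⟩ := h1
    have key : ∀ ρ : ℝ, 0 < ρ → ρ < δ → Φ (ζ * (1 - ρ)) = Ψ ζ ∧
        ζ * (1 - ρ) ∈ Metric.ball (0 : ℂ) 1 := fun ρ h0 h2 => by
      have h3 := h1 (y := ρ) (by simpa [abs_of_pos h0] using h2) h0
      simp only [Complex.ofReal_zero, zero_mul, Complex.exp_zero, mul_one] at h3
      exact ⟨by rw [← hΨΦ _ h3.2]; exact sub_eq_zero.1 h3.1, h3.2⟩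
    obtain ⟨a1, a2⟩ := key (δ / 2) (by linarith) (by linarith)
    obtain ⟨b1, b2⟩ := key (δ / 3) (by linarith) (by linarith)
    have h4 := mul_left_cancel₀ hζ0 (hΦ.injOn a2 b2 (a1.trans b1.symm))
    have h5 : δ / 2 = δ / 3 := by exact_mod_cast sub_right_injective h4
    linarith
  obtain ⟨m, g, hg, hg0, hfac⟩ := han'.exists_eventuallyEq_pow_smul_nonzero_iff.2 hnc
  intro hd
  have hm : 2 ≤ m := by
    by_contra hm
    have hself := hfac.self_of_nhds
    have hcases : m = 0 ∨ m = 1 := by lia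
    rcases hcases with rfl | rfl
    · simp only [sub_self, pow_zero, one_smul] at hself
      exact hg0 hself.symm
    · have h1 : HasDerivAt (fun z => (z - ζ) ^ 1 • g z) (g ζ) ζ := by
        have := ((hasDerivAt_id ζ).sub_const ζ).mul hg.differentiableAt.hasDerivAt
        simp only [id, sub_self, zero_mul, one_mul, add_zero] at this
        simp only [pow_one, smul_eq_mul]
        exact this
      have h2 := (h1.congr_of_eventuallyEq hfac).deriv
      rw [deriv_sub_const, hd] at h2
      exact hg0 h2.symm
  have hC : g ζ * (-ζ) ^ m / v ≠ 0 := div_ne_zero (mul_ne_zero hg0 (pow_ne_zero _ (by simpa))) hv0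
  obtain ⟨θ, hθ, hθm⟩ := exists_mul_exp_mem_downSector hC hm
  have hlim : Tendsto (fun ρ : ℝ => g (ζ * (1 - ρ * Complex.exp (θ * Complex.I))) * (-ζ) ^ m / v *
      Complex.exp (θ * Complex.I) ^ m) (𝓝[>] 0)
      (𝓝 (g ζ * (-ζ) ^ m / v * Complex.exp (θ * Complex.I) ^ m)) :=
    (((hg.continuousAt.tendsto.comp (happ θ)).mul_const _).div_const _).mul_const _
  have hsmall : Tendsto (fun ρ : ℝ => ‖(Ψ (ζ * (1 - ρ * Complex.exp (θ * Complex.I))) - Ψ ζ) / v‖)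
      (𝓝[>] 0) (𝓝 0) := by
    have h1 := han.continuousAt.tendsto.comp (happ θ)
    simpa using ((h1.sub_const (Ψ ζ)).div_const v).norm
  obtain ⟨ρ, h1, h2, h3, h4, h5⟩ := ((hlim.eventually (isOpen_downSector.mem_nhds hθm)).and
    ((hsmall.eventually_lt_const hr).and (((happ θ).eventually hfac).and
      ((hdisc θ hθ).and self_mem_nhdsWithin)))).exists
  have h5' : (0 : ℝ) < ρ ^ m := pow_pos h5 m
  set z := ζ * (1 - ρ * Complex.exp (θ * Complex.I)) with hz
  have h6 : (Ψ z - Ψ ζ) / v ∈ downSector := by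
    have := smul_mem_downSector h5' h1
    convert this using 1
    rw [h3, smul_eq_mul, show z - ζ = ρ * (-ζ) * Complex.exp (θ * Complex.I) by rw [hz]; ring,
      mul_pow, mul_pow]
    push_cast
    ring
  refine hdisj _ h6 h2 ?_
  rw [mul_div_cancel₀ _ hv0, hσ, add_sub_cancel, hΨΦ z h4, ← hΦ.image_eq]
  exact mem_image_of_mem _ h4

/-! ### Joint continuity of divided differences -/

/-- A function `f a z` that is holomorphic in `z` on a disc is jointly continuous as soon as it is
so for `a` inside and `z` on each smaller circle: by Cauchy's formula it is an integral over such a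
circle. -/
theorem continuousOn_uncurry_of_sphere {f : ℂ → ℂ → ℂ} {R : ℝ}
    (hf : ∀ a ∈ Metric.ball (0 : ℂ) R, DifferentiableOn ℂ (f a) (Metric.ball 0 R))
    (hc : ∀ ρ < R, ContinuousOn (fun p : ℂ × ℂ => f p.1 p.2)
      (Metric.ball 0 ρ ×ˢ Metric.sphere 0 ρ)) :
    ContinuousOn (fun p : ℂ × ℂ => f p.1 p.2) (Metric.ball 0 R ×ˢ Metric.ball 0 R) := by
  rintro ⟨a₀, z₀⟩ ⟨ha₀, hz₀⟩
  rw [mem_ball_zero_iff] at ha₀ hz₀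
  obtain ⟨ρ, hρ1, hρ2⟩ := exists_between (max_lt ha₀ hz₀)
  have hρ0 : 0 < ρ := (norm_nonneg a₀).trans_lt ((le_max_left _ _).trans_lt hρ1)
  set U : Set (ℂ × ℂ) := Metric.ball 0 ρ ×ˢ Metric.ball 0 ρ
  have hU : IsOpen U := Metric.isOpen_ball.prod Metric.isOpen_ball
  have hmem : ((a₀, z₀) : ℂ × ℂ) ∈ U :=
    ⟨by simpa using (le_max_left _ _).trans_lt hρ1, by simpa using (le_max_right _ _).trans_lt hρ1⟩
  refine ContinuousAt.continuousWithinAt ?_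
  refine ContinuousOn.continuousAt (s := U) ?_ (hU.mem_nhds hmem)
  have hcauchy : ∀ p ∈ U, f p.1 p.2 = (2 * Real.pi * Complex.I : ℂ)⁻¹ •
      ∮ w in C(0, ρ), (w - p.2)⁻¹ • f p.1 w := by
    rintro ⟨a, z⟩ ⟨ha, hz⟩
    have ha' : a ∈ Metric.ball (0 : ℂ) R := Metric.ball_subset_ball hρ2.le ha
    have hd : DiffContOnCl ℂ (f a) (Metric.ball 0 ρ) := by
      refine ((hf a ha').mono ?_).diffContOnCl
      rw [closure_ball _ hρ0.ne']
      exact Metric.closedBall_subset_ball hρ2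
    exact (hd.two_pi_i_inv_smul_circleIntegral_sub_inv_smul hz).symm
  suffices hint : ContinuousOn (fun p : ℂ × ℂ => ∮ w in C(0, ρ), (w - p.2)⁻¹ • f p.1 w) U from
    (hint.const_smul (2 * Real.pi * Complex.I : ℂ)⁻¹).congr fun p hp => hcauchy p hp
  rw [continuousOn_iff_continuous_domRestrict]
  have hne : ∀ (x : U) (θ : ℝ), circleMap 0 ρ θ - x.1.2 ≠ 0 := fun x θ h => by
    have h1 : ‖x.1.2‖ < ρ := by simpa using x.2.2
    rw [← sub_eq_zero.1 h, norm_circleMap_zero, abs_of_pos hρ0] at h1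
    exact lt_irrefl _ h1
  have hfc : Continuous fun y : U × ℝ => f y.1.1.1 (circleMap 0 ρ y.2) := by
    have h1 : Continuous fun y : U × ℝ => ((y.1.1.1, circleMap 0 ρ y.2) : ℂ × ℂ) := by fun_prop
    refine (hc ρ hρ2).comp_continuous h1 fun y => ⟨y.1.2.1, ?_⟩
    simp [abs_of_pos hρ0]
  have hcont : Continuous (Function.uncurry fun (x : U) (θ : ℝ) =>
      deriv (circleMap 0 ρ) θ • ((circleMap 0 ρ θ - x.1.2)⁻¹ • f x.1.1 (circleMap 0 ρ θ))) := by
    simp only [deriv_circleMap, Function.uncurry_def]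
    have h1 : Continuous fun y : U × ℝ => circleMap 0 ρ y.2 * Complex.I := by fun_prop
    have h2 : Continuous fun y : U × ℝ => circleMap 0 ρ y.2 - y.1.1.2 := by fun_prop
    exact h1.smul ((h2.inv₀ fun y => hne y.1 y.2).smul hfc)
  exact intervalIntegral.continuous_parametric_intervalIntegral_of_continuous' hcont 0 (2 * Real.pi)

section DividedDifferences

variable {Ψ : ℂ → ℂ} {R : ℝ}

theorem differentiableOn_dslope_ball (hΨ : DifferentiableOn ℂ Ψ (Metric.ball 0 R)) {a : ℂ}
    (ha : a ∈ Metric.ball (0 : ℂ) R) : DifferentiableOn ℂ (dslope Ψ a) (Metric.ball 0 R) :=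
  (Complex.differentiableOn_dslope (Metric.isOpen_ball.mem_nhds ha)).2 hΨ

theorem ne_of_mem_ball_of_mem_sphere {ρ : ℝ} {a w : ℂ} (ha : a ∈ Metric.ball (0 : ℂ) ρ)
    (hw : w ∈ Metric.sphere (0 : ℂ) ρ) : w ≠ a := by
  rintro rfl
  rw [mem_ball_zero_iff] at ha
  rw [mem_sphere_zero_iff_norm] at hw
  exact ha.ne hw

theorem continuousOn_dslope_uncurry (hΨ : DifferentiableOn ℂ Ψ (Metric.ball 0 R)) :
    ContinuousOn (fun p : ℂ × ℂ => dslope Ψ p.1 p.2) (Metric.ball 0 R ×ˢ Metric.ball 0 R) := by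
  refine continuousOn_uncurry_of_sphere (fun a ha => differentiableOn_dslope_ball hΨ ha)
    fun ρ hρ => ?_
  have : EqOn (fun p : ℂ × ℂ => dslope Ψ p.1 p.2) (fun p => (p.2 - p.1)⁻¹ • (Ψ p.2 - Ψ p.1))
      (Metric.ball 0 ρ ×ˢ Metric.sphere 0 ρ) := fun p hp => by
    simp only
    rw [dslope_of_ne _ (ne_of_mem_ball_of_mem_sphere hp.1 hp.2), slope_def_module]
  refine ContinuousOn.congr ?_ this
  have h1 : ContinuousOn (fun p : ℂ × ℂ => Ψ p.1) (Metric.ball 0 ρ ×ˢ Metric.sphere 0 ρ) :=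
    hΨ.continuousOn.comp continuousOn_fst fun p hp => Metric.ball_subset_ball hρ.le hp.1
  have h2 : ContinuousOn (fun p : ℂ × ℂ => Ψ p.2) (Metric.ball 0 ρ ×ˢ Metric.sphere 0 ρ) :=
    hΨ.continuousOn.comp continuousOn_snd fun p hp => Metric.sphere_subset_ball hρ hp.2
  exact (ContinuousOn.inv₀ (by fun_prop) fun p hp =>
    sub_ne_zero.2 (ne_of_mem_ball_of_mem_sphere hp.1 hp.2)).smul (h2.sub h1)

theorem continuousOn_dslope_dslope_uncurry (hΨ : DifferentiableOn ℂ Ψ (Metric.ball 0 R)) :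
    ContinuousOn (fun p : ℂ × ℂ => dslope (dslope Ψ p.1) p.1 p.2)
      (Metric.ball 0 R ×ˢ Metric.ball 0 R) := by
  refine continuousOn_uncurry_of_sphere (f := fun a => dslope (dslope Ψ a) a)
    (fun a ha => differentiableOn_dslope_ball (differentiableOn_dslope_ball hΨ ha) ha)
    fun ρ hρ => ?_
  have hD := continuousOn_dslope_uncurry hΨ
  have : EqOn (fun p : ℂ × ℂ => dslope (dslope Ψ p.1) p.1 p.2)
      (fun p => (p.2 - p.1)⁻¹ • (dslope Ψ p.1 p.2 - dslope Ψ p.1 p.1))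
      (Metric.ball 0 ρ ×ˢ Metric.sphere 0 ρ) := fun p hp => by
    simp only
    rw [dslope_of_ne _ (ne_of_mem_ball_of_mem_sphere hp.1 hp.2), slope_def_module]
  refine ContinuousOn.congr ?_ this
  have hb : ∀ p ∈ Metric.ball (0 : ℂ) ρ ×ˢ Metric.sphere (0 : ℂ) ρ, p.1 ∈ Metric.ball (0 : ℂ) R :=
    fun p hp => Metric.ball_subset_ball hρ.le hp.1
  have h1 : ContinuousOn (fun p : ℂ × ℂ => dslope Ψ p.1 p.1)
      (Metric.ball 0 ρ ×ˢ Metric.sphere 0 ρ) :=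
    hD.comp (f := fun p : ℂ × ℂ => (p.1, p.1)) (by fun_prop) fun p hp => ⟨hb p hp, hb p hp⟩
  have h2 : ContinuousOn (fun p : ℂ × ℂ => dslope Ψ p.1 p.2)
      (Metric.ball 0 ρ ×ˢ Metric.sphere 0 ρ) :=
    hD.mono fun p hp => ⟨hb p hp, Metric.sphere_subset_ball hρ hp.2⟩
  exact (ContinuousOn.inv₀ (by fun_prop) fun p hp =>
    sub_ne_zero.2 (ne_of_mem_ball_of_mem_sphere hp.1 hp.2)).smul (h2.sub h1)

end DividedDifferences

/-! ### Extensions of the Riemann mapping that are one-to-one at the unit circle -/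

/-- `Ψ` extends the Riemann mapping `Φ` and its boundary values `q` holomorphically to the disc of
radius `R > 1`; it takes its values on the unit circle only once, and with nonzero derivative. -/
structure IsDiscExtension (Φ : ℂ → ℂ) (q : ℝ → ℂ) (Ψ : ℂ → ℂ) (R : ℝ) : Prop where
  one_lt : 1 < R
  holo : DifferentiableOn ℂ Ψ (Metric.ball 0 R)
  eq_disc : ∀ z ∈ Metric.ball (0 : ℂ) 1, Ψ z = Φ z
  eq_circle : ∀ s : ℝ, Ψ (Complex.exp (s * Complex.I)) = q s
  ne : ∀ a z : ℂ, ‖a‖ = 1 → ‖z‖ < R → z ≠ a → Ψ z ≠ Ψ a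
  deriv_ne : ∀ a : ℂ, ‖a‖ = 1 → deriv Ψ a ≠ 0

theorem exists_arg_Ico (z : ℂ) (hz : z ≠ 0) :
    ∃ x ∈ Ico (-Real.pi) Real.pi,
      z = Complex.exp (Complex.I * (x + ((-Real.log ‖z‖ : ℝ) : ℂ) * Complex.I)) := by
  have h : z = Complex.exp (Complex.log z) := (Complex.exp_log hz).symm
  have hlog : ∀ x : ℝ, Complex.I * (x + ((-Real.log ‖z‖ : ℝ) : ℂ) * Complex.I) =
      Real.log ‖z‖ + x * Complex.I := fun x => by
    push_cast
    linear_combination (-(Real.log ‖z‖ : ℂ)) * Complex.I_mul_I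
  rcases (Complex.arg_le_pi z).lt_or_eq with h1 | h1
  · exact ⟨z.arg, ⟨(Complex.neg_pi_lt_arg z).le, h1⟩, by rw [hlog]; exact h⟩
  · refine ⟨-Real.pi, ⟨le_rfl, by linarith [Real.pi_pos]⟩, ?_⟩
    rw [hlog]
    conv_lhs => rw [h]
    rw [Complex.exp_eq_exp_iff_exists_int]
    refine ⟨1, ?_⟩
    rw [Complex.log, h1]
    push_cast
    ring

/-- Below the Grauert radius of a regular boundary, the Riemann mapping extends to the corresponding
disc. -/
theorem exists_isDiscExtension {Ω : Set ℂ} (hΩ : IsOpen Ω) (hb : HasAnalyticBoundary Ω) {Φ : ℂ → ℂ}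
    {q : ℝ → ℂ} (hΦ : IsRiemannMap Ω Φ) (hq : IsParamByRiemannMap Φ q) {ε : ℝ}
    (hεq : ENNReal.ofReal ε < grauertRadius q) :
    ∃ R Ψ, Real.exp ε < R ∧ IsDiscExtension Φ q Ψ R := by
  obtain ⟨p, hp, -⟩ := hb
  obtain ⟨_, ⟨ε', hε', ⟨Q, hQ, hQq, hG⟩, rfl⟩, hεε'⟩ := lt_sSup_iff.1 hεq
  have hlt : ε < ε' := (ENNReal.ofReal_lt_ofReal_iff hε').1 hεε'
  obtain ⟨Ψ, hΨ, hΨΦ, hΨQ⟩ := exists_riemannMap_extension hΦ hq hε' hQ hQq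
  have hR : 1 < Real.exp ε' := Real.one_lt_exp_iff.2 hε'
  have hcirc : ∀ s : ℝ, Ψ (Complex.exp (s * Complex.I)) = q s := fun s => by
    rw [mul_comm, hΨQ _ (by simpa using hε'), hQq]
  have hfr : ∀ a : ℂ, ‖a‖ = 1 → Ψ a ∈ frontier Ω := fun a ha => by
    obtain ⟨s, rfl⟩ := exists_eq_exp_of_norm_eq_one ha
    rw [hcirc]
    exact hq.mem_frontier hΩ hΦ s
  refine ⟨Real.exp ε', Ψ, Real.exp_lt_exp.2 hlt, hR, hΨ, hΨΦ, hcirc, fun a z ha hz hza heq => ?_,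
    fun a ha => deriv_riemannMap_extension_ne_zero hΩ hp hΦ hR hΨ hΨΦ ha (hfr a ha)⟩
  by_cases hz1 : ‖z‖ < 1
  · have hz' : z ∈ Metric.ball (0 : ℂ) 1 := by simpa using hz1
    have h1 := hfr a ha
    rw [← heq, hΨΦ z hz', hΩ.frontier_eq] at h1
    exact h1.2 (hΦ.image_eq ▸ mem_image_of_mem Φ hz')
  · push Not at hz1
    have ha0 : a ≠ 0 := norm_ne_zero_iff.1 (by rw [ha]; exact one_ne_zero)
    have hz0 : z ≠ 0 := norm_ne_zero_iff.1 (by linarith)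
    obtain ⟨s, hs, has⟩ := exists_arg_Ico a ha0
    obtain ⟨x, hx, hzx⟩ := exists_arg_Ico z hz0
    rw [ha, Real.log_one, neg_zero, Complex.ofReal_zero, zero_mul, add_zero] at has
    set t : ℂ := x + ((-Real.log ‖z‖ : ℝ) : ℂ) * Complex.I with ht
    have htim : |t.im| < ε' := by
      have : t.im = -Real.log ‖z‖ := by simp [ht]
      rw [this, abs_neg, abs_of_nonneg (Real.log_nonneg hz1),
        Real.log_lt_iff_lt_exp (by linarith)]
      exact hz
    have htre : t.re = x := by simp [ht]
    have h1 : Q t = q s := by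
      rw [← hΨQ t htim, ← hzx, heq, ← hcirc, mul_comm (s : ℂ), ← has]
    have h2 := hG t (by rwa [htre]) htim s hs h1
    apply hza
    rw [hzx, h2, has]

namespace IsDiscExtension

variable {Φ : ℂ → ℂ} {q : ℝ → ℂ} {Ψ : ℂ → ℂ} {R : ℝ}

theorem mem_ball (h : IsDiscExtension Φ q Ψ R) {a : ℂ} (ha : ‖a‖ = 1) :
    a ∈ Metric.ball (0 : ℂ) R := by
  rw [mem_ball_zero_iff, ha]; exact h.one_lt

theorem dslope_ne_zero (h : IsDiscExtension Φ q Ψ R) {a z : ℂ} (ha : ‖a‖ = 1) (hz : ‖z‖ < R) :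
    dslope Ψ a z ≠ 0 := by
  rcases eq_or_ne z a with rfl | hza
  · rw [dslope_same]
    exact h.deriv_ne z ha
  · rw [dslope_of_ne _ hza, slope_def_module]
    exact smul_ne_zero (inv_ne_zero (sub_ne_zero.2 hza)) (sub_ne_zero.2 (h.ne a z ha hz hza))

theorem hasDerivAt_param (h : IsDiscExtension Φ q Ψ R) (s : ℝ) :
    HasDerivAt q (Complex.I * Complex.exp (s * Complex.I) *
      deriv Ψ (Complex.exp (s * Complex.I))) s := by
  have h1 : HasDerivAt (fun s : ℝ => Complex.exp (s * Complex.I))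
      (Complex.exp (s * Complex.I) * Complex.I) s := by
    have := ((hasDerivAt_id s).ofReal_comp.mul_const Complex.I).cexp
    simpa using this
  have h2 : HasDerivAt Ψ (deriv Ψ (Complex.exp (s * Complex.I))) (Complex.exp (s * Complex.I)) :=
    (h.holo.differentiableAt (Metric.isOpen_ball.mem_nhds
      (h.mem_ball (Complex.norm_exp_ofReal_mul_I s)))).hasDerivAt
  have h3 := h2.comp s h1
  have e : Ψ ∘ (fun s : ℝ => Complex.exp (s * Complex.I)) = q := funext h.eq_circle
  rw [e] at h3
  exact h3.congr_deriv (by ring)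

theorem deriv_param (h : IsDiscExtension Φ q Ψ R) (s : ℝ) :
    deriv q s = Complex.I * Complex.exp (s * Complex.I) * deriv Ψ (Complex.exp (s * Complex.I)) :=
  (h.hasDerivAt_param s).deriv

theorem deriv_param_ne_zero (h : IsDiscExtension Φ q Ψ R) (s : ℝ) : deriv q s ≠ 0 := by
  rw [h.deriv_param]
  exact mul_ne_zero (mul_ne_zero Complex.I_ne_zero (Complex.exp_ne_zero _))
    (h.deriv_ne _ (Complex.norm_exp_ofReal_mul_I s))

theorem injOn (h : IsDiscExtension Φ q Ψ R) : InjOn q (Ico (-Real.pi) Real.pi) := by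
  intro s hs t ht hst
  rw [← h.eq_circle, ← h.eq_circle] at hst
  have h1 : Complex.exp (s * Complex.I) = Complex.exp (t * Complex.I) := by
    by_contra hne
    refine h.ne _ _ (Complex.norm_exp_ofReal_mul_I t) ?_ hne hst
    rw [Complex.norm_exp_ofReal_mul_I]
    exact h.one_lt
  have h2 : Circle.exp s = Circle.exp t := Circle.ext (by simpa using h1)
  exact Circle.exp_injOn_Ico (by linarith) hs ht h2

end IsDiscExtension

/-! ### The integral kernel in terms of divided differences -/

/-- The regular part of the logarithmic derivative of `Ψ - Ψ(τ)`: for `σ ≠ τ` it equals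
`iσ Ψ'(σ) / (Ψ(σ) - Ψ(τ)) - iσ / (σ - τ)`.  It is written with divided differences at `σ`, which
have no singularity at `σ = τ`. -/
def logRem (Ψ : ℂ → ℂ) (σ τ : ℂ) : ℂ :=
  Complex.I * σ * (dslope (dslope Ψ σ) σ τ / dslope Ψ σ τ)

/-- The kernel of `𝒦` at points `σ`, `τ` of the unit circle. -/
def circleK (Ψ : ℂ → ℂ) (σ τ : ℂ) : ℝ := (1 / 2 + (logRem Ψ σ τ).im) / (2 * Real.pi)

/-- The unimodular number `z / z̄`, where `z = Ψ(σ) - Ψ(τ)`, at points of the unit circle. -/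
def chordTurn (Ψ : ℂ → ℂ) (σ τ : ℂ) : ℂ := -(τ * σ) * (dslope Ψ σ τ * conj (dslope Ψ σ τ)⁻¹)

/-- The matrix of the map `φ ↦ w φ̄` of the plane. -/
def reflMatrix (w : ℂ) : Matrix (Fin 2) (Fin 2) ℝ := !![w.re, w.im; w.im, -w.re]

/-- The kernel of `2 k₀ B H + T₂` at points `σ`, `τ` of the unit circle.  In the last term,
`Re (logRem)/2π` is the kernel of `𝒦ℋ`. -/
def circleT (lam mu : ℝ) (Ψ : ℂ → ℂ) (σ τ : ℂ) : Matrix (Fin 2) (Fin 2) ℝ :=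
  (-circleK Ψ σ τ) • (1 : Matrix (Fin 2) (Fin 2) ℝ) -
    ((mu + lam) / (2 * mu + lam) * circleK Ψ σ τ) • reflMatrix (chordTurn Ψ σ τ) +
    (2 * k0 lam mu * ((logRem Ψ σ τ).re / (2 * Real.pi))) • !![0, -1; 1, 0]

theorem angleForm_eq_im_div (z v : ℂ) : angleForm z v = (v / z).im / (2 * Real.pi) := by
  rw [angleForm, Complex.div_im, Complex.normSq_apply]
  rcases eq_or_ne (z.re * z.re + z.im * z.im) 0 with h | h
  · rw [h]; simp
  · have := Real.pi_pos
    field_simp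

theorem elasticForm_eq {lam mu : ℝ} (hlm : 2 * mu + lam ≠ 0) {z : ℂ} (hz : z ≠ 0) (v : ℂ) :
    elasticForm lam mu z v = (-angleForm z v) • (1 : Matrix (Fin 2) (Fin 2) ℝ) -
      ((mu + lam) / (2 * mu + lam) * angleForm z v) • reflMatrix (z / conj z) := by
  have hN : Complex.normSq z ≠ 0 := by simpa using hz
  have hre : (z / conj z).re = (z.re * z.re - z.im * z.im) / Complex.normSq z := by
    rw [Complex.div_re]; simp [Complex.normSq_conj]; ring
  have him : (z / conj z).im = 2 * z.re * z.im / Complex.normSq z := by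
    rw [Complex.div_im]; simp [Complex.normSq_conj]; ring
  rw [elasticForm, reflMatrix, hre, him]
  have hN' : z.re * z.re + z.im * z.im = Complex.normSq z := (Complex.normSq_apply z).symm
  have e1 : mu / (2 * mu + lam) = 1 - (mu + lam) / (2 * mu + lam) := by
    rw [eq_sub_iff_add_eq, ← add_div, div_eq_one_iff_eq hlm]; ring
  have e2 : 2 * (mu + lam) / (2 * mu + lam) = 2 * ((mu + lam) / (2 * mu + lam)) := by ring
  rw [e1, e2]
  generalize (mu + lam) / (2 * mu + lam) = X
  generalize angleForm z v = k
  generalize Complex.normSq z = N at hN hN' ⊢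
  ext i j
  fin_cases i <;> fin_cases j <;> simp [toVec]
  · field_simp
    linear_combination (-X * k) * hN'
  · field_simp
  · field_simp
  · field_simp
    linear_combination (-X * k) * hN'

section Circle

variable {Φ : ℂ → ℂ} {q : ℝ → ℂ} {Ψ : ℂ → ℂ} {R : ℝ}

theorem re_div_sub_of_norm_eq_one {σ τ : ℂ} (hσ : ‖σ‖ = 1) (hτ : ‖τ‖ = 1) (hne : σ ≠ τ) :
    (σ / (σ - τ)).re = 1 / 2 := by
  have h1 : σ.re * σ.re + σ.im * σ.im = 1 := by
    rw [← Complex.normSq_apply, Complex.normSq_eq_norm_sq, hσ, one_pow]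
  have h2 : τ.re * τ.re + τ.im * τ.im = 1 := by
    rw [← Complex.normSq_apply, Complex.normSq_eq_norm_sq, hτ, one_pow]
  have h3 : Complex.normSq (σ - τ) ≠ 0 := by simpa [sub_eq_zero] using hne
  rw [Complex.div_re, ← add_div, div_eq_iff h3, Complex.normSq_apply]
  simp only [Complex.sub_re, Complex.sub_im]
  linarith

theorem sub_eq_mul_dslope (Ψ : ℂ → ℂ) (σ τ : ℂ) : Ψ σ - Ψ τ = (σ - τ) * dslope Ψ σ τ := by
  have := sub_smul_dslope Ψ σ τ
  rw [smul_eq_mul] at this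
  linear_combination this

theorem IsDiscExtension.logRem_eq (h : IsDiscExtension Φ q Ψ R) {σ τ : ℂ} (hσ : ‖σ‖ = 1)
    (hτ : ‖τ‖ = 1) (hne : σ ≠ τ) :
    logRem Ψ σ τ = Complex.I * σ * deriv Ψ σ / (Ψ σ - Ψ τ) - Complex.I * (σ / (σ - τ)) := by
  have hD : dslope Ψ σ τ ≠ 0 := h.dslope_ne_zero hσ (by rw [hτ]; exact h.one_lt)
  have h1 := sub_eq_mul_dslope Ψ σ τ
  have h2 := sub_eq_mul_dslope (dslope Ψ σ) σ τ
  rw [dslope_same] at h2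
  have h3 : σ - τ ≠ 0 := sub_ne_zero.2 hne
  rw [h1, logRem, show deriv Ψ σ = dslope Ψ σ τ + (σ - τ) * dslope (dslope Ψ σ) σ τ by
    linear_combination h2]
  field_simp
  ring

theorem IsDiscExtension.angleForm_eq (h : IsDiscExtension Φ q Ψ R) {t s : ℝ}
    (hne : Complex.exp (s * Complex.I) ≠ Complex.exp (t * Complex.I)) :
    angleForm (q s - q t) (deriv q s) =
      circleK Ψ (Complex.exp (s * Complex.I)) (Complex.exp (t * Complex.I)) := by
  have hσ := Complex.norm_exp_ofReal_mul_I s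
  have hτ := Complex.norm_exp_ofReal_mul_I t
  have h1 := h.logRem_eq hσ hτ hne
  have h2 := re_div_sub_of_norm_eq_one hσ hτ hne
  rw [angleForm_eq_im_div, circleK, h.deriv_param, ← h.eq_circle, ← h.eq_circle, h1,
    Complex.sub_im, Complex.I_mul_im, h2]
  ring

theorem IsDiscExtension.chordTurn_eq (h : IsDiscExtension Φ q Ψ R) {σ τ : ℂ} (hσ : ‖σ‖ = 1)
    (hτ : ‖τ‖ = 1) (hne : σ ≠ τ) :
    chordTurn Ψ σ τ = (Ψ σ - Ψ τ) / conj (Ψ σ - Ψ τ) := by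
  have hD : dslope Ψ σ τ ≠ 0 := h.dslope_ne_zero hσ (by rw [hτ]; exact h.one_lt)
  have hD' : conj (dslope Ψ σ τ) ≠ 0 := by simpa using hD
  have h3 : σ - τ ≠ 0 := sub_ne_zero.2 hne
  have hσ0 : σ ≠ 0 := norm_ne_zero_iff.1 (by rw [hσ]; exact one_ne_zero)
  have hτ0 : τ ≠ 0 := norm_ne_zero_iff.1 (by rw [hτ]; exact one_ne_zero)
  have c1 : conj σ = σ⁻¹ := (Complex.inv_eq_conj hσ).symm
  have c2 : conj τ = τ⁻¹ := (Complex.inv_eq_conj hτ).symm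
  have h4 : σ⁻¹ - τ⁻¹ ≠ 0 := sub_ne_zero.2 fun h => hne (inv_injective h)
  rw [chordTurn, sub_eq_mul_dslope, map_mul, map_sub, c1, c2, map_inv₀,
    eq_div_iff (mul_ne_zero h4 hD')]
  field_simp
  ring

theorem IsDiscExtension.elasticForm_eq (h : IsDiscExtension Φ q Ψ R) {lam mu : ℝ}
    (hlm : 2 * mu + lam ≠ 0) {t s : ℝ}
    (hne : Complex.exp (s * Complex.I) ≠ Complex.exp (t * Complex.I)) :
    elasticForm lam mu (q s - q t) (deriv q s) =
      circleT lam mu Ψ (Complex.exp (s * Complex.I)) (Complex.exp (t * Complex.I)) -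
      (2 * k0 lam mu * ((logRem Ψ (Complex.exp (s * Complex.I))
        (Complex.exp (t * Complex.I))).re / (2 * Real.pi))) • !![0, -1; 1, 0] := by
  have hσ := Complex.norm_exp_ofReal_mul_I s
  have hτ := Complex.norm_exp_ofReal_mul_I t
  have hz : q s - q t ≠ 0 := by
    rw [← h.eq_circle, ← h.eq_circle, sub_ne_zero]
    exact h.ne _ _ hτ (by rw [hσ]; exact h.one_lt) hne
  rw [ElasticNP.elasticForm_eq hlm hz, h.angleForm_eq hne, circleT, add_sub_cancel_right,
    h.chordTurn_eq hσ hτ hne, h.eq_circle, h.eq_circle]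

/-! ### Continuity of the kernel -/

theorem IsDiscExtension.continuousOn_dslope (h : IsDiscExtension Φ q Ψ R) :
    ContinuousOn (fun p : ℂ × ℂ => dslope Ψ p.1 p.2) (Metric.sphere 0 1 ×ˢ Metric.ball 0 R) :=
  (continuousOn_dslope_uncurry h.holo).mono
    (prod_mono_left (Metric.sphere_subset_ball h.one_lt))

theorem IsDiscExtension.dslope_ne_zero' (h : IsDiscExtension Φ q Ψ R) :
    ∀ p ∈ (Metric.sphere 0 1 ×ˢ Metric.ball 0 R : Set (ℂ × ℂ)), dslope Ψ p.1 p.2 ≠ 0 :=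
  fun _ hp => h.dslope_ne_zero (by simpa using hp.1) (by simpa using hp.2)

theorem IsDiscExtension.continuousOn_logRem (h : IsDiscExtension Φ q Ψ R) :
    ContinuousOn (fun p : ℂ × ℂ => logRem Ψ p.1 p.2) (Metric.sphere 0 1 ×ˢ Metric.ball 0 R) := by
  have h1 := (continuousOn_dslope_dslope_uncurry h.holo).mono
    (prod_mono_left (t := Metric.ball (0 : ℂ) R) (Metric.sphere_subset_ball h.one_lt))
  exact ContinuousOn.mul (by fun_prop) (h1.div h.continuousOn_dslope h.dslope_ne_zero')

theorem continuous_circlePair :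
    Continuous fun p : ℝ × ℝ => (Complex.exp (p.2 * Complex.I), Complex.exp (p.1 * Complex.I)) := by
  fun_prop

theorem IsDiscExtension.mem_circlePair (h : IsDiscExtension Φ q Ψ R) (p : ℝ × ℝ) :
    (Complex.exp (p.2 * Complex.I), Complex.exp (p.1 * Complex.I)) ∈
      (Metric.sphere 0 1 ×ˢ Metric.ball 0 R : Set (ℂ × ℂ)) :=
  ⟨by simp, h.mem_ball (Complex.norm_exp_ofReal_mul_I _)⟩

theorem IsDiscExtension.continuous_logRem (h : IsDiscExtension Φ q Ψ R) :
    Continuous fun p : ℝ × ℝ =>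
      logRem Ψ (Complex.exp (p.2 * Complex.I)) (Complex.exp (p.1 * Complex.I)) :=
  h.continuousOn_logRem.comp_continuous continuous_circlePair h.mem_circlePair

theorem IsDiscExtension.continuous_circleK (h : IsDiscExtension Φ q Ψ R) :
    Continuous fun p : ℝ × ℝ =>
      circleK Ψ (Complex.exp (p.2 * Complex.I)) (Complex.exp (p.1 * Complex.I)) :=
  (continuous_const.add (Complex.continuous_im.comp h.continuous_logRem)).div_const _

theorem continuous_elastic_combination {X : Type*} [TopologicalSpace X] {k a b c : X → ℝ}
    (c₁ c₂ : ℝ) (hk : Continuous k) (ha : Continuous a) (hb : Continuous b) (hc : Continuous c) :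
    Continuous fun x => (-k x) • (1 : Matrix (Fin 2) (Fin 2) ℝ) -
      (c₁ * k x) • !![a x, b x; b x, -a x] + (c₂ * c x) • !![0, -1; 1, 0] := by
  refine continuous_matrix fun i j => ?_
  fin_cases i <;> fin_cases j <;> simp <;> fun_prop

theorem IsDiscExtension.continuous_circleT (h : IsDiscExtension Φ q Ψ R) (lam mu : ℝ) :
    Continuous fun p : ℝ × ℝ =>
      circleT lam mu Ψ (Complex.exp (p.2 * Complex.I)) (Complex.exp (p.1 * Complex.I)) := by
  have h1 := h.continuous_logRem
  have h2 := h.continuous_circleK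
  have hD : Continuous fun p : ℝ × ℝ =>
      dslope Ψ (Complex.exp (p.2 * Complex.I)) (Complex.exp (p.1 * Complex.I)) :=
    h.continuousOn_dslope.comp_continuous continuous_circlePair h.mem_circlePair
  have h3 : Continuous fun p : ℝ × ℝ =>
      chordTurn Ψ (Complex.exp (p.2 * Complex.I)) (Complex.exp (p.1 * Complex.I)) := by
    have hD' := Complex.continuous_conj.comp
      (hD.inv₀ fun p => h.dslope_ne_zero (Complex.norm_exp_ofReal_mul_I _)
        (by rw [Complex.norm_exp_ofReal_mul_I]; exact h.one_lt))
    have hστ : Continuous fun p : ℝ × ℝ =>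
        -(Complex.exp (p.1 * Complex.I) * Complex.exp (p.2 * Complex.I)) := by fun_prop
    exact hστ.mul (hD.mul hD')
  exact continuous_elastic_combination _ _ h2 (Complex.continuous_re.comp h3)
    (Complex.continuous_im.comp h3) ((Complex.continuous_re.comp h1).div_const _)

end Circle

/-! ### Holomorphic continuation of the kernel to an annulus, and decay of Fourier coefficients -/

/-- The functions `u σ` on the unit circle, for `|σ| = 1`, extend holomorphically to the annulus
`1/R < |ζ| < R`, with a common bound on `1/r ≤ |ζ| ≤ r`. -/
def HasAnnulusExtension (r R : ℝ) (u : ℂ → ℂ → ℂ) : Prop :=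
  ∃ M : ℝ, ∀ σ : ℂ, ‖σ‖ = 1 → ∃ W : ℂ → ℂ, DifferentiableOn ℂ W {ζ | R⁻¹ < ‖ζ‖ ∧ ‖ζ‖ < R} ∧
    (∀ ζ : ℂ, r⁻¹ ≤ ‖ζ‖ → ‖ζ‖ ≤ r → ‖W ζ‖ ≤ M) ∧ ∀ τ : ℂ, ‖τ‖ = 1 → W τ = u σ τ

namespace HasAnnulusExtension

variable {r R : ℝ} {u v : ℂ → ℂ → ℂ}

theorem congr (hu : HasAnnulusExtension r R u)
    (h : ∀ σ τ : ℂ, ‖σ‖ = 1 → ‖τ‖ = 1 → v σ τ = u σ τ) : HasAnnulusExtension r R v := by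
  obtain ⟨M, hM⟩ := hu
  refine ⟨M, fun σ hσ => ?_⟩
  obtain ⟨W, h1, h2, h3⟩ := hM σ hσ
  exact ⟨W, h1, h2, fun τ hτ => by rw [h3 τ hτ, h σ τ hσ hτ]⟩

theorem add (hu : HasAnnulusExtension r R u) (hv : HasAnnulusExtension r R v) :
    HasAnnulusExtension r R fun σ τ => u σ τ + v σ τ := by
  obtain ⟨M, hM⟩ := hu
  obtain ⟨N, hN⟩ := hv
  refine ⟨M + N, fun σ hσ => ?_⟩
  obtain ⟨W, h1, h2, h3⟩ := hM σ hσ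
  obtain ⟨V, k1, k2, k3⟩ := hN σ hσ
  exact ⟨fun ζ => W ζ + V ζ, h1.add k1, fun ζ a b =>
    (norm_add_le _ _).trans (add_le_add (h2 ζ a b) (k2 ζ a b)),
    fun τ hτ => by simp only [h3 τ hτ, k3 τ hτ]⟩

theorem mul (hu : HasAnnulusExtension r R u) (hv : HasAnnulusExtension r R v) :
    HasAnnulusExtension r R fun σ τ => u σ τ * v σ τ := by
  obtain ⟨M, hM⟩ := hu
  obtain ⟨N, hN⟩ := hv
  refine ⟨M * N, fun σ hσ => ?_⟩
  obtain ⟨W, h1, h2, h3⟩ := hM σ hσ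
  obtain ⟨V, k1, k2, k3⟩ := hN σ hσ
  refine ⟨fun ζ => W ζ * V ζ, h1.mul k1, fun ζ a b => ?_, fun τ hτ => by simp only [h3 τ hτ, k3 τ hτ]⟩
  rw [norm_mul]
  exact mul_le_mul (h2 ζ a b) (k2 ζ a b) (norm_nonneg _) ((norm_nonneg _).trans (h2 ζ a b))

theorem const (c : ℂ) : HasAnnulusExtension r R fun _ _ => c :=
  ⟨‖c‖, fun _ _ => ⟨fun _ => c, differentiableOn_const _, fun _ _ _ => le_rfl, fun _ _ => rfl⟩⟩

/-- On the unit circle, `conj (u τ)` is the value at `τ` of the holomorphic function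
`ζ ↦ conj (u (1 / conj ζ))`. -/
theorem star (hr : 0 < r) (hR : 0 < R) (hu : HasAnnulusExtension r R u) :
    HasAnnulusExtension r R fun σ τ => conj (u σ τ) := by
  obtain ⟨M, hM⟩ := hu
  refine ⟨M, fun σ hσ => ?_⟩
  obtain ⟨W, h1, h2, h3⟩ := hM σ hσ
  have hopen : IsOpen {ζ : ℂ | R⁻¹ < ‖ζ‖ ∧ ‖ζ‖ < R} :=
    (isOpen_lt continuous_const continuous_norm).inter (isOpen_lt continuous_norm continuous_const)
  refine ⟨fun ζ => starRingEnd ℂ (W (starRingEnd ℂ ζ⁻¹)), fun ζ hζ => ?_, fun ζ a b => ?_,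
    fun τ hτ => ?_⟩
  · have hζ0 : 0 < ‖ζ‖ := (inv_pos.2 hR).trans hζ.1
    have hmem : starRingEnd ℂ ζ⁻¹ ∈ {ζ : ℂ | R⁻¹ < ‖ζ‖ ∧ ‖ζ‖ < R} := by
      simp only [mem_ofPred_eq, RCLike.norm_conj, norm_inv]
      exact ⟨inv_strictAnti₀ hζ0 hζ.2, inv_lt_of_inv_lt₀ hR hζ.1⟩
    have hd := ((h1 _ hmem).differentiableAt (hopen.mem_nhds hmem)).conj_conj
    rw [Complex.conj_conj] at hd
    exact (hd.comp ζ (differentiableAt_inv (norm_pos_iff.1 hζ0))).differentiableWithinAt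
  · have hζ0 : 0 < ‖ζ‖ := (inv_pos.2 hr).trans_le a
    rw [RCLike.norm_conj]
    refine h2 _ ?_ ?_ <;> rw [RCLike.norm_conj, norm_inv]
    · exact inv_anti₀ hζ0 b
    · exact inv_le_of_inv_le₀ hr a
  · have : starRingEnd ℂ τ⁻¹ = τ := by
      rw [Complex.inv_eq_conj hτ, Complex.conj_conj]
    simp only [this, h3 τ hτ]

theorem re (hr : 0 < r) (hR : 0 < R) (hu : HasAnnulusExtension r R u) :
    HasAnnulusExtension r R fun σ τ => ((u σ τ).re : ℂ) :=
  ((const (1 / 2)).mul (hu.add (hu.star hr hR))).congr fun σ τ _ _ => by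
    rw [Complex.add_conj]; push_cast; ring

theorem im (hr : 0 < r) (hR : 0 < R) (hu : HasAnnulusExtension r R u) :
    HasAnnulusExtension r R fun σ τ => ((u σ τ).im : ℂ) :=
  (((const (-Complex.I)).mul hu).re hr hR).congr fun σ τ _ _ => by simp

theorem of_continuousOn (hr : r < R)
    (hc : ContinuousOn (fun p : ℂ × ℂ => u p.1 p.2) (Metric.sphere 0 1 ×ˢ Metric.ball 0 R))
    (hd : ∀ σ : ℂ, ‖σ‖ = 1 → DifferentiableOn ℂ (u σ) (Metric.ball 0 R)) :
    HasAnnulusExtension r R u := by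
  obtain ⟨M, hM⟩ := ((isCompact_sphere (0 : ℂ) 1).prod
    (isCompact_closedBall (0 : ℂ) r)).exists_bound_of_continuousOn
    (hc.mono (prod_mono_right (Metric.closedBall_subset_ball hr)))
  refine ⟨M, fun σ hσ => ⟨u σ, (hd σ hσ).mono fun ζ hζ => by simpa using hζ.2, fun ζ _ b => ?_,
    fun _ _ => rfl⟩⟩
  exact hM (σ, ζ) ⟨by simpa using hσ, by simpa using b⟩

/-- The Fourier coefficients decay exponentially: shift the circle of integration to `|ζ| = r` or to
`|ζ| = 1/r`. -/
theorem exists_fourier_bound (hr : 1 < r) (hrR : r < R) (hu : HasAnnulusExtension r R u) :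
    ∃ M : ℝ, ∀ σ : ℂ, ‖σ‖ = 1 → ∀ n : ℤ,
      ‖∫ t in (-Real.pi)..Real.pi, u σ (Complex.exp (t * Complex.I)) *
        Complex.exp (-(Complex.I * n * t))‖ ≤ M * r ^ (-|n|) := by
  obtain ⟨M, hM⟩ := hu
  refine ⟨2 * Real.pi * M, fun σ hσ n => ?_⟩
  obtain ⟨W, h1, h2, h3⟩ := hM σ hσ
  have hr0 : 0 < r := one_pos.trans hr
  have hopen : IsOpen {ζ : ℂ | R⁻¹ < ‖ζ‖ ∧ ‖ζ‖ < R} :=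
    (isOpen_lt continuous_const continuous_norm).inter (isOpen_lt continuous_norm continuous_const)
  have hRr : R⁻¹ < r⁻¹ := inv_strictAnti₀ hr0 hrR
  have hri : r⁻¹ < 1 := inv_lt_one_of_one_lt₀ hr
  let f : ℂ → ℂ := fun ζ => W ζ * ζ ^ (-n - 1)
  have hf : DifferentiableOn ℂ f {ζ : ℂ | R⁻¹ < ‖ζ‖ ∧ ‖ζ‖ < R} := by
    refine h1.mul fun ζ hζ => DifferentiableAt.differentiableWithinAt ?_
    have hζ0 : ζ ≠ 0 := norm_pos_iff.1 ((inv_pos.2 (hr0.trans hrR)).trans hζ.1)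
    exact differentiableAt_zpow.2 (Or.inl hζ0)
  -- the integral as a contour integral
  have hcirc : (∮ ζ in C(0, 1), f ζ) = Complex.I * ∫ t in (-Real.pi)..Real.pi,
      u σ (Complex.exp (t * Complex.I)) * Complex.exp (-(Complex.I * n * t)) := by
    have hper : Function.Periodic (fun t : ℝ => u σ (Complex.exp (t * Complex.I)) *
        Complex.exp (-(Complex.I * n * t))) (2 * Real.pi) := fun t => by
      have e1 : Complex.exp (((t + 2 * Real.pi : ℝ) : ℂ) * Complex.I) =
          Complex.exp (t * Complex.I) := by
        push_cast; rw [add_mul, Complex.exp_periodic]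
      have e2 : Complex.exp (-(Complex.I * n * ((t + 2 * Real.pi : ℝ) : ℂ))) =
          Complex.exp (-(Complex.I * n * t)) := by
        rw [Complex.exp_eq_exp_iff_exists_int]
        exact ⟨-n, by push_cast; ring⟩
      simp only [e1, e2]
    have hsh := hper.intervalIntegral_add_eq (-Real.pi) 0
    rw [show -Real.pi + 2 * Real.pi = Real.pi by ring, zero_add] at hsh
    rw [hsh, circleIntegral, ← intervalIntegral.integral_const_mul]
    refine intervalIntegral.integral_congr fun t _ => ?_
    have e3 : circleMap 0 1 t = Complex.exp (t * Complex.I) := by simp [circleMap]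
    simp only [deriv_circleMap, e3, f, smul_eq_mul]
    rw [h3 _ (Complex.norm_exp_ofReal_mul_I t), ← Complex.exp_int_mul]
    have e4 : Complex.exp (t * Complex.I) * Complex.exp (((-n - 1 : ℤ) : ℂ) * (t * Complex.I)) =
        Complex.exp (-(Complex.I * n * t)) := by
      rw [← Complex.exp_add]; congr 1; push_cast; ring
    rw [← e4]
    ring
  have key : ∀ ρ : ℝ, r⁻¹ ≤ ρ → ρ ≤ r → ‖∮ ζ in C(0, ρ), f ζ‖ ≤ 2 * Real.pi * M * ρ ^ (-n) := by
    intro ρ hρ1 hρ2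
    have hρ0 : 0 < ρ := (inv_pos.2 hr0).trans_le hρ1
    have := circleIntegral.norm_integral_le_of_norm_le_const (c := 0) (f := f)
      (C := M * ρ ^ (-n - 1)) hρ0.le fun ζ hζ => by
        rw [mem_sphere_zero_iff_norm] at hζ
        simp only [f, norm_mul, norm_zpow, hζ]
        exact mul_le_mul_of_nonneg_right (h2 ζ (hζ ▸ hρ1) (hζ ▸ hρ2)) (by positivity)
    refine this.trans_eq ?_
    rw [zpow_sub_one₀ hρ0.ne']
    field_simp
  have hshift : ∀ a b : ℝ, r⁻¹ ≤ a → a ≤ b → b ≤ r →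
      (∮ ζ in C(0, b), f ζ) = ∮ ζ in C(0, a), f ζ := by
    intro a b ha hab hb
    have hsub : Metric.closedBall (0 : ℂ) b \ Metric.ball 0 a ⊆ {ζ | R⁻¹ < ‖ζ‖ ∧ ‖ζ‖ < R} := by
      rintro ζ ⟨h4, h5⟩
      rw [mem_closedBall_zero_iff] at h4
      rw [mem_ball_zero_iff, not_lt] at h5
      exact ⟨hRr.trans_le (ha.trans h5), (h4.trans hb).trans_lt hrR⟩
    refine Complex.circleIntegral_eq_of_differentiable_on_annulus_off_countable
      ((inv_pos.2 hr0).trans_le ha) hab countable_empty (hf.continuousOn.mono hsub) fun ζ hζ => ?_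
    have hζ' : ζ ∈ {ζ : ℂ | R⁻¹ < ‖ζ‖ ∧ ‖ζ‖ < R} :=
      hsub ⟨Metric.ball_subset_closedBall hζ.1.1, fun h => hζ.1.2 (Metric.ball_subset_closedBall h)⟩
    exact (hf ζ hζ').differentiableAt (hopen.mem_nhds hζ')
  have hnorm : ‖∮ ζ in C(0, 1), f ζ‖ ≤ 2 * Real.pi * M * r ^ (-|n|) := by
    rcases le_total 0 n with hn | hn
    · rw [abs_of_nonneg hn, ← hshift 1 r hri.le hr.le le_rfl]
      exact key r (hri.trans hr).le le_rfl
    · rw [abs_of_nonpos hn, hshift r⁻¹ 1 le_rfl hri.le hr.le]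
      have := key r⁻¹ le_rfl (hri.trans hr).le
      rwa [inv_zpow', neg_neg, ← neg_neg n] at this
  rwa [hcirc, norm_mul, Complex.norm_I, one_mul] at hnorm

end HasAnnulusExtension

section Decay

variable {Φ : ℂ → ℂ} {q : ℝ → ℂ} {Ψ : ℂ → ℂ} {r R : ℝ}

theorem IsDiscExtension.hasAnnulusExtension_circleT (h : IsDiscExtension Φ q Ψ R) (hr0 : 0 < r)
    (hr : r < R) (lam mu : ℝ) (i j : Fin 2) :
    HasAnnulusExtension r R fun σ τ => (circleT lam mu Ψ σ τ i j : ℂ) := by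
  have hR0 : 0 < R := hr0.trans hr
  have hDd : ∀ σ : ℂ, ‖σ‖ = 1 → DifferentiableOn ℂ (dslope Ψ σ) (Metric.ball 0 R) := fun σ hσ =>
    differentiableOn_dslope_ball h.holo (h.mem_ball hσ)
  have hD0 : ∀ σ : ℂ, ‖σ‖ = 1 → ∀ ζ ∈ Metric.ball (0 : ℂ) R, dslope Ψ σ ζ ≠ 0 := fun σ hσ ζ hζ =>
    h.dslope_ne_zero hσ (by simpa using hζ)
  have hD : HasAnnulusExtension r R fun σ τ => dslope Ψ σ τ :=
    .of_continuousOn hr h.continuousOn_dslope hDd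
  have hDi : HasAnnulusExtension r R fun σ τ => (dslope Ψ σ τ)⁻¹ :=
    .of_continuousOn hr (h.continuousOn_dslope.inv₀ h.dslope_ne_zero')
      fun σ hσ => (hDd σ hσ).fun_inv (hD0 σ hσ)
  have hg : HasAnnulusExtension r R fun σ τ => logRem Ψ σ τ :=
    .of_continuousOn hr h.continuousOn_logRem fun σ hσ =>
      ((differentiableOn_dslope_ball (hDd σ hσ) (h.mem_ball hσ)).div (hDd σ hσ)
        (hD0 σ hσ)).const_mul _
  have hw : HasAnnulusExtension r R fun σ τ => chordTurn Ψ σ τ := by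
    have hστ : HasAnnulusExtension r R fun σ τ => -(τ * σ) :=
      .of_continuousOn hr (by fun_prop) fun σ _ => by fun_prop
    exact hστ.mul (hD.mul (hDi.star hr0 hR0))
  have hk : HasAnnulusExtension r R fun σ τ => (circleK Ψ σ τ : ℂ) :=
    ((HasAnnulusExtension.const (1 / (2 * Real.pi) : ℂ)).mul
      ((HasAnnulusExtension.const (1 / 2)).add (hg.im hr0 hR0))).congr
      fun σ τ _ _ => by rw [circleK]; push_cast; ring
  have hre := hw.re hr0 hR0
  have him := hw.im hr0 hR0
  have hgre := hg.re hr0 hR0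
  set X := (mu + lam) / (2 * mu + lam)
  set Y := 2 * k0 lam mu / (2 * Real.pi) with hY
  have hY' : ∀ x : ℝ, 2 * k0 lam mu * (x / (2 * Real.pi)) = Y * x := fun x => by rw [hY]; ring
  fin_cases i <;> fin_cases j
  · refine (((HasAnnulusExtension.const (-1 : ℂ)).mul hk).add
      ((HasAnnulusExtension.const (-(X : ℂ))).mul (hk.mul hre))).congr
      fun σ τ _ _ => ?_
    simp [circleT, reflMatrix, X]; ring
  · refine (((HasAnnulusExtension.const (-(X : ℂ))).mul (hk.mul him)).add
      ((HasAnnulusExtension.const (-(Y : ℂ))).mul hgre)).congr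
      fun σ τ _ _ => ?_
    simp only [circleT, hY']
    simp [reflMatrix, X]; ring
  · refine (((HasAnnulusExtension.const (-(X : ℂ))).mul (hk.mul him)).add
      ((HasAnnulusExtension.const (Y : ℂ)).mul hgre)).congr
      fun σ τ _ _ => ?_
    simp only [circleT, hY']
    simp [reflMatrix, X]; ring
  · refine (((HasAnnulusExtension.const (-1 : ℂ)).mul hk).add
      ((HasAnnulusExtension.const (X : ℂ)).mul (hk.mul hre))).congr
      fun σ τ _ _ => ?_
    simp [circleT, reflMatrix, X]; ring

/-- Exponential decay of the Fourier coefficients of the kernel. -/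
theorem IsDiscExtension.exists_fourierCoeffKernel_bound (h : IsDiscExtension Φ q Ψ R) {ε : ℝ}
    (hε : 0 < ε) (hεR : Real.exp ε < R) (lam mu : ℝ) :
    ∃ C : ℝ, ∀ (n : ℤ) (s : ℝ) (i j : Fin 2),
      ‖fourierCoeffKernel (fun t s => circleT lam mu Ψ (Complex.exp (s * Complex.I))
        (Complex.exp (t * Complex.I))) n s i j‖ ≤ C * Real.exp (-ε * |(n : ℝ)|) := by
  choose M hM using fun i j => (h.hasAnnulusExtension_circleT (Real.exp_pos ε) hεR lam mu i
    j).exists_fourier_bound (Real.one_lt_exp_iff.2 hε) hεR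
  refine ⟨1 / (2 * Real.pi) * ∑ i, ∑ j, |M i j|, fun n s i j => ?_⟩
  have h1 := hM i j _ (Complex.norm_exp_ofReal_mul_I s) n
  have h2 : Real.exp ε ^ (-|n|) = Real.exp (-ε * |(n : ℝ)|) := by
    rw [← Real.rpow_intCast, ← Real.exp_mul]; congr 1; push_cast; ring
  have h3 : M i j ≤ ∑ i, ∑ j, |M i j| :=
    (le_abs_self _).trans ((Finset.single_le_sum (f := fun j => |M i j|)
      (fun _ _ => abs_nonneg _) (Finset.mem_univ j)).trans
      (Finset.single_le_sum (f := fun i => ∑ j, |M i j|)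
        (fun _ _ => Finset.sum_nonneg fun _ _ => abs_nonneg _) (Finset.mem_univ i)))
  rw [h2] at h1
  simp only [fourierCoeffKernel, Matrix.of_apply, norm_mul]
  have h4 : ‖(1 / (2 * Real.pi) : ℂ)‖ = 1 / (2 * Real.pi) := by
    have : (1 / (2 * Real.pi) : ℂ) = ((1 / (2 * Real.pi) : ℝ) : ℂ) := by push_cast; rfl
    rw [this, Complex.norm_real, Real.norm_of_nonneg (by positivity)]
  rw [h4, mul_assoc]
  gcongr
  exact h1.trans (by gcongr)

end Decay

/-! ### The Hilbert transform inside an integral -/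

/-- The mean value property `∫ h F = 2π h(0) F(0)` on the circles `|ζ| = r < 1` passes to the limit
`r → 1` when `F` has `L²` boundary values `u`. -/
theorem integral_mul_boundary_value {h F : ℂ → ℂ} {u : ℝ → ℂ}
    (hh : DiffContOnCl ℂ h (Metric.ball 0 1)) (hF : DifferentiableOn ℂ F (Metric.ball 0 1))
    (hu : MemLp u 2 (volume.restrict (Ioc (-Real.pi) Real.pi)))
    (hlim : Tendsto (fun r : ℝ => eLpNorm (fun s : ℝ => F (r * Complex.exp (s * Complex.I)) - u s) 2
      (volume.restrict (Ioc (-Real.pi) Real.pi))) (𝓝[<] 1) (𝓝 0)) :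
    ∫ s in (-Real.pi)..Real.pi, h (Complex.exp (s * Complex.I)) * u s =
      2 * Real.pi * (h 0 * F 0) := by
  set μ := volume.restrict (Ioc (-Real.pi) Real.pi)
  have hππ : -Real.pi ≤ Real.pi := by linarith [Real.pi_pos]
  have hr : ∀ᶠ r : ℝ in 𝓝[<] 1, 0 < r ∧ r < 1 := by
    filter_upwards [self_mem_nhdsWithin, nhdsWithin_le_nhds (Ioi_mem_nhds one_pos)] with r h1 h2
    exact ⟨h2, h1⟩
  have hnorm : ∀ r : ℝ, 0 < r → ∀ s : ℝ, ‖(r : ℂ) * Complex.exp (s * Complex.I)‖ = r :=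
    fun r hr s => by
      rw [norm_mul, Complex.norm_exp_ofReal_mul_I, mul_one, Complex.norm_real,
        Real.norm_of_nonneg hr.le]
  have hcl : ContinuousOn h (Metric.closedBall 0 1) := by
    rw [← closure_ball _ one_ne_zero]; exact hh.continuousOn
  have hhc : ∀ r : ℝ, 0 < r → r ≤ 1 → Continuous fun s : ℝ =>
      h (r * Complex.exp (s * Complex.I)) := fun r hr0 hr1 =>
    hcl.comp_continuous (by fun_prop) fun s => by
      rw [mem_closedBall_zero_iff, hnorm r hr0]; exact hr1
  have hFc : ∀ r : ℝ, 0 < r → r < 1 → Continuous fun s : ℝ =>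
      F (r * Complex.exp (s * Complex.I)) := fun r hr0 hr1 =>
    hF.continuousOn.comp_continuous (by fun_prop) fun s => by
      rw [mem_ball_zero_iff, hnorm r hr0]; exact hr1
  obtain ⟨M, hM⟩ := (isCompact_closedBall (0 : ℂ) 1).exists_bound_of_continuousOn hcl
  have hM' : ∀ r : ℝ, 0 < r → r ≤ 1 → ∀ s : ℝ, ‖h (r * Complex.exp (s * Complex.I))‖ ≤ M :=
    fun r hr0 hr1 s => hM _ (by rw [mem_closedBall_zero_iff, hnorm r hr0]; exact hr1)
  have hu1 : Integrable u μ := hu.integrable (by norm_num)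
  -- the mean value property
  have hmv : ∀ r : ℝ, 0 < r → r < 1 → ∫ s in (-Real.pi)..Real.pi,
      h (r * Complex.exp (s * Complex.I)) * F (r * Complex.exp (s * Complex.I)) =
        2 * Real.pi * (h 0 * F 0) := by
    intro r hr0 hr1
    have hd : DiffContOnCl ℂ (fun z => h z * F z) (Metric.ball 0 |r|) := by
      have hsub : Metric.closedBall (0 : ℂ) |r| ⊆ Metric.ball 0 1 := by
        rw [abs_of_pos hr0]; exact Metric.closedBall_subset_ball hr1
      refine ((hh.differentiableOn.mul hF).mono ?_).diffContOnCl
      exact (closure_mono Metric.ball_subset_closedBall).trans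
        (Metric.isClosed_closedBall.closure_eq.subset.trans hsub)
    have h1 := hd.circleAverage
    rw [Real.circleAverage, inv_smul_eq_iff₀ (by positivity)] at h1
    have hper : Function.Periodic (fun s : ℝ => h (r * Complex.exp (s * Complex.I)) *
        F (r * Complex.exp (s * Complex.I))) (2 * Real.pi) := fun s => by
      have : Complex.exp (((s + 2 * Real.pi : ℝ) : ℂ) * Complex.I) =
          Complex.exp (s * Complex.I) := by
        push_cast; rw [add_mul, Complex.exp_periodic]
      simp only [this]
    have hsh := hper.intervalIntegral_add_eq (-Real.pi) 0
    rw [show -Real.pi + 2 * Real.pi = Real.pi by ring, zero_add] at hsh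
    rw [hsh]
    simp only [circleMap, zero_add] at h1
    rw [h1, Complex.real_smul]
    push_cast
    rfl
  -- convergence of the integrals as `r → 1`
  have hA : Tendsto (fun r : ℝ => ∫ s, h (r * Complex.exp (s * Complex.I)) * u s ∂μ) (𝓝[<] 1)
      (𝓝 (∫ s, h (Complex.exp (s * Complex.I)) * u s ∂μ)) := by
    refine tendsto_integral_filter_of_dominated_convergence (fun s => M * ‖u s‖) ?_ ?_
      (hu1.norm.const_mul M) ?_
    · filter_upwards [hr] with r hr
      exact (hhc r hr.1 hr.2.le).aestronglyMeasurable.mul hu1.aestronglyMeasurable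
    · filter_upwards [hr] with r hr
      refine Eventually.of_forall fun s => ?_
      rw [norm_mul]
      exact mul_le_mul_of_nonneg_right (hM' r hr.1 hr.2.le s) (norm_nonneg _)
    · refine Eventually.of_forall fun s => Tendsto.mul_const _ ?_
      have h1 : ContinuousWithinAt h (Metric.closedBall 0 1) (Complex.exp (s * Complex.I)) :=
        hcl _ (by rw [mem_closedBall_zero_iff, Complex.norm_exp_ofReal_mul_I])
      refine h1.tendsto.comp (tendsto_nhdsWithin_iff.2 ⟨?_, ?_⟩)
      · have : Continuous fun r : ℝ => (r : ℂ) * Complex.exp (s * Complex.I) := by fun_prop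
        exact (this.tendsto' 1 _ (by simp)).mono_left nhdsWithin_le_nhds
      · filter_upwards [hr] with r hr
        rw [mem_closedBall_zero_iff, hnorm r hr.1]; exact hr.2.le
  have hint : ∀ r : ℝ, 0 < r → r < 1 →
      Integrable (fun s : ℝ => F (r * Complex.exp (s * Complex.I)) - u s) μ := fun r h0 h1 =>
    ((hFc r h0 h1).integrableOn_Ioc).sub hu1
  have hB : Tendsto (fun r : ℝ => ∫ s, h (r * Complex.exp (s * Complex.I)) *
      (F (r * Complex.exp (s * Complex.I)) - u s) ∂μ) (𝓝[<] 1) (𝓝 0) := by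
    have hL1 : Tendsto (fun r : ℝ => eLpNorm (fun s : ℝ => F (r * Complex.exp (s * Complex.I)) - u s)
        1 μ) (𝓝[<] 1) (𝓝 0) := by
      have hfin : (μ univ ^ (1 / (1 : ℝ≥0∞).toReal - 1 / (2 : ℝ≥0∞).toReal)) ≠ ∞ :=
        ENNReal.rpow_ne_top_of_nonneg (by norm_num) (measure_ne_top _ _)
      have h2 := ENNReal.Tendsto.mul_const hlim (Or.inr hfin)
      rw [zero_mul] at h2
      refine tendsto_of_tendsto_of_tendsto_of_le_of_le' tendsto_const_nhds h2
        (Eventually.of_forall fun _ => zero_le) ?_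
      filter_upwards [hr] with r hr
      exact eLpNorm_le_eLpNorm_mul_rpow_measure_univ (by norm_num)
        (hint r hr.1 hr.2).aestronglyMeasurable
    have hL1' : Tendsto (fun r : ℝ => M * ∫ s, ‖F (r * Complex.exp (s * Complex.I)) - u s‖ ∂μ)
        (𝓝[<] 1) (𝓝 0) := by
      have h3 := ((ENNReal.tendsto_toReal ENNReal.zero_ne_top).comp hL1).const_mul M
      rw [ENNReal.toReal_zero, mul_zero] at h3
      refine h3.congr' ?_
      filter_upwards [hr] with r hr
      rw [Function.comp_apply, eLpNorm_one_eq_lintegral_enorm,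
        integral_norm_eq_lintegral_enorm (hint r hr.1 hr.2).aestronglyMeasurable]
    refine squeeze_zero_norm' ?_ hL1'
    filter_upwards [hr] with r hr
    rw [← integral_const_mul]
    refine norm_integral_le_of_norm_le ((hint r hr.1 hr.2).norm.const_mul M)
      (Eventually.of_forall fun s => ?_)
    rw [norm_mul]
    exact mul_le_mul_of_nonneg_right (hM' r hr.1 hr.2.le s) (norm_nonneg _)
  have hsum : ∀ᶠ r : ℝ in 𝓝[<] 1, (∫ s, h (r * Complex.exp (s * Complex.I)) *
      (F (r * Complex.exp (s * Complex.I)) - u s) ∂μ) +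
        (∫ s, h (r * Complex.exp (s * Complex.I)) * u s ∂μ) = 2 * Real.pi * (h 0 * F 0) := by
    filter_upwards [hr] with r hr
    have i1 : Integrable (fun s : ℝ => h (r * Complex.exp (s * Complex.I)) *
        (F (r * Complex.exp (s * Complex.I)) - u s)) μ :=
      (hint r hr.1 hr.2).bdd_mul (hhc r hr.1 hr.2.le).aestronglyMeasurable
        (Eventually.of_forall (hM' r hr.1 hr.2.le))
    have i2 : Integrable (fun s : ℝ => h (r * Complex.exp (s * Complex.I)) * u s) μ :=
      hu1.bdd_mul (hhc r hr.1 hr.2.le).aestronglyMeasurable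
        (Eventually.of_forall (hM' r hr.1 hr.2.le))
    rw [← integral_add i1 i2, ← hmv r hr.1 hr.2, intervalIntegral.integral_of_le hππ]
    refine integral_congr_ae (Eventually.of_forall fun s => ?_)
    simp only
    ring
  have hfinal := (hB.add hA).congr' hsum
  rw [zero_add] at hfinal
  rw [intervalIntegral.integral_of_le hππ]
  exact tendsto_nhds_unique hfinal tendsto_const_nhds |>.symm ▸ rfl

/-! ### The product of the Neumann–Poincaré operator and the Hilbert transform -/

theorem ae_exp_mul_I_ne (t : ℝ) :
    ∀ᵐ s : ℝ, Complex.exp (s * Complex.I) ≠ Complex.exp (t * Complex.I) := by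
  have hc : (range fun n : ℤ => t + n * (2 * Real.pi)).Countable := countable_range _
  filter_upwards [hc.ae_notMem volume] with s hs h
  obtain ⟨n, hn⟩ := Complex.exp_eq_exp_iff_exists_int.1 h
  refine hs ⟨n, ?_⟩
  have h1 : (s : ℂ) = ((t + n * (2 * Real.pi) : ℝ) : ℂ) := by
    apply mul_right_cancel₀ Complex.I_ne_zero
    rw [hn]; push_cast; ring
  exact (Complex.ofReal_injective h1).symm

section KH

variable {Ω : Set ℂ} {Φ : ℂ → ℂ} {q : ℝ → ℂ} {Ψ : ℂ → ℂ} {R : ℝ}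

theorem IsL2.intervalIntegrable_mul {f : ℂ → ℝ} (hf : IsL2 q f) {a : ℝ → ℝ} (ha : Continuous a) :
    IntervalIntegrable (fun s => a s * f (q s)) volume (-Real.pi) Real.pi := by
  have h1 : IntervalIntegrable (fun s => f (q s)) volume (-Real.pi) Real.pi :=
    (intervalIntegrable_iff_integrableOn_Ioc_of_le (by linarith [Real.pi_pos])).2
      (MemLp.integrable (by norm_num) hf)
  exact h1.continuousOn_mul ha.continuousOn

theorem deriv_dslope_of_ne {τ σ : ℂ} (hne : σ ≠ τ) (hd : DifferentiableAt ℂ Ψ σ) :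
    deriv (dslope Ψ τ) σ = deriv Ψ σ / (σ - τ) - (Ψ σ - Ψ τ) / (σ - τ) ^ 2 := by
  have h3 : σ - τ ≠ 0 := sub_ne_zero.2 hne
  have h1 : dslope Ψ τ =ᶠ[𝓝 σ] fun z => (Ψ z - Ψ τ) / (z - τ) := by
    filter_upwards [isOpen_ne.mem_nhds hne] with z hz
    rw [dslope_of_ne _ hz, slope_def_field]
  rw [h1.deriv_eq]
  have h2 := (hd.hasDerivAt.sub_const (Ψ τ)).div ((hasDerivAt_id σ).sub_const τ) h3
  refine h2.deriv.trans ?_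
  simp only [id]
  field_simp

/-- `iζ ∂_ζ log ((Ψ(ζ) - Ψ(τ)) / (ζ - τ))` is holomorphic in the disc, vanishes at the origin, and
has the boundary values `logRem`. -/
theorem IsDiscExtension.exists_logRem_extension (h : IsDiscExtension Φ q Ψ R) {τ : ℂ}
    (hτ : ‖τ‖ = 1) : ∃ H : ℂ → ℂ, DiffContOnCl ℂ H (Metric.ball 0 1) ∧ H 0 = 0 ∧
      ∀ σ : ℂ, ‖σ‖ = 1 → σ ≠ τ → H σ = logRem Ψ σ τ := by
  have hd : DifferentiableOn ℂ (dslope Ψ τ) (Metric.ball 0 R) :=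
    differentiableOn_dslope_ball h.holo (h.mem_ball hτ)
  have hH : DifferentiableOn ℂ (fun ζ => Complex.I * ζ * (deriv (dslope Ψ τ) ζ / dslope Ψ τ ζ))
      (Metric.ball 0 R) := by
    refine DifferentiableOn.mul (by fun_prop) ((hd.deriv Metric.isOpen_ball).div hd fun z hz => ?_)
    exact h.dslope_ne_zero hτ (by simpa using hz)
  refine ⟨_, (hH.mono ?_).diffContOnCl, by simp, fun σ hσ hne => ?_⟩
  · rw [closure_ball _ one_ne_zero]
    exact Metric.closedBall_subset_ball h.one_lt
  · have hz : Ψ σ - Ψ τ ≠ 0 :=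
      sub_ne_zero.2 (h.ne τ σ hτ (by rw [hσ]; exact h.one_lt) hne)
    have h3 : σ - τ ≠ 0 := sub_ne_zero.2 hne
    rw [h.logRem_eq hσ hτ hne, deriv_dslope_of_ne hne
      (h.holo.differentiableAt (Metric.isOpen_ball.mem_nhds (h.mem_ball hσ))),
      dslope_of_ne _ hne, slope_def_field]
    field_simp

/-- `𝒦 ℋ` has the kernel `Re (logRem) / 2π`: the holomorphic functions `logRem` and `f + i ℋ[f]` of
`σ` are orthogonal in the sense of the mean value property, and `𝒦` has the kernel
`(1/2 + Im (logRem)) / 2π`. -/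
theorem IsDiscExtension.integral_circleK_mul (h : IsDiscExtension Φ q Ψ R)
    (hΦ : IsRiemannMap Ω Φ) {f g : ℂ → ℝ} (hf : IsL2 q f) (hfg : IsHilbertTransform Ω Φ q f g)
    (t : ℝ) :
    ∫ s in (-Real.pi)..Real.pi,
        circleK Ψ (Complex.exp (s * Complex.I)) (Complex.exp (t * Complex.I)) * g (q s) =
      ∫ s in (-Real.pi)..Real.pi,
        (logRem Ψ (Complex.exp (s * Complex.I)) (Complex.exp (t * Complex.I))).re /
          (2 * Real.pi) * f (q s) := by
  obtain ⟨hg, F, hF, hF0, hlim⟩ := hfg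
  set a : ℝ → ℂ := fun s => logRem Ψ (Complex.exp (s * Complex.I)) (Complex.exp (t * Complex.I))
  have ha : Continuous a :=
    h.continuous_logRem.comp (f := fun s : ℝ => (t, s)) (by fun_prop)
  have hu : MemLp (fun s => (f (q s) : ℂ) + Complex.I * (g (q s) : ℂ)) 2
      (volume.restrict (Ioc (-Real.pi) Real.pi)) := by
    have h1 := Complex.ofRealCLM.comp_memLp' hf
    have h2 := (Complex.ofRealCLM.comp_memLp' hg).const_mul Complex.I
    exact h1.add h2
  have hFΦ : DifferentiableOn ℂ (fun z => F (Φ z)) (Metric.ball 0 1) :=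
    hF.comp hΦ.holo fun z hz => hΦ.image_eq.subset (mem_image_of_mem Φ hz)
  have hi : ∀ {b : ℝ → ℂ}, Continuous b → IntervalIntegrable
      (fun s => b s * ((f (q s) : ℂ) + Complex.I * (g (q s) : ℂ))) volume (-Real.pi) Real.pi :=
    fun hb => ((intervalIntegrable_iff_integrableOn_Ioc_of_le (by linarith [Real.pi_pos])).2
      (hu.integrable (by norm_num))).continuousOn_mul hb.continuousOn
  obtain ⟨H, hH, hH0, hHa⟩ := h.exists_logRem_extension (Complex.norm_exp_ofReal_mul_I t)
  have key := integral_mul_boundary_value hH hFΦ hu hlim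
  have key1 := integral_mul_boundary_value (h := fun _ => 1) diffContOnCl_const hFΦ hu hlim
  rw [hH0, zero_mul, mul_zero] at key
  have key' : ∫ s in (-Real.pi)..Real.pi, a s * ((f (q s) : ℂ) + Complex.I * (g (q s) : ℂ)) = 0 := by
    rw [← key]
    refine intervalIntegral.integral_congr_ae ?_
    filter_upwards [ae_exp_mul_I_ne t] with s hs _
    rw [hHa _ (Complex.norm_exp_ofReal_mul_I s) hs]
  have hre := congrArg Complex.re key'
  have him := congrArg Complex.im key1
  rw [← Complex.reCLM_apply, ← Complex.reCLM.intervalIntegral_comp_comm (hi ha)] at hre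
  rw [← Complex.imCLM_apply,
    ← Complex.imCLM.intervalIntegral_comp_comm (hi continuous_const)] at him
  simp only [Complex.reCLM_apply, Complex.imCLM_apply, Complex.mul_re, Complex.mul_im,
    Complex.add_re, Complex.add_im, Complex.ofReal_re, Complex.ofReal_im, Complex.I_re,
    Complex.I_im, Complex.one_re, Complex.one_im, hF0, Complex.zero_re] at hre him
  have iaf : IntervalIntegrable (fun s => (a s).re * f (q s)) volume (-Real.pi) Real.pi :=
    hf.intervalIntegrable_mul (Complex.continuous_re.comp ha)
  have ibg : IntervalIntegrable (fun s => (a s).im * g (q s)) volume (-Real.pi) Real.pi :=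
    hg.intervalIntegrable_mul (Complex.continuous_im.comp ha)
  have ig : IntervalIntegrable (fun s => 1 * g (q s)) volume (-Real.pi) Real.pi :=
    hg.intervalIntegrable_mul (continuous_const (y := (1 : ℝ)))
  have hre' : (∫ s in (-Real.pi)..Real.pi, (a s).re * f (q s)) -
      ∫ s in (-Real.pi)..Real.pi, (a s).im * g (q s) = 0 := by
    rw [← hre, ← intervalIntegral.integral_sub iaf ibg]
    refine intervalIntegral.integral_congr fun s _ => ?_
    simp
  have him' : ∫ s in (-Real.pi)..Real.pi, 1 * g (q s) = 0 := by
    calc _ = _ := by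
            refine intervalIntegral.integral_congr fun s _ => ?_
            simp
         _ = _ := him
         _ = 0 := by norm_num
  have e1 : ∫ s in (-Real.pi)..Real.pi, circleK Ψ (Complex.exp (s * Complex.I))
      (Complex.exp (t * Complex.I)) * g (q s) = (1 / (2 * Real.pi)) *
        (1 / 2 * (∫ s in (-Real.pi)..Real.pi, 1 * g (q s)) +
          ∫ s in (-Real.pi)..Real.pi, (a s).im * g (q s)) := by
    rw [← intervalIntegral.integral_const_mul, ← intervalIntegral.integral_add
      (ig.const_mul _) ibg, ← intervalIntegral.integral_const_mul]
    refine intervalIntegral.integral_congr fun s _ => ?_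
    simp only [circleK, a]
    ring
  have e2 : ∫ s in (-Real.pi)..Real.pi, (a s).re / (2 * Real.pi) * f (q s) =
      (1 / (2 * Real.pi)) * ∫ s in (-Real.pi)..Real.pi, (a s).re * f (q s) := by
    rw [← intervalIntegral.integral_const_mul]
    refine intervalIntegral.integral_congr fun s _ => ?_
    ring
  rw [e1, e2, him', mul_zero, zero_add, sub_eq_zero.1 hre']

end KH

/-! ### Hardy functions with prescribed real part on the unit circle -/

section Fourier

variable {T : ℝ} [hT : Fact (0 < T)]

theorem fourierCoeff_conj (f : AddCircle T → ℂ) (n : ℤ) :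
    fourierCoeff (fun x => conj (f x)) n = conj (fourierCoeff f (-n)) := by
  rw [fourierCoeff, fourierCoeff, ← integral_conj]
  refine integral_congr_ae (Eventually.of_forall fun x => ?_)
  simp only [smul_eq_mul, map_mul, ← fourier_neg, neg_neg]

theorem norm_sq_eq_tsum_fourierBasis_repr (v : Lp ℂ 2 (AddCircle.haarAddCircle (T := T))) :
    ‖v‖ ^ 2 = ∑' n, ‖fourierBasis.repr v n‖ ^ 2 := by
  have H : HasSum (fun i => ‖fourierBasis.repr v i‖ ^ 2) (‖fourierBasis.repr v‖ ^ 2) := by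
    exact_mod_cast lp.hasSum_norm (by simp) (fourierBasis.repr v)
  rw [H.tsum_eq, LinearIsometryEquiv.norm_map]

/-- The Abel means of a square summable sequence of coefficients converge in `L²`. -/
theorem tendsto_repr_symm_abel (d : lp (fun _ : ℤ => ℂ) 2)
    (v : ℝ → Lp ℂ 2 (AddCircle.haarAddCircle (T := T)))
    (hv : ∀ r : ℝ, 0 < r → r < 1 → ∀ n, fourierBasis.repr (v r) n = (r : ℂ) ^ n.natAbs * d n) :
    Tendsto (fun r => ‖v r - fourierBasis.repr.symm d‖) (𝓝[<] 1) (𝓝 0) := by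
  have hr : ∀ᶠ r : ℝ in 𝓝[<] 1, 0 < r ∧ r < 1 := by
    filter_upwards [self_mem_nhdsWithin, nhdsWithin_le_nhds (Ioi_mem_nhds one_pos)] with r h1 h2
    exact ⟨h2, h1⟩
  have hd : Summable fun n => ‖d n‖ ^ 2 := by
    exact_mod_cast (lp.hasSum_norm (by simp) d).summable
  have key : Tendsto (fun r : ℝ => ∑' n : ℤ, ‖((r : ℂ) ^ n.natAbs - 1) * d n‖ ^ 2) (𝓝[<] 1)
      (𝓝 (∑' n : ℤ, (0 : ℝ))) := by
    refine tendsto_tsum_of_dominated_convergence (hd.mul_left 4) (fun n => ?_) ?_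
    · have h1 : Continuous fun r : ℝ => ‖((r : ℂ) ^ n.natAbs - 1) * d n‖ ^ 2 := by fun_prop
      exact (h1.tendsto' 1 0 (by simp)).mono_left nhdsWithin_le_nhds
    · filter_upwards [hr] with r hr n
      rw [Real.norm_of_nonneg (by positivity), norm_mul, mul_pow]
      refine mul_le_mul_of_nonneg_right ?_ (by positivity)
      have h2 : ‖(r : ℂ) ^ n.natAbs - 1‖ ≤ 2 := by
        refine (norm_sub_le _ _).trans ?_
        rw [norm_pow, Complex.norm_real, Real.norm_of_nonneg hr.1.le, norm_one]
        linarith [pow_le_one₀ (n := n.natAbs) hr.1.le hr.2.le]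
      nlinarith [norm_nonneg ((r : ℂ) ^ n.natAbs - 1)]
  rw [tsum_zero] at key
  have h0 := (Real.continuous_sqrt.tendsto 0).comp key
  rw [Real.sqrt_zero] at h0
  refine h0.congr' ?_
  filter_upwards [hr] with r hr
  rw [Function.comp_apply, ← Real.sqrt_sq (norm_nonneg (v r - _)),
    norm_sq_eq_tsum_fourierBasis_repr]
  congr 2
  ext n
  rw [map_sub, LinearIsometryEquiv.apply_symm_apply, lp.coeFn_sub, Pi.sub_apply, hv r hr.1 hr.2]
  congr 2
  ring

/-- The power series `∑ d_n ζ^n` converges uniformly on the circle of radius `r < 1`. -/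
theorem summable_fourier_powerSeries {d : ℤ → ℂ} {M : ℝ} (hM : ∀ n, ‖d n‖ ≤ M) {r : ℝ} (hr0 : 0 < r)
    (hr1 : r < 1) : Summable fun n : ℕ => (d n * (r : ℂ) ^ n) • (fourier (T := T) n) := by
  refine Summable.of_norm_bounded ((summable_geometric_of_lt_one hr0.le hr1).mul_left M)
    fun n => ?_
  rw [norm_smul, fourier_norm, mul_one, norm_mul, norm_pow, Complex.norm_real,
    Real.norm_of_nonneg hr0.le]
  exact mul_le_mul_of_nonneg_right (hM n) (by positivity)

theorem fourierBasis_repr_toLp_tsum {d : ℤ → ℂ} {M : ℝ} (hM : ∀ n, ‖d n‖ ≤ M)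
    (hd : ∀ n < 0, d n = 0) {r : ℝ} (hr0 : 0 < r) (hr1 : r < 1) (m : ℤ) :
    fourierBasis.repr (ContinuousMap.toLp (E := ℂ) 2 (AddCircle.haarAddCircle (T := T)) ℂ
      (∑' n : ℕ, (d n * (r : ℂ) ^ n) • (fourier (T := T) n))) m = (r : ℂ) ^ m.natAbs * d m := by
  have h1 := (summable_fourier_powerSeries (T := T) hM hr0 hr1).hasSum
  have h2 := (ContinuousMap.toLp (E := ℂ) 2 (AddCircle.haarAddCircle (T := T)) ℂ).hasSum h1
  have h3 := (innerSL ℂ (fourierLp (T := T) 2 m)).hasSum h2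
  rw [← coe_fourierBasis, innerSL_apply_apply, ← HilbertBasis.repr_apply_apply] at h3
  refine h3.unique ?_
  have h4 : ∀ n : ℕ, innerSL ℂ (fourierLp (T := T) 2 m)
      (ContinuousMap.toLp (E := ℂ) 2 (AddCircle.haarAddCircle (T := T)) ℂ
        ((d n * (r : ℂ) ^ n) • (fourier (T := T) n))) =
      if (n : ℤ) = m then (r : ℂ) ^ m.natAbs * d m else 0 := fun n => by
    rw [map_smul, innerSL_apply_apply, inner_smul_right,
      orthonormal_iff_ite.1 (orthonormal_fourier (T := T)) m n]
    by_cases h : (n : ℤ) = m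
    · subst h; simp [mul_comm]
    · rw [if_neg h, if_neg (Ne.symm h), mul_zero]
  rw [← coe_fourierBasis] at h4
  simp only [h4]
  rcases lt_or_ge m 0 with hm | hm
  · have h5 : ∀ n : ℕ, (n : ℤ) ≠ m := fun n => by omega
    simp only [h5, if_false, hd m hm, mul_zero]
    exact hasSum_zero
  · lift m to ℕ using hm
    simp only [Nat.cast_inj, Int.natAbs_natCast]
    exact hasSum_ite_eq m ((r : ℂ) ^ m * d m)

/-- The Fourier coefficients of the Hardy function whose real part on the circle has the Fourier
coefficients `c`. -/
def analyticCoeff (c : ℤ → ℂ) (n : ℤ) : ℂ := if n < 0 then 0 else if n = 0 then c 0 else 2 * c n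

theorem norm_analyticCoeff_le (c : ℤ → ℂ) (n : ℤ) : ‖analyticCoeff c n‖ ≤ 2 * ‖c n‖ := by
  unfold analyticCoeff
  split_ifs with h h1
  · simp
  · subst h1; linarith [norm_nonneg (c 0)]
  · simp

theorem analyticCoeff_add_conj {c : ℤ → ℂ} (hc : ∀ n, c n = conj (c (-n))) (n : ℤ) :
    analyticCoeff c n + conj (analyticCoeff c (-n)) = 2 * c n := by
  unfold analyticCoeff
  rcases lt_trichotomy n 0 with h | h | h
  · rw [if_pos h, if_neg (by omega), if_neg (by omega), map_mul, ← hc, zero_add,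
      Complex.conj_ofNat]
  · subst h
    have := hc 0
    simp only [neg_zero] at this
    simp only [neg_zero, lt_irrefl, if_false, if_true, ← this]; ring
  · rw [if_neg (by omega), if_neg (by omega), if_pos (by omega)]; simp

/-- Every real function in `L²` of the circle is the real part of the boundary value of a
holomorphic function in the disc. -/
theorem exists_hardy_addCircle {f : AddCircle T → ℝ}
    (hf : MemLp (fun x => (f x : ℂ)) 2 (AddCircle.haarAddCircle (T := T))) :
    ∃ (d : ℤ → ℂ) (M : ℝ) (G : AddCircle T → ℂ), (∀ n, ‖d n‖ ≤ M) ∧ (d 0).im = 0 ∧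
      MemLp G 2 (AddCircle.haarAddCircle (T := T)) ∧
      (∀ᵐ x ∂AddCircle.haarAddCircle (T := T), (G x).re = f x) ∧
      Tendsto (fun r : ℝ => eLpNorm (fun x => (∑' n : ℕ, (d n * (r : ℂ) ^ n) •
        fourier (T := T) n) x - G x) 2 (AddCircle.haarAddCircle (T := T))) (𝓝[<] 1) (𝓝 0) := by
  set c : ℤ → ℂ := fourierCoeff (fun x => (f x : ℂ)) with hc_def
  have hφ : ∀ n, fourierBasis.repr hf.toLp n = c n := fun n => by
    rw [fourierBasis_repr, fourierCoeff_congr_ae hf.coeFn_toLp]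
  have hc : ∀ n, c n = conj (c (-n)) := fun n => by
    rw [hc_def, ← fourierCoeff_conj]; simp only [Complex.conj_ofReal]
  have hc2 : Summable fun n => ‖c n‖ ^ 2 := by
    have : Summable fun n => ‖fourierBasis.repr hf.toLp n‖ ^ 2 := by
      exact_mod_cast (lp.hasSum_norm (by simp) (fourierBasis.repr hf.toLp)).summable
    simpa only [hφ] using this
  have hmem : Memℓp (analyticCoeff c) 2 := by
    refine memℓp_gen ?_
    have : Summable fun n => ‖analyticCoeff c n‖ ^ 2 := by
      refine Summable.of_nonneg_of_le (fun n => by positivity) (fun n => ?_) (hc2.mul_left 4)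
      have := norm_analyticCoeff_le c n
      nlinarith [norm_nonneg (analyticCoeff c n)]
    exact_mod_cast this
  let d : lp (fun _ : ℤ => ℂ) 2 := ⟨analyticCoeff c, hmem⟩
  have hdM : ∀ n, ‖analyticCoeff c n‖ ≤ ‖d‖ := fun n => lp.norm_apply_le_norm (by simp) d n
  have hneg : ∀ n < 0, analyticCoeff c n = 0 := fun n hn => by rw [analyticCoeff, if_pos hn]
  set G : Lp ℂ 2 (AddCircle.haarAddCircle (T := T)) := fourierBasis.repr.symm d with hG
  have hGc : fourierCoeff (G : AddCircle T → ℂ) = analyticCoeff c := by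
    ext n
    rw [← fourierBasis_repr, hG, LinearIsometryEquiv.apply_symm_apply]
  refine ⟨analyticCoeff c, ‖d‖, G, hdM, ?_, Lp.memLp G, ?_, ?_⟩
  · have h0 := hc 0
    rw [neg_zero] at h0
    simpa [analyticCoeff] using Complex.conj_eq_iff_im.1 h0.symm
  · have hk : MemLp (fun x => (1 / 2 : ℂ) * (G x + conj (G x))) 2
        (AddCircle.haarAddCircle (T := T)) :=
      ((Lp.memLp G).add (Lp.memLp G).star).const_mul _
    have hGi : Integrable (G : AddCircle T → ℂ) (AddCircle.haarAddCircle (T := T)) :=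
      (Lp.memLp G).integrable (by norm_num)
    have hGi' : Integrable (fun x => conj (G x)) (AddCircle.haarAddCircle (T := T)) :=
      ((Lp.memLp G).star).integrable (by norm_num)
    have heq : hk.toLp = hf.toLp := by
      apply fourierBasis.repr.injective
      ext n
      rw [hφ, fourierBasis_repr, fourierCoeff_congr_ae hk.coeFn_toLp, fourierCoeff.const_mul]
      have := congrFun (fourierCoeff.add hGi hGi') n
      rw [Pi.add_apply, fourierCoeff_conj, hGc, analyticCoeff_add_conj hc] at this
      rw [show (fun x => G x + conj (G x)) = (G : AddCircle T → ℂ) + fun x => conj (G x) from rfl,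
        this]
      ring
    filter_upwards [hk.coeFn_toLp, hf.coeFn_toLp] with x h1 h2
    rw [heq, h2, Complex.add_conj] at h1
    have := congrArg Complex.re h1
    simpa using this.symm
  · have h1 := tendsto_repr_symm_abel (T := T) d (fun r => ContinuousMap.toLp (E := ℂ) 2
      (AddCircle.haarAddCircle (T := T)) ℂ (∑' n : ℕ, (d n * (r : ℂ) ^ n) • (fourier (T := T) n)))
      fun r h0 h1 n => fourierBasis_repr_toLp_tsum hdM hneg h0 h1 n
    rw [← tendsto_iff_norm_sub_tendsto_zero, Lp.tendsto_Lp_iff_tendsto_eLpNorm'] at h1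
    refine h1.congr fun r => eLpNorm_congr_ae ?_
    filter_upwards [ContinuousMap.coeFn_toLp (𝕜 := ℂ) (p := 2)
      (AddCircle.haarAddCircle (T := T)) (∑' n : ℕ,
        (analyticCoeff c n * (r : ℂ) ^ n) • (fourier (T := T) n))] with x hx
    rw [Pi.sub_apply, hx]

end Fourier

/-- Every real function in `L²(-π, π)` is the real part of the boundary value of a holomorphic
function `F` in the disc, which may be normalized by `Im F(0) = 0`. -/
theorem exists_hardy {f : ℝ → ℝ} (hf : MemLp f 2 (volume.restrict (Ioc (-Real.pi) Real.pi))) :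
    ∃ (F : ℂ → ℂ) (g : ℝ → ℝ), DifferentiableOn ℂ F (Metric.ball 0 1) ∧ (F 0).im = 0 ∧
      MemLp g 2 (volume.restrict (Ioc (-Real.pi) Real.pi)) ∧
      Tendsto (fun r : ℝ => eLpNorm (fun s : ℝ => F (r * Complex.exp (s * Complex.I)) -
        ((f s : ℂ) + Complex.I * (g s : ℂ))) 2 (volume.restrict (Ioc (-Real.pi) Real.pi)))
        (𝓝[<] 1) (𝓝 0) := by
  have : Fact (0 < 2 * Real.pi) := ⟨Real.two_pi_pos⟩
  have hI : Ioc (-Real.pi) (-Real.pi + 2 * Real.pi) = Ioc (-Real.pi) Real.pi := by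
    congr 1; ring
  have hmp : MeasurePreserving (fun s : ℝ => (s : AddCircle (2 * Real.pi)))
      (volume.restrict (Ioc (-Real.pi) Real.pi)) volume := by
    rw [← hI]; exact AddCircle.measurePreserving_mk (2 * Real.pi) (-Real.pi)
  set fl : AddCircle (2 * Real.pi) → ℝ := fun x =>
    (AddCircle.liftIoc (2 * Real.pi) (-Real.pi) (fun s => (f s : ℂ)) x).re
  have hfl : MemLp (fun x => (fl x : ℂ)) 2 (AddCircle.haarAddCircle (T := 2 * Real.pi)) := by
    have h1 : MemLp (fun s => (f s : ℂ)) 2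
        (volume.restrict (Ioc (-Real.pi) (-Real.pi + 2 * Real.pi))) := by
      rw [hI]; exact Complex.ofRealCLM.comp_memLp' hf
    exact Complex.ofRealCLM.comp_memLp' (Complex.reCLM.comp_memLp' h1.memLp_liftIoc.haarAddCircle)
  obtain ⟨d, M, G, hM, hd0, hG, hre, hlim⟩ := exists_hardy_addCircle hfl
  have hac : ∀ {p : AddCircle (2 * Real.pi) → Prop},
      (∀ᵐ x ∂AddCircle.haarAddCircle (T := 2 * Real.pi), p x) →
        ∀ᵐ s : ℝ ∂volume.restrict (Ioc (-Real.pi) Real.pi), p (s : AddCircle (2 * Real.pi)) :=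
    fun hp => hmp.quasiMeasurePreserving.ae (by
      rw [AddCircle.volume_eq_smul_haarAddCircle]
      exact Measure.ae_smul_measure hp _)
  have hG' : MemLp (fun s : ℝ => G (s : AddCircle (2 * Real.pi))) 2
      (volume.restrict (Ioc (-Real.pi) Real.pi)) :=
    hG.of_haarAddCircle.comp_measurePreserving hmp
  refine ⟨fun ζ => ∑' n : ℕ, d n * ζ ^ n, fun s => (G (s : AddCircle (2 * Real.pi))).im, ?_, ?_,
    Complex.imCLM.comp_memLp' hG', ?_⟩
  · intro z hz
    rw [mem_ball_zero_iff] at hz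
    obtain ⟨ρ, h1, h2⟩ := exists_between hz
    have hρ : 0 < ρ := (norm_nonneg z).trans_lt h1
    have := Complex.differentiableOn_tsum_of_summable_norm (U := Metric.ball (0 : ℂ) ρ)
      (F := fun (n : ℕ) ζ => d n * ζ ^ n)
      ((summable_geometric_of_lt_one hρ.le h2).mul_left M) (fun n => by fun_prop)
      Metric.isOpen_ball fun n w hw => by
        rw [norm_mul, norm_pow]
        rw [mem_ball_zero_iff] at hw
        exact mul_le_mul (hM n) (pow_le_pow_left₀ (norm_nonneg _) hw.le _) (by positivity)
          ((norm_nonneg _).trans (hM n))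
    exact (this.differentiableAt (Metric.isOpen_ball.mem_nhds
      (by simpa using h1))).differentiableWithinAt
  · have h0 : ∑' n : ℕ, d n * (0 : ℂ) ^ n = d 0 := by
      rw [tsum_eq_single 0 fun n hn => by rw [zero_pow hn, mul_zero]]
      simp
    simpa only [h0] using hd0
  · set c : ℝ≥0∞ := ENNReal.ofReal (2 * Real.pi) ^ (1 / (2 : ℝ≥0∞)).toReal
    have hc : c ≠ ∞ := ENNReal.rpow_ne_top_of_nonneg ENNReal.toReal_nonneg ENNReal.ofReal_ne_top
    have h1 := ENNReal.Tendsto.const_mul (a := c) hlim (Or.inr hc)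
    rw [mul_zero] at h1
    refine h1.congr' ?_
    filter_upwards [self_mem_nhdsWithin, nhdsWithin_le_nhds (Ioi_mem_nhds one_pos)] with r hr1 hr0
    set D : AddCircle (2 * Real.pi) → ℂ := fun x => (∑' n : ℕ, (d n * (r : ℂ) ^ n) •
      fourier (T := 2 * Real.pi) n) x - G x
    have hDm : AEStronglyMeasurable D volume :=
      (ContinuousMap.continuous _).aestronglyMeasurable.sub
        hG.of_haarAddCircle.aestronglyMeasurable
    have h2 : eLpNorm D 2 volume =
        c * eLpNorm D 2 (AddCircle.haarAddCircle (T := 2 * Real.pi)) := by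
      rw [AddCircle.volume_eq_smul_haarAddCircle,
        eLpNorm_smul_measure_of_ne_top (by norm_num), smul_eq_mul]
    rw [← h2, ← eLpNorm_comp_measurePreserving hDm hmp]
    refine eLpNorm_congr_ae ?_
    filter_upwards [hac hre, ae_restrict_mem measurableSet_Ioc] with s hs hsI
    simp only [fl] at hs
    rw [AddCircle.liftIoc_coe_apply (by rwa [hI]), Complex.ofReal_re] at hs
    have h3 : (∑' n : ℕ, (d n * (r : ℂ) ^ n) • fourier (T := 2 * Real.pi) n)
        (s : AddCircle (2 * Real.pi)) = ∑' n : ℕ, d n * (r * Complex.exp (s * Complex.I)) ^ n := by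
      have h4 := (ContinuousMap.evalCLM ℂ (s : AddCircle (2 * Real.pi))).hasSum
        (summable_fourier_powerSeries (T := 2 * Real.pi) hM hr0 hr1).hasSum
      refine h4.tsum_eq.symm.trans (tsum_congr fun n => ?_)
      rw [ContinuousMap.evalCLM_apply, ContinuousMap.smul_apply, fourier_coe_apply, smul_eq_mul,
        mul_pow, ← Complex.exp_nat_mul, mul_assoc]
      congr 3
      have : (Real.pi : ℂ) ≠ 0 := by exact_mod_cast Real.pi_ne_zero
      push_cast
      field_simp
    rw [Function.comp_apply, ← h3, ← hs, mul_comm Complex.I, Complex.re_add_im]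

/-! ### Holomorphy of the inverse of an injective holomorphic function -/

section Inverse

variable {U : Set ℂ} {f : ℂ → ℂ}

theorem not_eventually_eq_of_injOn (hU : IsOpen U) (hinj : InjOn f U) {z : ℂ} (hz : z ∈ U) :
    ¬ ∀ᶠ w in 𝓝 z, f w = f z := fun h => by
  have h1 : ∀ᶠ w in 𝓝[≠] z, f w = f z ∧ w ∈ U ∧ w ≠ z := by
    filter_upwards [nhdsWithin_le_nhds h, nhdsWithin_le_nhds (hU.mem_nhds hz),
      self_mem_nhdsWithin] with w h1 h2 h3
    exact ⟨h1, h2, h3⟩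
  obtain ⟨w, h1, h2, h3⟩ := h1.exists
  exact h3 (hinj h2 hz h1)

theorem nhds_le_map_nhds_of_injOn (hU : IsOpen U) (hf : DifferentiableOn ℂ f U) (hinj : InjOn f U)
    {z : ℂ} (hz : z ∈ U) : 𝓝 (f z) ≤ map f (𝓝 z) :=
  ((hf.analyticAt (hU.mem_nhds hz)).eventually_constant_or_nhds_le_map_nhds).resolve_left
    (not_eventually_eq_of_injOn hU hinj hz)

theorem continuousAt_invFunOn_of_injOn (hU : IsOpen U) (hf : DifferentiableOn ℂ f U)
    (hinj : InjOn f U) {z : ℂ} (hz : z ∈ U) : ContinuousAt (Function.invFunOn f U) (f z) := by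
  intro V hV
  rw [hinj.leftInvOn_invFunOn hz] at hV
  have h1 := nhds_le_map_nhds_of_injOn hU hf hinj hz
    (image_mem_map (inter_mem hV (hU.mem_nhds hz)))
  refine mem_map.2 (mem_of_superset h1 ?_)
  rintro _ ⟨w, ⟨hwV, hwU⟩, rfl⟩
  rwa [mem_preimage, hinj.leftInvOn_invFunOn hwU]

theorem eventually_deriv_ne_zero_of_injOn (hU : IsOpen U) (hf : DifferentiableOn ℂ f U)
    (hinj : InjOn f U) {z : ℂ} (hz : z ∈ U) : ∀ᶠ w in 𝓝[≠] z, deriv f w ≠ 0 := by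
  refine ((hf.analyticAt (hU.mem_nhds hz)).deriv.eventually_eq_zero_or_eventually_ne_zero
    ).resolve_left fun h => not_eventually_eq_of_injOn hU hinj hz ?_
  obtain ⟨ρ, hρ, hball⟩ := Metric.eventually_nhds_iff_ball.1 (h.and (hU.mem_nhds hz))
  filter_upwards [Metric.ball_mem_nhds z hρ] with w hw
  exact Metric.isOpen_ball.is_const_of_deriv_eq_zero (convex_ball z ρ).isPreconnected
    (hf.mono fun x hx => (hball x hx).2) (fun x hx => (hball x hx).1) hw (Metric.mem_ball_self hρ)

/-- The inverse is continuous, and differentiable off the (isolated) images of critical points; such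
singularities are removable. -/
theorem differentiableOn_invFunOn_of_injOn (hU : IsOpen U) (hf : DifferentiableOn ℂ f U)
    (hinj : InjOn f U) : DifferentiableOn ℂ (Function.invFunOn f U) (f '' U) := by
  rintro _ ⟨z, hz, rfl⟩
  have hc := continuousAt_invFunOn_of_injOn hU hf hinj hz
  have himg : ∀ {x}, x ∈ U → f '' U ∈ 𝓝 (f x) := fun hx =>
    nhds_le_map_nhds_of_injOn hU hf hinj hx (image_mem_map (hU.mem_nhds hx))
  have htend : Tendsto (Function.invFunOn f U) (𝓝[≠] (f z)) (𝓝[≠] z) := by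
    refine tendsto_nhdsWithin_iff.2 ⟨?_, ?_⟩
    · have h1 := hc.tendsto
      rw [hinj.leftInvOn_invFunOn hz] at h1
      exact h1.mono_left nhdsWithin_le_nhds
    · filter_upwards [nhdsWithin_le_nhds (himg hz), self_mem_nhdsWithin]
      rintro _ ⟨x, hx, rfl⟩ hne
      rw [hinj.leftInvOn_invFunOn hx]
      rintro rfl
      exact hne rfl
  refine (Complex.analyticAt_of_differentiable_on_punctured_nhds_of_continuousAt ?_
    hc).differentiableAt.differentiableWithinAt
  filter_upwards [htend.eventually (eventually_deriv_ne_zero_of_injOn hU hf hinj hz),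
    nhdsWithin_le_nhds (himg hz)]
  rintro _ hd ⟨x, hx, rfl⟩
  have hx' := hinj.leftInvOn_invFunOn hx
  refine (HasDerivAt.of_local_left_inverse (continuousAt_invFunOn_of_injOn hU hf hinj hx)
    (hf.differentiableAt (hU.mem_nhds (by rwa [hx']))).hasDerivAt hd ?_).differentiableAt
  filter_upwards [himg hx] with y hy
  exact Function.invFunOn_eq hy

end Inverse

/-! ### Existence of the Hilbert transform -/

section Boundary

variable {Ω : Set ℂ} {Φ : ℂ → ℂ} {q : ℝ → ℂ} {Ψ : ℂ → ℂ} {R : ℝ}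

/-- A density on the boundary may be prescribed by its values along the parametrization. -/
theorem IsDiscExtension.exists_density (h : IsDiscExtension Φ q Ψ R) {E : Type*} (g : ℝ → E) :
    ∃ G : ℂ → E, ∀ s ∈ Ico (-Real.pi) Real.pi, G (q s) = g s :=
  ⟨fun y => g (Function.invFunOn q (Ico (-Real.pi) Real.pi) y), fun s hs => by
    simp only [h.injOn.leftInvOn_invFunOn hs]⟩

theorem ae_mem_Ico : ∀ᵐ s ∂volume.restrict (Ioc (-Real.pi) Real.pi),
    s ∈ Ico (-Real.pi) Real.pi := by
  rw [Measure.restrict_congr_set Ioo_ae_eq_Ioc.symm]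
  filter_upwards [ae_restrict_mem measurableSet_Ioo] with s hs
  exact Ioo_subset_Ico_self hs

theorem IsDiscExtension.exists_isHilbertTransform (h : IsDiscExtension Φ q Ψ R)
    (hΦ : IsRiemannMap Ω Φ) {f : ℂ → ℝ} (hf : IsL2 q f) :
    ∃ g, IsHilbertTransform Ω Φ q f g := by
  obtain ⟨F, g, hF, hF0, hg, hlim⟩ := exists_hardy hf
  obtain ⟨G, hG⟩ := h.exists_density g
  have hae : ∀ᵐ s ∂volume.restrict (Ioc (-Real.pi) Real.pi), G (q s) = g s := by
    filter_upwards [ae_mem_Ico] with s hs using hG s hs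
  have hinv : ∀ z ∈ Metric.ball (0 : ℂ) 1,
      Function.invFunOn Φ (Metric.ball 0 1) (Φ z) = z := fun z hz =>
    hΦ.injOn.leftInvOn_invFunOn hz
  refine ⟨G, (memLp_congr_ae hae).2 hg, fun w => F (Function.invFunOn Φ (Metric.ball 0 1) w), ?_, ?_,
    ?_⟩
  · have h1 := differentiableOn_invFunOn_of_injOn Metric.isOpen_ball hΦ.holo hΦ.injOn
    rw [hΦ.image_eq] at h1
    refine hF.comp h1 fun w hw => ?_
    rw [← hΦ.image_eq] at hw
    exact Function.invFunOn_mem hw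
  · simpa only [hinv 0 (Metric.mem_ball_self one_pos)] using hF0
  · refine hlim.congr' ?_
    filter_upwards [self_mem_nhdsWithin, nhdsWithin_le_nhds (Ioi_mem_nhds one_pos)] with r hr1 hr0
    refine eLpNorm_congr_ae ?_
    filter_upwards [hae] with s hs
    rw [hs, hinv]
    rw [mem_ball_zero_iff, norm_mul, Complex.norm_exp_ofReal_mul_I, mul_one, Complex.norm_real,
      Real.norm_of_nonneg (le_of_lt hr0)]
    exact hr1

theorem IsDiscExtension.isHilbertTransform (h : IsDiscExtension Φ q Ψ R)
    (hΦ : IsRiemannMap Ω Φ) {f : ℂ → ℝ} (hf : IsL2 q f) :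
    IsHilbertTransform Ω Φ q f (hilbertTransform Ω Φ q f) :=
  Classical.epsilon_spec (h.exists_isHilbertTransform hΦ hf)

end Boundary

/-! ### The kernel of the operator and its uniqueness -/

section Kernel

variable {Ω : Set ℂ} {Φ : ℂ → ℂ} {q : ℝ → ℂ} {Ψ : ℂ → ℂ} {R : ℝ}

theorem intervalIntegrable_mulVec_apply {A : ℝ → Matrix (Fin 2) (Fin 2) ℝ} (hA : Continuous A)
    {φ : ℂ → Fin 2 → ℝ} (hφ : ∀ i, IsL2 q fun y => φ y i) (i : Fin 2) :
    IntervalIntegrable (fun s => (A s).mulVec (φ (q s)) i) volume (-Real.pi) Real.pi := by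
  simp only [Matrix.mulVec, dotProduct, Fin.sum_univ_two]
  exact ((hφ 0).intervalIntegrable_mul (hA.matrix_elem i 0)).add
    ((hφ 1).intervalIntegrable_mul (hA.matrix_elem i 1))

theorem intervalIntegrable_mulVec {A : ℝ → Matrix (Fin 2) (Fin 2) ℝ} (hA : Continuous A)
    {φ : ℂ → Fin 2 → ℝ} (hφ : ∀ i, IsL2 q fun y => φ y i) :
    IntervalIntegrable (fun s => (A s).mulVec (φ (q s))) volume (-Real.pi) Real.pi :=
  ⟨Integrable.of_eval fun i => (intervalIntegrable_mulVec_apply hA hφ i).1,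
    Integrable.of_eval fun i => (intervalIntegrable_mulVec_apply hA hφ i).2⟩

theorem integral_mulVec_apply {A : ℝ → Matrix (Fin 2) (Fin 2) ℝ} (hA : Continuous A)
    {φ : ℂ → Fin 2 → ℝ} (hφ : ∀ i, IsL2 q fun y => φ y i) (i : Fin 2) :
    (∫ s in (-Real.pi)..Real.pi, (A s).mulVec (φ (q s))) i =
      ∫ s in (-Real.pi)..Real.pi, (A s).mulVec (φ (q s)) i :=
  ((ContinuousLinearMap.proj (R := ℝ) (φ := fun _ : Fin 2 => ℝ) i).intervalIntegral_comp_comm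
    (intervalIntegrable_mulVec hA hφ)).symm

theorem IsDiscExtension.isL2_opH (h : IsDiscExtension Φ q Ψ R) (hΦ : IsRiemannMap Ω Φ)
    {φ : ℂ → Fin 2 → ℝ} (hφ : ∀ i, IsL2 q fun y => φ y i) (i : Fin 2) :
    IsL2 q fun y => opH Ω Φ q φ y i := by
  fin_cases i
  · exact MemLp.neg (h.isHilbertTransform hΦ (hφ 1)).1
  · exact (h.isHilbertTransform hΦ (hφ 0)).1

/-- `B H` has the kernel `Re (logRem) / 2π` times the rotation by a right angle. -/
theorem IsDiscExtension.integralOp_kernelB_opH (h : IsDiscExtension Φ q Ψ R)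
    (hΦ : IsRiemannMap Ω Φ) {φ : ℂ → Fin 2 → ℝ} (hφ : ∀ i, IsL2 q fun y => φ y i) (t : ℝ) :
    integralOp kernelB q (opH Ω Φ q φ) (q t) = ∫ s in (-Real.pi)..Real.pi,
      (((logRem Ψ (Complex.exp (s * Complex.I)) (Complex.exp (t * Complex.I))).re /
        (2 * Real.pi)) • (!![0, -1; 1, 0] : Matrix (Fin 2) (Fin 2) ℝ)).mulVec (φ (q s)) := by
  have hK : Continuous fun s : ℝ =>
      circleK Ψ (Complex.exp (s * Complex.I)) (Complex.exp (t * Complex.I)) :=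
    h.continuous_circleK.comp (f := fun s : ℝ => (t, s)) (by fun_prop)
  have hr : Continuous fun s : ℝ =>
      (logRem Ψ (Complex.exp (s * Complex.I)) (Complex.exp (t * Complex.I))).re / (2 * Real.pi) :=
    (Complex.continuous_re.comp
      (h.continuous_logRem.comp (f := fun s : ℝ => (t, s)) (by fun_prop))).div_const _
  have e1 : integralOp kernelB q (opH Ω Φ q φ) (q t) = ∫ s in (-Real.pi)..Real.pi,
      (circleK Ψ (Complex.exp (s * Complex.I)) (Complex.exp (t * Complex.I)) •
        (1 : Matrix (Fin 2) (Fin 2) ℝ)).mulVec (opH Ω Φ q φ (q s)) := by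
    refine intervalIntegral.integral_congr_ae ?_
    filter_upwards [ae_exp_mul_I_ne t] with s hs _
    rw [← h.angleForm_eq hs, ← norm_mul_kernelK (h.deriv_param_ne_zero s), ← Matrix.smul_mulVec]
    congr 1
    ext i j
    fin_cases i <;> fin_cases j <;> simp [kernelB]
  rw [e1]
  ext i
  have hK1 : Continuous fun s : ℝ => circleK Ψ (Complex.exp (s * Complex.I))
      (Complex.exp (t * Complex.I)) • (1 : Matrix (Fin 2) (Fin 2) ℝ) := hK.smul continuous_const
  have hrJ : Continuous fun s : ℝ => ((logRem Ψ (Complex.exp (s * Complex.I))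
      (Complex.exp (t * Complex.I))).re / (2 * Real.pi)) •
        (!![0, -1; 1, 0] : Matrix (Fin 2) (Fin 2) ℝ) := hr.smul continuous_const
  rw [integral_mulVec_apply hK1 (h.isL2_opH hΦ hφ), integral_mulVec_apply hrJ hφ]
  have hH : ∀ j, _ := fun j => h.integral_circleK_mul hΦ (hφ j) (h.isHilbertTransform hΦ (hφ j)) t
  fin_cases i
  · simpa [Matrix.mulVec, dotProduct, opH] using congrArg Neg.neg (hH 1)
  · simpa [Matrix.mulVec, dotProduct, opH] using hH 0

theorem IsDiscExtension.opT_eq (h : IsDiscExtension Φ q Ψ R) (hΦ : IsRiemannMap Ω Φ)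
    {lam mu : ℝ} (hlm : 2 * mu + lam ≠ 0) {φ : ℂ → Fin 2 → ℝ} (hφ : ∀ i, IsL2 q fun y => φ y i)
    (t : ℝ) :
    opT lam mu Ω Φ q φ (q t) = ∫ s in (-Real.pi)..Real.pi,
      (circleT lam mu Ψ (Complex.exp (s * Complex.I)) (Complex.exp (t * Complex.I))).mulVec
        (φ (q s)) := by
  set r : ℝ → ℝ := fun s =>
    (logRem Ψ (Complex.exp (s * Complex.I)) (Complex.exp (t * Complex.I))).re / (2 * Real.pi)
  have hr : Continuous r :=
    (Complex.continuous_re.comp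
      (h.continuous_logRem.comp (f := fun s : ℝ => (t, s)) (by fun_prop))).div_const _
  have hT : Continuous fun s : ℝ =>
      circleT lam mu Ψ (Complex.exp (s * Complex.I)) (Complex.exp (t * Complex.I)) :=
    (h.continuous_circleT lam mu).comp (f := fun s : ℝ => (t, s)) (by fun_prop)
  have hA : Continuous fun s => r s • (!![0, -1; 1, 0] : Matrix (Fin 2) (Fin 2) ℝ) :=
    hr.smul continuous_const
  have hB : Continuous fun s : ℝ =>
      circleT lam mu Ψ (Complex.exp (s * Complex.I)) (Complex.exp (t * Complex.I)) -
        (2 * k0 lam mu * r s) • (!![0, -1; 1, 0] : Matrix (Fin 2) (Fin 2) ℝ) :=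
    hT.sub ((continuous_const.mul hr).smul continuous_const)
  have e2 : integralOp (kernelT2 lam mu) q φ (q t) = ∫ s in (-Real.pi)..Real.pi,
      (circleT lam mu Ψ (Complex.exp (s * Complex.I)) (Complex.exp (t * Complex.I)) -
        (2 * k0 lam mu * r s) • (!![0, -1; 1, 0] : Matrix (Fin 2) (Fin 2) ℝ)).mulVec
          (φ (q s)) := by
    refine intervalIntegral.integral_congr_ae ?_
    filter_upwards [ae_exp_mul_I_ne t] with s hs _
    rw [← h.elasticForm_eq hlm hs, ← norm_smul_kernelT2 lam mu (h.deriv_param_ne_zero s),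
      ← Matrix.smul_mulVec]
  have hAi : IntervalIntegrable (fun s => (2 * k0 lam mu) •
      (r s • (!![0, -1; 1, 0] : Matrix (Fin 2) (Fin 2) ℝ)).mulVec (φ (q s))) volume
        (-Real.pi) Real.pi := (intervalIntegrable_mulVec hA hφ).smul (2 * k0 lam mu)
  rw [opT, h.integralOp_kernelB_opH hΦ hφ, e2, ← intervalIntegral.integral_smul,
    ← intervalIntegral.integral_add hAi (intervalIntegrable_mulVec hB hφ)]
  refine intervalIntegral.integral_congr fun s _ => ?_
  rw [← Matrix.smul_mulVec, ← Matrix.add_mulVec, smul_smul, add_sub_cancel]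

theorem IsDiscExtension.isKernelOfOpT (h : IsDiscExtension Φ q Ψ R) (hΦ : IsRiemannMap Ω Φ)
    {lam mu : ℝ} (hlm : 2 * mu + lam ≠ 0) :
    IsKernelOfOpT lam mu Ω Φ q fun t s =>
      circleT lam mu Ψ (Complex.exp (s * Complex.I)) (Complex.exp (t * Complex.I)) := by
  have hper : ∀ t : ℝ, Complex.exp (((t + 2 * Real.pi : ℝ) : ℂ) * Complex.I) =
      Complex.exp (t * Complex.I) := fun t => by
    push_cast
    rw [add_mul, Complex.exp_periodic]
  exact ⟨h.continuous_circleT lam mu, fun t s => by simp only [hper], fun t s => by simp only [hper],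
    fun φ hφ t => h.opT_eq hΦ hlm hφ t⟩

/-- The difference of two kernels annihilates all square integrable densities, in particular its own
rows. -/
theorem IsDiscExtension.isKernelOfOpT_unique (h : IsDiscExtension Φ q Ψ R) {lam mu : ℝ}
    {T T' : ℝ → ℝ → Matrix (Fin 2) (Fin 2) ℝ} (hT : IsKernelOfOpT lam mu Ω Φ q T)
    (hT' : IsKernelOfOpT lam mu Ω Φ q T') : T' = T := by
  have hc : ∀ {S : ℝ → ℝ → Matrix (Fin 2) (Fin 2) ℝ}, IsKernelOfOpT lam mu Ω Φ q S → ∀ t,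
      Continuous (S t) := fun hS t =>
    hS.continuous.comp (f := fun s : ℝ => (t, s)) (by fun_prop)
  funext t s
  ext i j
  set w : ℝ → Fin 2 → ℝ := fun s j => T' t s i j - T t s i j
  have hw : ∀ j, Continuous fun s => w s j := fun j =>
    ((hc hT' t).matrix_elem i j).sub ((hc hT t).matrix_elem i j)
  have hwper : Function.Periodic w (2 * Real.pi) := fun s => by
    simp only [w, hT.periodic_right, hT'.periodic_right]
  obtain ⟨φ, hφ⟩ := h.exists_density w
  have hae : ∀ᵐ s ∂volume.restrict (Ioc (-Real.pi) Real.pi), φ (q s) = w s := by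
    filter_upwards [ae_mem_Ico] with s hs using hφ s hs
  have hφ2 : ∀ j, IsL2 q fun y => φ y j := fun j => by
    refine (memLp_congr_ae (g := fun s => w s j) (hae.mono fun s hs => congrFun hs j)).2 ?_
    obtain ⟨C, hC⟩ := isCompact_Icc.exists_bound_of_continuousOn
      (hw j).continuousOn (s := Icc (-Real.pi) Real.pi)
    refine MemLp.of_bound (hw j).aestronglyMeasurable C ?_
    filter_upwards [ae_restrict_mem measurableSet_Ioc] with s hs using hC s (Ioc_subset_Icc_self hs)
  have hint := congrFun ((hT.represents φ hφ2 t).symm.trans (hT'.represents φ hφ2 t)) i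
  rw [integral_mulVec_apply (hc hT t) hφ2, integral_mulVec_apply (hc hT' t) hφ2, eq_comm,
    ← sub_eq_zero, ← intervalIntegral.integral_sub
      (intervalIntegrable_mulVec_apply (hc hT' t) hφ2 i)
      (intervalIntegrable_mulVec_apply (hc hT t) hφ2 i)] at hint
  have hsq : ∫ s in (-Real.pi)..Real.pi, (w s 0 ^ 2 + w s 1 ^ 2) = 0 := by
    rw [← hint, intervalIntegral.integral_of_le (by linarith [Real.pi_pos]),
      intervalIntegral.integral_of_le (by linarith [Real.pi_pos])]
    refine integral_congr_ae ?_
    filter_upwards [hae] with s hs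
    simp only [Matrix.mulVec, dotProduct, Fin.sum_univ_two, hs, w]
    ring
  have hzero : ∀ s ∈ Icc (-Real.pi) Real.pi, w s 0 ^ 2 + w s 1 ^ 2 = 0 := by
    by_contra! hne
    obtain ⟨s, hs, hs0⟩ := hne
    have hcont : Continuous fun s => w s 0 ^ 2 + w s 1 ^ 2 := ((hw 0).pow 2).add ((hw 1).pow 2)
    exact (intervalIntegral.integral_pos (by linarith [Real.pi_pos]) hcont.continuousOn
      (fun s _ => by positivity) ⟨s, hs, lt_of_le_of_ne (by positivity) hs0.symm⟩).ne' hsq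
  obtain ⟨y, hy, hsy⟩ := hwper.exists_mem_Ico (by positivity) s (-Real.pi)
  have hy' : y ∈ Icc (-Real.pi) Real.pi := by
    rw [show -Real.pi + 2 * Real.pi = Real.pi by ring] at hy
    exact Ico_subset_Icc_self hy
  have h0 := hzero y hy'
  have hj : w y j = 0 := by
    fin_cases j
    · have : w y 0 ^ 2 = 0 := by linarith [sq_nonneg (w y 0), sq_nonneg (w y 1)]
      exact pow_eq_zero_iff two_ne_zero |>.1 this
    · have : w y 1 ^ 2 = 0 := by linarith [sq_nonneg (w y 0), sq_nonneg (w y 1)]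
      exact pow_eq_zero_iff two_ne_zero |>.1 this
  have := congrFun hsy j
  rw [hj] at this
  exact sub_eq_zero.1 this

end Kernel

end ElasticNP

end

theorem proposition2p1 (Ω : Set ℂ) (hΩ : ElasticNP.IsSimplyConnectedDomain Ω)
    (lam mu : ℝ) (hlm : 2 * mu + lam ≠ 0) :
    (∀ (k : ℕ) (α : ℝ≥0), α < 1 → 2 < (k : ℝ) + (α : ℝ) →
      ∀ q : ℝ → ℂ, ElasticNP.IsRegularParam Ω q → ElasticNP.IsCkHolder k α q →
        ElasticNP.IsCkHolderKernel (k - 2) α q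
          (ElasticNP.paramKernel ElasticNP.kernelB q) ∧
        ElasticNP.IsCkHolderKernel (k - 2) α q
          (ElasticNP.paramKernel (ElasticNP.kernelT2 lam mu) q)) ∧
    (ElasticNP.HasAnalyticBoundary Ω →
      ∀ (Φ : ℂ → ℂ) (q : ℝ → ℂ), ElasticNP.IsRiemannMap Ω Φ →
        ElasticNP.IsParamByRiemannMap Φ q →
        ∀ ε : ℝ, 0 < ε → ENNReal.ofReal ε < ElasticNP.grauertRadius q →
          ∃ T : ℝ → ℝ → Matrix (Fin 2) (Fin 2) ℝ,
            ElasticNP.IsKernelOfOpT lam mu Ω Φ q T ∧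
            (∀ T', ElasticNP.IsKernelOfOpT lam mu Ω Φ q T' → T' = T) ∧
            ∃ C : ℝ, ∀ (n : ℤ), ∀ s ∈ Set.Ico (-Real.pi) Real.pi, ∀ i j : Fin 2,
              ‖ElasticNP.fourierCoeffKernel T n s i j‖ ≤ C * Real.exp (-ε * |(n : ℝ)|)) := by
  refine ⟨fun k α hα hk q hq hqk =>
    ElasticNP.isCkHolderKernel_kernelB_kernelT2 lam mu hα hk hq hqk,
    fun hb Φ q hΦ hq ε hε hεq => ?_⟩
  obtain ⟨R, Ψ, hεR, h⟩ := ElasticNP.exists_isDiscExtension hΩ.isOpen hb hΦ hq hεq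
  have hT := h.isKernelOfOpT hΦ hlm
  obtain ⟨C, hC⟩ := h.exists_fourierCoeffKernel_bound hε hεR lam mu
  exact ⟨_, hT, fun T' hT' => h.isKernelOfOpT_unique hT hT', C, fun n s _ i j => hC n s i j⟩
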